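/- **Setting.** Let $A$ be a unital $*$-algebra over $\mathbb C$ and $\Omega^1$ a $*$-bimodule over $A$, i.e. an $A$-bimodule with an antilinear involution satisfying $(a\omega)^*=\omega^*a^*$. Suppose $\Omega^1$ is finitely generated projective on both sides with pivotal dual $\mathfrak X$: that is, $\mathfrak X$ is an $A$-bimodule with bimodule maps ${\rm ev}^L:\mathfrak X\otimes_A\Omega^1\to A$, ${\rm ev}^R:\Omega^1\otimes_A\mathfrak X\to A$ and elements ${\rm coev}^L(1)=\sum_i\omega_i\otimes x_i\in\Omega^1\otimes_A\mathfrak X$, ${\rm coev}^R(1)=\sum_j y_j\otimes\eta_j\in\mathfrak X\otimes_A\Omega^1$ such that for all $\omega\in\Omega^1$, $x\in\mathfrak X$ $$\omega=\sum_i\omega_i\,{\rm ev}^L(x_i,\omega),\quad x=\sum_i{\rm ev}^L(x,\omega_i)x_i,\quad \omega=\sum_j{\rm ev}^R(\omega,y_j)\eta_j,\quad x=\sum_j y_j\,{\rm ev}^R(\eta_j,x).$$ Let $\circledast:\mathfrak X\to\mathfrak X$ be the bijection determined by ${\rm ev}^R(\omega,x^\circledast)={\rm ev}^L(x,\omega^*)^*$;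 its inverse is determined by ${\rm ev}^L(y^{\circledast^{-1}},\omega)={\rm ev}^R(\omega^*,y)^*$. Write $\underline a$ for $a\in A$ viewed in $A^{op}$. Ghobadi's algebra $IIB(\Omega^1)$ is the $\mathbb C$-algebra generated by $A$ and $A^{op}$, commuting with each other, and by symbols $(x,\omega)$, $(\omega,y)$ ($x,y\in\mathfrak X$, $\omega\in\Omega^1$), bilinear over $\mathbb C$, with relations $$a\underline b(x,\omega)c\underline d=(axc,d\omega b),\qquad a\underline b(\omega,y)c\underline d=(a\omega c,dyb),$$ $$\sum_i(\omega_i,y)(x_i,\omega)=\underline{{\rm ev}^R(\omega,y)},\qquad \sum_j(x,\eta_j)(\omega,y_j)={\rm ev}^L(x,\omega),$$ $$\sum_j(y_j,\omega)(\eta_j,x)=\underline{{\rm ev}^L(x,\omega)},\qquad \sum_i(\omega,x_i)(x,\omega_i)={\rm ev}^R(\omega,x).$$ **Full $\star$-Hopf algebroids.** Left and right bialgebroids have the usual meaning, with $a.X.b=s_L(a)t_L(b)X$ in the left case and $a.X.b=Xt_R(a)s_R(b)$ in the right case; write $\Delta_L(X)=X_{(1)}\otimes X_{(2)}$ and $\Delta_R(X)=X_{[1]}\otimes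 X_{[2]}$. A full Hopf algebroid is a left $B$-bialgebroid $L$ with an invertible anti-algebra map $S:L\to L$ such that $S t_L=s_L$, $$(S^{-1}X_{(2)})_{(1)}\otimes_B(S^{-1}X_{(2)})_{(2)}X_{(1)}=S^{-1}(X)\otimes_B1,\qquad S(X_{(1)})_{(1)}X_{(2)}\otimes_BS(X_{(1)})_{(2)}=1\otimes_BS(X),$$ together with the right $B^{op}$-bialgebroid $R$ on the same algebra given by $s_R(\underline b)=t_L(b)$, $t_R(\underline b)=S^{-1}(t_L(b))$, $\varepsilon_R(X)=\underline{\varepsilon_L(S X)}$, $\Delta_R(X)=S(S^{-1}(X)_{(2)})\otimes S(S^{-1}(X)_{(1)})$; the two satisfy $s_L(B)=t_R(B^{op})$, $t_L(B)=s_R(B^{op})$, $({\rm id}\otimes\Delta_R)\Delta_L=(\Delta_L\otimes{\rm id})\Delta_R$ and $({\rm id}\otimes\Delta_L)\Delta_R=(\Delta_R\otimes{\rm id})\Delta_L$. If $B$ is a $*$-algebra, it is a full $\star$-Hopf algebroid if $L$ is a $\star$-algebra with, for all $b\in B$, $X\in L$, $$s_L(b)^\star=t_R(\underline{b^*}),\quad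 t_L(b)^\star=s_R(\underline{b^*}),\quad \underline{\varepsilon_L(X^\star)}=\varepsilon_R(X)^*,\quad \Delta_R(X^\star)=X_{(1)}^\star\otimes X_{(2)}^\star.$$ **Proposition 5.3.** If $\circledast=\circledast^{-1}$, then $IIB(\Omega^1)$ is a full $\star$-Hopf algebroid over $B=A$ with $$s_L(a)=a,\quad t_L(a)=\underline a,\quad \Delta_L(\omega,y)=\sum_j(\omega,y_j)\otimes(\eta_j,y),\quad \Delta_L(x,\omega)=\sum_i(x,\omega_i)\otimes(x_i,\omega),$$ $$\varepsilon_L(\omega,y)={\rm ev}^R(\omega,y),\quad \varepsilon_L(x,\omega)={\rm ev}^L(x,\omega),\quad S(x,\omega)=(\omega,x),\quad S(\omega,x)=(x,\omega),$$ $$s_R(\underline a)=\underline a,\quad t_R(\underline a)=a,\quad \Delta_R(\omega,y)=\sum_i(\omega,x_i)\otimes(\omega_i,y),\quad \Delta_R(x,\omega)=\sum_j(x,\eta_j)\otimes(y_j,\omega),$$ $$\varepsilon_R(\omega,y)=\underline{{\rm ev}^L(y,\omega)},\quad \varepsilon_R(x,\omega)=\underline{{\rm ev}^R(\omega,x)},$$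 and $\star$-structure $$s_L(a)^\star=a^*,\quad t_L(a)^\star=\underline{a^*},\quad (\omega,y)^\star=(\omega^*,y^\circledast),\quad (x,\omega)^\star=(x^\circledast,\omega^*).$$ -/

import Mathlib

open scoped TensorProduct

noncomputable section

/-! ## Balanced tensor products

All algebras and modules are over `ℂ`. A balanced tensor product of two copies of `H` is formed with
respect to a family `ρ b` of endomorphisms of the first factor (a right action) and a family `l b`
of endomorphisms of the second factor (a left action). -/

section Balanced

variable {H : Type*} [Ring H] [Algebra ℂ H] {B C : Type*}

/-- The span of the elements `ρ b X ⊗ Y - X ⊗ l b Y`. -/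
def balSub (ρ l : B → Module.End ℂ H) : Submodule ℂ (H ⊗[ℂ] H) :=
  Submodule.span ℂ {w | ∃ (b : B) (X Y : H), w = (ρ b X) ⊗ₜ[ℂ] Y - X ⊗ₜ[ℂ] (l b Y)}

/-- The balanced tensor product `H ⊗ H / (ρ b X ⊗ Y = X ⊗ l b Y)`. -/
abbrev BalTensor (ρ l : B → Module.End ℂ H) : Type _ := (H ⊗[ℂ] H) ⧸ balSub ρ l

/-- The relations of a threefold balanced tensor product: the pair `ρ₁`, `l₁` balances the first and
second factors, and the pair `ρ₂`, `l₂` balances the second and third ones. -/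
def balSub₃ (ρ₁ l₁ : B → Module.End ℂ H) (ρ₂ l₂ : C → Module.End ℂ H) :
    Submodule ℂ (H ⊗[ℂ] (H ⊗[ℂ] H)) :=
  Submodule.span ℂ
    ({w | ∃ (b : B) (X Y Z : H),
        w = (ρ₁ b X) ⊗ₜ[ℂ] (Y ⊗ₜ[ℂ] Z) - X ⊗ₜ[ℂ] ((l₁ b Y) ⊗ₜ[ℂ] Z)} ∪
     {w | ∃ (c : C) (X Y Z : H),
        w = X ⊗ₜ[ℂ] ((ρ₂ c Y) ⊗ₜ[ℂ] Z) - X ⊗ₜ[ℂ] (Y ⊗ₜ[ℂ] (l₂ c Z))})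

/-- The threefold balanced tensor product `H ⊗_B H ⊗_C H`. -/
abbrev BalTensor₃ (ρ₁ l₁ : B → Module.End ℂ H) (ρ₂ l₂ : C → Module.End ℂ H) : Type _ :=
  (H ⊗[ℂ] (H ⊗[ℂ] H)) ⧸ balSub₃ ρ₁ l₁ ρ₂ l₂

/-- The canonical map `H ⊗ (H ⊗_C H) → H ⊗_B H ⊗_C H`. -/
def balAssocR (ρ₁ l₁ : B → Module.End ℂ H) (ρ₂ l₂ : C → Module.End ℂ H) :
    H ⊗[ℂ] BalTensor ρ₂ l₂ →ₗ[ℂ] BalTensor₃ ρ₁ l₁ ρ₂ l₂ :=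
  TensorProduct.lift
    { toFun := fun X => (balSub ρ₂ l₂).liftQ
        ((balSub₃ ρ₁ l₁ ρ₂ l₂).mkQ ∘ₗ TensorProduct.mk ℂ H (H ⊗[ℂ] H) X) (by
          refine Submodule.span_le.2 ?_
          rintro _ ⟨c, Y, Z, rfl⟩
          simp only [SetLike.mem_coe, LinearMap.mem_ker, LinearMap.comp_apply,
            TensorProduct.mk_apply, Submodule.mkQ_apply, Submodule.Quotient.mk_eq_zero,
            TensorProduct.tmul_sub]
          exact Submodule.subset_span (Or.inr ⟨c, X, Y, Z, rfl⟩))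
      map_add' := fun X X' => by
        refine Submodule.linearMap_qext _ (LinearMap.ext fun w => ?_)
        change (balSub₃ ρ₁ l₁ ρ₂ l₂).mkQ ((X + X') ⊗ₜ[ℂ] w) =
          (balSub₃ ρ₁ l₁ ρ₂ l₂).mkQ (X ⊗ₜ[ℂ] w) + (balSub₃ ρ₁ l₁ ρ₂ l₂).mkQ (X' ⊗ₜ[ℂ] w)
        rw [TensorProduct.add_tmul, map_add]
      map_smul' := fun r X => by
        refine Submodule.linearMap_qext _ (LinearMap.ext fun w => ?_)
        change (balSub₃ ρ₁ l₁ ρ₂ l₂).mkQ ((r • X) ⊗ₜ[ℂ] w) =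
          r • (balSub₃ ρ₁ l₁ ρ₂ l₂).mkQ (X ⊗ₜ[ℂ] w)
        rw [← TensorProduct.smul_tmul', map_smul] }

/-- The canonical map `(H ⊗_B H) ⊗ H → H ⊗_B H ⊗_C H`. -/
def balAssocL (ρ₁ l₁ : B → Module.End ℂ H) (ρ₂ l₂ : C → Module.End ℂ H) :
    BalTensor ρ₁ l₁ ⊗[ℂ] H →ₗ[ℂ] BalTensor₃ ρ₁ l₁ ρ₂ l₂ :=
  TensorProduct.lift <| LinearMap.flip
    { toFun := fun Z => (balSub ρ₁ l₁).liftQ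
        ((balSub₃ ρ₁ l₁ ρ₂ l₂).mkQ ∘ₗ (TensorProduct.assoc ℂ H H H).toLinearMap ∘ₗ
          (TensorProduct.mk ℂ (H ⊗[ℂ] H) H).flip Z) (by
          refine Submodule.span_le.2 ?_
          rintro _ ⟨b, X, Y, rfl⟩
          change (balSub₃ ρ₁ l₁ ρ₂ l₂).mkQ (TensorProduct.assoc ℂ H H H
            ((ρ₁ b X ⊗ₜ[ℂ] Y - X ⊗ₜ[ℂ] l₁ b Y) ⊗ₜ[ℂ] Z)) = 0
          rw [TensorProduct.sub_tmul, map_sub, TensorProduct.assoc_tmul, TensorProduct.assoc_tmul,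
            Submodule.mkQ_apply, Submodule.Quotient.mk_eq_zero]
          exact Submodule.subset_span (Or.inl ⟨b, X, Y, Z, rfl⟩))
      map_add' := fun Z Z' => by
        refine Submodule.linearMap_qext _ (LinearMap.ext fun w => ?_)
        change (balSub₃ ρ₁ l₁ ρ₂ l₂).mkQ (TensorProduct.assoc ℂ H H H (w ⊗ₜ[ℂ] (Z + Z'))) =
          (balSub₃ ρ₁ l₁ ρ₂ l₂).mkQ (TensorProduct.assoc ℂ H H H (w ⊗ₜ[ℂ] Z)) +
            (balSub₃ ρ₁ l₁ ρ₂ l₂).mkQ (TensorProduct.assoc ℂ H H H (w ⊗ₜ[ℂ] Z'))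
        rw [TensorProduct.tmul_add, map_add, map_add]
      map_smul' := fun r Z => by
        refine Submodule.linearMap_qext _ (LinearMap.ext fun w => ?_)
        change (balSub₃ ρ₁ l₁ ρ₂ l₂).mkQ (TensorProduct.assoc ℂ H H H (w ⊗ₜ[ℂ] (r • Z))) =
          r • (balSub₃ ρ₁ l₁ ρ₂ l₂).mkQ (TensorProduct.assoc ℂ H H H (w ⊗ₜ[ℂ] Z))
        rw [TensorProduct.tmul_smul, map_smul, map_smul] }

theorem balAssocR_tmul (ρ₁ l₁ : B → Module.End ℂ H) (ρ₂ l₂ : C → Module.End ℂ H) (X Y Z : H) :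
    balAssocR ρ₁ l₁ ρ₂ l₂ (X ⊗ₜ[ℂ] (balSub ρ₂ l₂).mkQ (Y ⊗ₜ[ℂ] Z)) =
      (balSub₃ ρ₁ l₁ ρ₂ l₂).mkQ (X ⊗ₜ[ℂ] (Y ⊗ₜ[ℂ] Z)) := rfl

theorem balAssocL_tmul (ρ₁ l₁ : B → Module.End ℂ H) (ρ₂ l₂ : C → Module.End ℂ H) (X Y Z : H) :
    balAssocL ρ₁ l₁ ρ₂ l₂ ((balSub ρ₁ l₁).mkQ (X ⊗ₜ[ℂ] Y) ⊗ₜ[ℂ] Z) =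
      (balSub₃ ρ₁ l₁ ρ₂ l₂).mkQ (X ⊗ₜ[ℂ] (Y ⊗ₜ[ℂ] Z)) := rfl

end Balanced

/-! ## Left and right bialgebroids -/

section Bialgebroids

open MulOpposite (op unop)

variable {B H : Type*} [Ring B] [Algebra ℂ B] [Ring H] [Algebra ℂ H]

/-- The right `B`-action `X . b = t b * X` of a left bialgebroid. -/
def leftActR (t : Bᵐᵒᵖ →ₐ[ℂ] H) (b : B) : Module.End ℂ H := LinearMap.mulLeft ℂ (t (op b))

/-- The left `B`-action `b . X = s b * X` of a left bialgebroid. -/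
def leftActL (s : B →ₐ[ℂ] H) (b : B) : Module.End ℂ H := LinearMap.mulLeft ℂ (s b)

/-- The right `B`-action `X . b = X * s b` of a right bialgebroid. -/
def rightActR (s : B →ₐ[ℂ] H) (b : B) : Module.End ℂ H := LinearMap.mulRight ℂ (s b)

/-- The left `B`-action `b . X = X * t b` of a right bialgebroid. -/
def rightActL (t : Bᵐᵒᵖ →ₐ[ℂ] H) (b : B) : Module.End ℂ H := LinearMap.mulRight ℂ (t (op b))

/-- `H ⊗_B H` for a left bialgebroid: `t b * X ⊗ Y = X ⊗ s b * Y`. -/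
abbrev LTensor (s : B →ₐ[ℂ] H) (t : Bᵐᵒᵖ →ₐ[ℂ] H) : Type _ :=
  BalTensor (leftActR t) (leftActL s)

/-- `H ⊗_B H` for a right bialgebroid: `X * s b ⊗ Y = X ⊗ Y * t b`. -/
abbrev RTensor (s : B →ₐ[ℂ] H) (t : Bᵐᵒᵖ →ₐ[ℂ] H) : Type _ :=
  BalTensor (rightActR s) (rightActL t)

/-- The class in `H ⊗_B H` (left bialgebroid version) of an element of `H ⊗ H`. -/
abbrev LTensor.cls (s : B →ₐ[ℂ] H) (t : Bᵐᵒᵖ →ₐ[ℂ] H) : H ⊗[ℂ] H →ₗ[ℂ] LTensor s t :=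
  (balSub (leftActR t) (leftActL s)).mkQ

/-- The class in `H ⊗_B H` (right bialgebroid version) of an element of `H ⊗ H`. -/
abbrev RTensor.cls (s : B →ₐ[ℂ] H) (t : Bᵐᵒᵖ →ₐ[ℂ] H) : H ⊗[ℂ] H →ₗ[ℂ] RTensor s t :=
  (balSub (rightActR s) (rightActL t)).mkQ

/-- The defining relations of `H ⊗_B H` form a right ideal of the algebra `H ⊗ H`, so that `H ⊗ H`
acts on `H ⊗_B H` from the right: `LTensor.rmul (U ⊗ V) [X ⊗ Y] = [X * U ⊗ Y * V]`. -/
def LTensor.rmul (s : B →ₐ[ℂ] H) (t : Bᵐᵒᵖ →ₐ[ℂ] H) (w : H ⊗[ℂ] H) :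
    LTensor s t →ₗ[ℂ] LTensor s t :=
  Submodule.mapQ _ _ (LinearMap.mulRight ℂ w) (by
    refine Submodule.span_le.2 ?_
    rintro _ ⟨b, X, Y, rfl⟩
    simp only [SetLike.mem_coe, Submodule.mem_comap, LinearMap.mulRight_apply]
    induction w using TensorProduct.induction_on with
    | zero => simp
    | tmul U V =>
      refine Submodule.subset_span ⟨b, X * U, Y * V, ?_⟩
      simp [sub_mul, leftActR, leftActL, mul_assoc]
    | add u v hu hv => rw [mul_add]; exact add_mem hu hv)

theorem LTensor.rmul_cls (s : B →ₐ[ℂ] H) (t : Bᵐᵒᵖ →ₐ[ℂ] H) (w u : H ⊗[ℂ] H) :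
    LTensor.rmul s t w (LTensor.cls s t u) = LTensor.cls s t (u * w) := rfl

/-- The map `X ⊗ Y ↦ Δ (f Y) · (1 ⊗ X)`, that is, `X ⊗ Y ↦ (f Y)₁ ⊗_B (f Y)₂ * X`. -/
def LTensor.twistOne (s : B →ₐ[ℂ] H) (t : Bᵐᵒᵖ →ₐ[ℂ] H) (Δ : H →ₗ[ℂ] LTensor s t)
    (f : H →ₗ[ℂ] H) : H ⊗[ℂ] H →ₗ[ℂ] LTensor s t :=
  TensorProduct.lift (LinearMap.mk₂ ℂ
    (fun X Y => LTensor.rmul s t (1 ⊗ₜ[ℂ] X) (Δ (f Y)))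
    (fun X X' Y => by
      obtain ⟨u, hu⟩ := Submodule.mkQ_surjective _ (Δ (f Y))
      simp only [← hu, LTensor.rmul_cls, TensorProduct.tmul_add, mul_add, map_add])
    (fun r X Y => by
      obtain ⟨u, hu⟩ := Submodule.mkQ_surjective _ (Δ (f Y))
      simp only [← hu, LTensor.rmul_cls, TensorProduct.tmul_smul, mul_smul_comm, map_smul])
    (fun X Y Y' => by simp only [map_add])
    (fun r X Y => by simp only [map_smul]))

/-- The map `X ⊗ Y ↦ Δ (f X) · (Y ⊗ 1)`, that is, `X ⊗ Y ↦ (f X)₁ * Y ⊗_B (f X)₂`. -/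
def LTensor.twistTwo (s : B →ₐ[ℂ] H) (t : Bᵐᵒᵖ →ₐ[ℂ] H) (Δ : H →ₗ[ℂ] LTensor s t)
    (f : H →ₗ[ℂ] H) : H ⊗[ℂ] H →ₗ[ℂ] LTensor s t :=
  TensorProduct.lift (LinearMap.mk₂ ℂ
    (fun X Y => LTensor.rmul s t (Y ⊗ₜ[ℂ] 1) (Δ (f X)))
    (fun X X' Y => by simp only [map_add])
    (fun r X Y => by simp only [map_smul])
    (fun X Y Y' => by
      obtain ⟨u, hu⟩ := Submodule.mkQ_surjective _ (Δ (f X))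
      simp only [← hu, LTensor.rmul_cls, TensorProduct.add_tmul, mul_add, map_add])
    (fun r X Y => by
      obtain ⟨u, hu⟩ := Submodule.mkQ_surjective _ (Δ (f X))
      simp only [← hu, LTensor.rmul_cls, ← TensorProduct.smul_tmul', mul_smul_comm, map_smul]))

variable (B H)

/-- A left bialgebroid over `B` with total algebra `H`. Identities in Sweedler notation are stated
for every representative `u : H ⊗ H` of a coproduct `Δ X ∈ H ⊗_B H`. -/
structure LeftBialgebroid where
  /-- the source map -/
  s : B →ₐ[ℂ] H
  /-- the target map, an anti-algebra map on `B` -/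
  t : Bᵐᵒᵖ →ₐ[ℂ] H
  comm : ∀ a b : B, s a * t (op b) = t (op b) * s a
  /-- the coproduct -/
  Δ : H →ₗ[ℂ] LTensor s t
  /-- the counit -/
  ε : H →ₗ[ℂ] B
  /-- `Δ` is a bimodule map for `a . X . b = s a * t b * X` -/
  Δ_bimod : ∀ (a b : B) (X : H) (u : H ⊗[ℂ] H), LTensor.cls s t u = Δ X →
    Δ (s a * t (op b) * X) = LTensor.cls s t ((s a ⊗ₜ[ℂ] t (op b)) * u)
  /-- `ε` is a bimodule map -/
  ε_bimod : ∀ (a b : B) (X : H), ε (s a * t (op b) * X) = a * ε X * b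
  /-- `(id ⊗ Δ) Δ = (Δ ⊗ id) Δ` in `H ⊗_B H ⊗_B H` -/
  coassoc : ∀ (X : H) (u v : H ⊗[ℂ] H), LTensor.cls s t u = Δ X → LTensor.cls s t v = Δ X →
    balAssocR (leftActR t) (leftActL s) (leftActR t) (leftActL s) (Δ.lTensor H u) =
      balAssocL (leftActR t) (leftActL s) (leftActR t) (leftActL s) (Δ.rTensor H v)
  /-- `s (ε X₁) * X₂ = X` -/
  counit_left : ∀ (X : H) (u : H ⊗[ℂ] H), LTensor.cls s t u = Δ X →
    LinearMap.mul' ℂ H (TensorProduct.map (s.toLinearMap ∘ₗ ε) LinearMap.id u) = X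
  /-- `t (ε X₂) * X₁ = X` -/
  counit_right : ∀ (X : H) (u : H ⊗[ℂ] H), LTensor.cls s t u = Δ X →
    LinearMap.mul' ℂ H (TensorProduct.map
      (t.toLinearMap ∘ₗ (MulOpposite.opLinearEquiv ℂ).toLinearMap ∘ₗ ε) LinearMap.id
      (TensorProduct.comm ℂ H H u)) = X
  /-- `Δ` takes values in the Takeuchi product: `X₁ * t a ⊗ X₂ = X₁ ⊗ X₂ * s a` -/
  takeuchi : ∀ (a : B) (X : H) (u : H ⊗[ℂ] H), LTensor.cls s t u = Δ X →
    LTensor.cls s t (u * (t (op a) ⊗ₜ[ℂ] 1)) = LTensor.cls s t (u * (1 ⊗ₜ[ℂ] s a))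
  Δ_one : Δ 1 = LTensor.cls s t 1
  Δ_mul : ∀ (X Y : H) (u v : H ⊗[ℂ] H), LTensor.cls s t u = Δ X → LTensor.cls s t v = Δ Y →
    Δ (X * Y) = LTensor.cls s t (u * v)
  ε_one : ε 1 = 1
  ε_mul_s : ∀ X Y : H, ε (X * Y) = ε (X * s (ε Y))
  ε_mul_t : ∀ X Y : H, ε (X * Y) = ε (X * t (op (ε Y)))

/-- A right bialgebroid over `B` with total algebra `H`. Identities in Sweedler notation are stated
for every representative `u : H ⊗ H` of a coproduct `Δ X ∈ H ⊗_B H`. -/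
structure RightBialgebroid where
  /-- the source map -/
  s : B →ₐ[ℂ] H
  /-- the target map, an anti-algebra map on `B` -/
  t : Bᵐᵒᵖ →ₐ[ℂ] H
  comm : ∀ a b : B, s a * t (op b) = t (op b) * s a
  /-- the coproduct -/
  Δ : H →ₗ[ℂ] RTensor s t
  /-- the counit -/
  ε : H →ₗ[ℂ] B
  /-- `Δ` is a bimodule map for `a . X . b = X * t a * s b` -/
  Δ_bimod : ∀ (a b : B) (X : H) (u : H ⊗[ℂ] H), RTensor.cls s t u = Δ X →
    Δ (X * t (op a) * s b) = RTensor.cls s t (u * (t (op a) ⊗ₜ[ℂ] s b))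
  /-- `ε` is a bimodule map -/
  ε_bimod : ∀ (a b : B) (X : H), ε (X * t (op a) * s b) = a * ε X * b
  /-- `(id ⊗ Δ) Δ = (Δ ⊗ id) Δ` in `H ⊗_B H ⊗_B H` -/
  coassoc : ∀ (X : H) (u v : H ⊗[ℂ] H), RTensor.cls s t u = Δ X → RTensor.cls s t v = Δ X →
    balAssocR (rightActR s) (rightActL t) (rightActR s) (rightActL t) (Δ.lTensor H u) =
      balAssocL (rightActR s) (rightActL t) (rightActR s) (rightActL t) (Δ.rTensor H v)
  /-- `X₂ * t (ε X₁) = X` -/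
  counit_left : ∀ (X : H) (u : H ⊗[ℂ] H), RTensor.cls s t u = Δ X →
    LinearMap.mul' ℂ H (TensorProduct.comm ℂ H H (TensorProduct.map
      (t.toLinearMap ∘ₗ (MulOpposite.opLinearEquiv ℂ).toLinearMap ∘ₗ ε) LinearMap.id u)) = X
  /-- `X₁ * s (ε X₂) = X` -/
  counit_right : ∀ (X : H) (u : H ⊗[ℂ] H), RTensor.cls s t u = Δ X →
    LinearMap.mul' ℂ H (TensorProduct.map LinearMap.id (s.toLinearMap ∘ₗ ε) u) = X
  /-- `Δ` takes values in the Takeuchi product: `s a * X₁ ⊗ X₂ = X₁ ⊗ t a * X₂` -/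
  takeuchi : ∀ (a : B) (X : H) (u : H ⊗[ℂ] H), RTensor.cls s t u = Δ X →
    RTensor.cls s t ((s a ⊗ₜ[ℂ] 1) * u) = RTensor.cls s t ((1 ⊗ₜ[ℂ] t (op a)) * u)
  Δ_one : Δ 1 = RTensor.cls s t 1
  Δ_mul : ∀ (X Y : H) (u v : H ⊗[ℂ] H), RTensor.cls s t u = Δ X → RTensor.cls s t v = Δ Y →
    Δ (X * Y) = RTensor.cls s t (u * v)
  ε_one : ε 1 = 1
  ε_mul_s : ∀ X Y : H, ε (X * Y) = ε (s (ε X) * Y)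
  ε_mul_t : ∀ X Y : H, ε (X * Y) = ε (t (op (ε X)) * Y)

/-! ## Full Hopf algebroids and full `⋆`-Hopf algebroids -/

/-- A full Hopf algebroid `(L, R, S)` with total algebra `H`: a left bialgebroid `L` over `B` with
an invertible anti-algebra map `S` (the antipode), together with the right bialgebroid `R` over the
opposite algebra of `B` that `L` and `S` determine. -/
structure FullHopfAlgebroid where
  /-- the left bialgebroid -/
  L : LeftBialgebroid B H
  /-- the antipode -/
  S : H ≃ₗ[ℂ] H
  S_one : S 1 = 1
  S_mul : ∀ X Y : H, S (X * Y) = S Y * S X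
  S_t : ∀ b : B, S (L.t (op b)) = L.s b
  /-- `(S⁻¹ X₂)₁ ⊗_B (S⁻¹ X₂)₂ * X₁ = S⁻¹ X ⊗_B 1` -/
  antipode_inv : ∀ (X : H) (u : H ⊗[ℂ] H), LTensor.cls L.s L.t u = L.Δ X →
    LTensor.twistOne L.s L.t L.Δ S.symm.toLinearMap u = LTensor.cls L.s L.t (S.symm X ⊗ₜ[ℂ] 1)
  /-- `(S X₁)₁ * X₂ ⊗_B (S X₁)₂ = 1 ⊗_B S X` -/
  antipode : ∀ (X : H) (u : H ⊗[ℂ] H), LTensor.cls L.s L.t u = L.Δ X →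
    LTensor.twistTwo L.s L.t L.Δ S.toLinearMap u = LTensor.cls L.s L.t (1 ⊗ₜ[ℂ] S X)
  /-- the right bialgebroid -/
  R : RightBialgebroid Bᵐᵒᵖ H
  R_s : ∀ b : B, R.s (op b) = L.t (op b)
  R_t : ∀ b : B, R.t (op (op b)) = S.symm (L.t (op b))
  R_ε : ∀ X : H, R.ε X = op (L.ε (S X))
  /-- `Δ_R X = S ((S⁻¹ X)₂) ⊗ S ((S⁻¹ X)₁)` -/
  R_Δ : ∀ (X : H) (u : H ⊗[ℂ] H), LTensor.cls L.s L.t u = L.Δ (S.symm X) →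
    R.Δ X = RTensor.cls R.s R.t
      (TensorProduct.map S.toLinearMap S.toLinearMap (TensorProduct.comm ℂ H H u))
  range_s : Set.range L.s = Set.range R.t
  range_t : Set.range L.t = Set.range R.s
  /-- `(id ⊗_B Δ_R) Δ_L = (Δ_L ⊗ id) Δ_R` -/
  mixed_coassoc_LR : ∀ (X : H) (u v : H ⊗[ℂ] H),
    LTensor.cls L.s L.t u = L.Δ X → RTensor.cls R.s R.t v = R.Δ X →
    balAssocR (leftActR L.t) (leftActL L.s) (rightActR R.s) (rightActL R.t) (R.Δ.lTensor H u) =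
      balAssocL (leftActR L.t) (leftActL L.s) (rightActR R.s) (rightActL R.t) (L.Δ.rTensor H v)
  /-- `(id ⊗ Δ_L) Δ_R = (Δ_R ⊗_B id) Δ_L` -/
  mixed_coassoc_RL : ∀ (X : H) (u v : H ⊗[ℂ] H),
    RTensor.cls R.s R.t u = R.Δ X → LTensor.cls L.s L.t v = L.Δ X →
    balAssocR (rightActR R.s) (rightActL R.t) (leftActR L.t) (leftActL L.s) (L.Δ.lTensor H u) =
      balAssocL (rightActR R.s) (rightActL R.t) (leftActR L.t) (leftActL L.s) (R.Δ.rTensor H v)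

/-- A full `⋆`-Hopf algebroid over the `⋆`-algebra `B`: a full Hopf algebroid whose total algebra is
a `⋆`-algebra, with an involution compatible with the left and right bialgebroid structures. -/
structure FullStarHopfAlgebroid [StarRing B] extends FullHopfAlgebroid B H where
  /-- the antilinear involution `⋆` of the total algebra -/
  st : H →ₛₗ[starRingEnd ℂ] H
  st_st : ∀ X : H, st (st X) = X
  st_mul : ∀ X Y : H, st (X * Y) = st Y * st X
  st_s : ∀ b : B, st (L.s b) = R.t (op (op (star b)))
  st_t : ∀ b : B, st (L.t (op b)) = R.s (op (star b))
  st_ε : ∀ X : H, op (L.ε (st X)) = star (R.ε X)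
  /-- `Δ_R (X⋆) = X₁⋆ ⊗ X₂⋆`, where `Δ_L X = X₁ ⊗ X₂` -/
  st_Δ : ∀ (X : H) (u : H ⊗[ℂ] H), LTensor.cls L.s L.t u = L.Δ X →
    R.Δ (st X) = RTensor.cls R.s R.t (TensorProduct.map st st u)

end Bialgebroids

/-! ## Pivotal duals and the induced map on the dual -/

section Pivotal

open MulOpposite (op unop)

/-- A `*`-bimodule over a `*`-algebra `A`: an `A`-bimodule with an additive involution such that
`(a ω)* = ω* a*`. Right actions are actions of the opposite ring. -/
class StarBimodule (A Ω : Type*) [Ring A] [StarRing A] [AddCommGroup Ω] [Module A Ω]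
    [Module Aᵐᵒᵖ Ω] extends StarAddMonoid Ω where
  star_smul_left : ∀ (a : A) (ω : Ω), star (a • ω) = op (Star.star a) • star ω

variable (A Ω 𝔛 : Type*) [Ring A] [Algebra ℂ A]
  [AddCommGroup Ω] [Module ℂ Ω] [Module A Ω] [Module Aᵐᵒᵖ Ω]
  [AddCommGroup 𝔛] [Module ℂ 𝔛] [Module A 𝔛] [Module Aᵐᵒᵖ 𝔛]

/-- An `A`-bimodule `𝔛` that is at the same time a left and a right dual of the `A`-bimodule `Ω`:
bimodule evaluation maps `evL : 𝔛 ⊗_A Ω → A` and `evR : Ω ⊗_A 𝔛 → A`, with coevaluations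
`coevL 1 = ∑ ωᵢ ⊗ xᵢ` and `coevR 1 = ∑ yⱼ ⊗ ηⱼ` that satisfy the four triangle identities (these
make `Ω` and `𝔛` finitely generated projective on both sides). -/
structure PivotalDual where
  evL : 𝔛 →ₗ[ℂ] Ω →ₗ[ℂ] A
  evL_left : ∀ (a : A) (x : 𝔛) (ω : Ω), evL (a • x) ω = a * evL x ω
  evL_mid : ∀ (a : A) (x : 𝔛) (ω : Ω), evL (op a • x) ω = evL x (a • ω)
  evL_right : ∀ (a : A) (x : 𝔛) (ω : Ω), evL x (op a • ω) = evL x ω * a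
  n : ℕ
  w : Fin n → Ω
  x : Fin n → 𝔛
  coevL_form : ∀ ω : Ω, ∑ i, op (evL (x i) ω) • w i = ω
  coevL_vec : ∀ z : 𝔛, ∑ i, evL z (w i) • x i = z
  evR : Ω →ₗ[ℂ] 𝔛 →ₗ[ℂ] A
  evR_left : ∀ (a : A) (ω : Ω) (y : 𝔛), evR (a • ω) y = a * evR ω y
  evR_mid : ∀ (a : A) (ω : Ω) (y : 𝔛), evR (op a • ω) y = evR ω (a • y)
  evR_right : ∀ (a : A) (ω : Ω) (y : 𝔛), evR ω (op a • y) = evR ω y * a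
  m : ℕ
  y : Fin m → 𝔛
  η : Fin m → Ω
  coevR_form : ∀ ω : Ω, ∑ j, evR ω (y j) • η j = ω
  coevR_vec : ∀ z : 𝔛, ∑ j, op (evR (η j) z) • y j = z

variable {A Ω 𝔛} [StarRing A] [StarBimodule A Ω]

namespace PivotalDual

variable (D : PivotalDual A Ω 𝔛)

/-- The map `⊛ : 𝔛 → 𝔛` determined by `evR ω (x⊛) = (evL x ω*)*`. -/
def toCirc (z : 𝔛) : 𝔛 := ∑ j, op (star (D.evL z (star (D.η j)))) • D.y j

/-- The map `⊛⁻¹ : 𝔛 → 𝔛` determined by `evL (y⊛⁻¹) ω = (evR ω* y)*`. -/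
def invCirc (z : 𝔛) : 𝔛 := ∑ i, star (D.evR (star (D.w i)) z) • D.x i

theorem evR_toCirc (ω : Ω) (z : 𝔛) :
    D.evR ω (D.toCirc z) = star (D.evL z (star ω)) := by
  have h : star ω = ∑ j, op (star (D.evR ω (D.y j))) • star (D.η j) := by
    conv_lhs => rw [← D.coevR_form ω]
    rw [star_sum]
    exact Finset.sum_congr rfl fun j _ => StarBimodule.star_smul_left _ _
  rw [h, map_sum, star_sum]
  simp only [toCirc, map_sum, D.evR_right, D.evL_right, star_mul, star_star]

theorem star_op_smul (a : A) (ω : Ω) : star (op a • ω) = star a • star ω := by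
  have h := StarBimodule.star_smul_left (star a) (star ω)
  rw [star_star, star_star] at h
  rw [← h, star_star]

theorem evL_invCirc (ω : Ω) (z : 𝔛) :
    D.evL (D.invCirc z) ω = star (D.evR (star ω) z) := by
  have h : star ω = ∑ i, star (D.evL (D.x i) ω) • star (D.w i) := by
    conv_lhs => rw [← D.coevL_form ω]
    rw [star_sum]
    exact Finset.sum_congr rfl fun i _ => star_op_smul _ _
  rw [h, map_sum, LinearMap.sum_apply, star_sum]
  simp only [invCirc, map_sum, LinearMap.sum_apply, D.evL_left, D.evR_left, star_mul, star_star]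

/-- The bijection `⊛ : 𝔛 → 𝔛`. -/
def circledast : 𝔛 ≃ 𝔛 where
  toFun := D.toCirc
  invFun := D.invCirc
  left_inv z := by
    rw [← D.coevL_vec (D.invCirc (D.toCirc z)), ← D.coevL_vec z]
    simp only [D.evL_invCirc, D.evR_toCirc, D.coevL_vec, star_star]
  right_inv z := by
    rw [← D.coevR_vec (D.toCirc (D.invCirc z)), ← D.coevR_vec z]
    simp only [D.evL_invCirc, D.evR_toCirc, D.coevR_vec, star_star]

theorem evR_circledast (ω : Ω) (z : 𝔛) :
    D.evR ω (D.circledast z) = star (D.evL z (star ω)) := D.evR_toCirc ω z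

theorem evL_circledast_symm (ω : Ω) (z : 𝔛) :
    D.evL (D.circledast.symm z) ω = star (D.evR (star ω) z) := D.evL_invCirc ω z

end PivotalDual

end Pivotal

/-! ## The algebra `IIB(Ω)`

`IIB(Ω)` is the quotient of the free product over `A ⊗ Aᵒᵖ` of the tensor algebras of the
`A ⊗ Aᵒᵖ`-bimodules `𝔛 ⊗ Ω` and `Ω ⊗ 𝔛` by the four coevaluation relations. It is presented by
generators `a`, `a̲` (for `a : A`), `(x, ω)` and `(ω, y)`. -/

section Ghobadi

open MulOpposite (op unop)

/-- The generators: elements of `A` and of its opposite, and elementary tensors of `𝔛 ⊗ Ω` and of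
`Ω ⊗ 𝔛`. -/
inductive IIBGen (A Ω 𝔛 : Type*)
  | src (a : A)
  | tgt (a : A)
  | vf (x : 𝔛) (ω : Ω)
  | fv (ω : Ω) (y : 𝔛)

variable {A Ω 𝔛 : Type*} [Ring A] [Algebra ℂ A]
  [AddCommGroup Ω] [Module ℂ Ω] [Module A Ω] [Module Aᵐᵒᵖ Ω]
  [AddCommGroup 𝔛] [Module ℂ 𝔛] [Module A 𝔛] [Module Aᵐᵒᵖ 𝔛]

/-- A generator as an element of the free algebra. -/
abbrev IIBGen.mk (g : IIBGen A Ω 𝔛) : FreeAlgebra ℂ (IIBGen A Ω 𝔛) := FreeAlgebra.ι ℂ g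

open IIBGen in
/-- The defining relations of `IIB(Ω)`. -/
inductive IIBRel (D : PivotalDual A Ω 𝔛) :
    FreeAlgebra ℂ (IIBGen A Ω 𝔛) → FreeAlgebra ℂ (IIBGen A Ω 𝔛) → Prop
  -- `A` and its opposite algebra are mapped in by commuting algebra maps
  | src_add (a b : A) : IIBRel D (mk (src (a + b))) (mk (src a) + mk (src b))
  | src_smul (r : ℂ) (a : A) : IIBRel D (mk (src (r • a))) (r • mk (src a))
  | src_one : IIBRel D (mk (src 1)) 1
  | src_mul (a b : A) : IIBRel D (mk (src (a * b))) (mk (src a) * mk (src b))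
  | tgt_add (a b : A) : IIBRel D (mk (tgt (a + b))) (mk (tgt a) + mk (tgt b))
  | tgt_smul (r : ℂ) (a : A) : IIBRel D (mk (tgt (r • a))) (r • mk (tgt a))
  | tgt_one : IIBRel D (mk (tgt 1)) 1
  | tgt_mul (a b : A) : IIBRel D (mk (tgt (a * b))) (mk (tgt b) * mk (tgt a))
  | src_tgt (a b : A) : IIBRel D (mk (src a) * mk (tgt b)) (mk (tgt b) * mk (src a))
  -- `(x, ω)` and `(ω, y)` are bilinear over `ℂ`
  | vf_add_left (x x' : 𝔛) (ω : Ω) : IIBRel D (mk (vf (x + x') ω)) (mk (vf x ω) + mk (vf x' ω))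
  | vf_add_right (x : 𝔛) (ω ω' : Ω) : IIBRel D (mk (vf x (ω + ω'))) (mk (vf x ω) + mk (vf x ω'))
  | vf_smul_left (r : ℂ) (x : 𝔛) (ω : Ω) : IIBRel D (mk (vf (r • x) ω)) (r • mk (vf x ω))
  | vf_smul_right (r : ℂ) (x : 𝔛) (ω : Ω) : IIBRel D (mk (vf x (r • ω))) (r • mk (vf x ω))
  | fv_add_left (ω ω' : Ω) (y : 𝔛) : IIBRel D (mk (fv (ω + ω') y)) (mk (fv ω y) + mk (fv ω' y))
  | fv_add_right (ω : Ω) (y y' : 𝔛) : IIBRel D (mk (fv ω (y + y'))) (mk (fv ω y) + mk (fv ω y'))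
  | fv_smul_left (r : ℂ) (ω : Ω) (y : 𝔛) : IIBRel D (mk (fv (r • ω) y)) (r • mk (fv ω y))
  | fv_smul_right (r : ℂ) (ω : Ω) (y : 𝔛) : IIBRel D (mk (fv ω (r • y))) (r • mk (fv ω y))
  -- `a b̲ (x, ω) c d̲ = (a x c, d ω b)`
  | src_vf (a : A) (x : 𝔛) (ω : Ω) : IIBRel D (mk (src a) * mk (vf x ω)) (mk (vf (a • x) ω))
  | tgt_vf (a : A) (x : 𝔛) (ω : Ω) : IIBRel D (mk (tgt a) * mk (vf x ω)) (mk (vf x (op a • ω)))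
  | vf_src (a : A) (x : 𝔛) (ω : Ω) : IIBRel D (mk (vf x ω) * mk (src a)) (mk (vf (op a • x) ω))
  | vf_tgt (a : A) (x : 𝔛) (ω : Ω) : IIBRel D (mk (vf x ω) * mk (tgt a)) (mk (vf x (a • ω)))
  -- `a b̲ (ω, y) c d̲ = (a ω c, d y b)`
  | src_fv (a : A) (ω : Ω) (y : 𝔛) : IIBRel D (mk (src a) * mk (fv ω y)) (mk (fv (a • ω) y))
  | tgt_fv (a : A) (ω : Ω) (y : 𝔛) : IIBRel D (mk (tgt a) * mk (fv ω y)) (mk (fv ω (op a • y)))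
  | fv_src (a : A) (ω : Ω) (y : 𝔛) : IIBRel D (mk (fv ω y) * mk (src a)) (mk (fv (op a • ω) y))
  | fv_tgt (a : A) (ω : Ω) (y : 𝔛) : IIBRel D (mk (fv ω y) * mk (tgt a)) (mk (fv ω (a • y)))
  -- the four coevaluation relations
  | coevL_fv (ω : Ω) (y : 𝔛) :
      IIBRel D (∑ i, mk (fv (D.w i) y) * mk (vf (D.x i) ω)) (mk (tgt (D.evR ω y)))
  | coevR_vf (x : 𝔛) (ω : Ω) :
      IIBRel D (∑ j, mk (vf x (D.η j)) * mk (fv ω (D.y j))) (mk (src (D.evL x ω)))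
  | coevR_tgt (ω : Ω) (x : 𝔛) :
      IIBRel D (∑ j, mk (vf (D.y j) ω) * mk (fv (D.η j) x)) (mk (tgt (D.evL x ω)))
  | coevL_src (ω : Ω) (x : 𝔛) :
      IIBRel D (∑ i, mk (fv ω (D.x i)) * mk (vf x (D.w i))) (mk (src (D.evR ω x)))

/-- The algebra `IIB(Ω)`. -/
abbrev IIB (D : PivotalDual A Ω 𝔛) : Type _ := RingQuot (IIBRel D)

namespace IIB

variable (D : PivotalDual A Ω 𝔛)

/-- The class of a generator in `IIB(Ω)`. -/
def gen (g : IIBGen A Ω 𝔛) : IIB D := RingQuot.mkAlgHom ℂ (IIBRel D) (IIBGen.mk g)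

/-- The generator `a`. -/
def src (a : A) : IIB D := gen D (.src a)

/-- The generator `a̲`. -/
def tgt (a : A) : IIB D := gen D (.tgt a)

/-- The generator `(x, ω)`. -/
def vf (x : 𝔛) (ω : Ω) : IIB D := gen D (.vf x ω)

/-- The generator `(ω, y)`. -/
def fv (ω : Ω) (y : 𝔛) : IIB D := gen D (.fv ω y)

end IIB

end Ghobadi

end

/-! The algebra is given by generators and relations, so each structure map is prescribed on
generators and the relations are checked once. Maps that are not algebra maps into an algebra at
hand are first rewritten as such.

The counit comes from an action of $IIB(\Omega^1)$ on $A$: $a$ and $\underline a$ multiply from the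
left and the right, $(x,\omega)$ sends $c$ to ${\rm ev}^L(x,c\omega)$ and $(\omega,y)$ sends $c$ to
${\rm ev}^R(\omega,cy)$; then $\varepsilon_L(X)=X\triangleright 1$ (`act`, `counit`).

The coproduct takes values in $H\otimes_A H$, which carries no product, only a right action of
$H\otimes H$. But left multiplication by the coproduct of a generator descends to $H\otimes_A H$,
because coevaluations are central (`lcls_comulGen_mul`). This gives an action of $IIB(\Omega^1)$ on
$H\otimes_A H$ (`comulEnd`), and $\Delta_L(X)=X\triangleright[1\otimes1]$. The action commutes with
right multiplication, whence the Takeuchi condition and multiplicativity. Identities in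
$X_{(1)}\otimes X_{(2)}$ then follow by multiplying with one generator at a time (`comul_induction`,
`mixed_coassoc`); on a generator they are the triangle identities.

The antipode is the anti-automorphism that swaps $A$ with $A^{op}$ and $(x,\omega)$ with
$(\omega,x)$; it permutes the four coevaluation relations and squares to the identity. Hence
$X\otimes Y\mapsto SY\otimes SX$ identifies the left balanced tensor square with the right one, and
most of the right bialgebroid is transported along it. The four coassociativity laws, two pure and
two mixed, are instances of `mixed_coassoc`.

The involution is an algebra map to the opposite of the complex conjugate algebra. Applying $*$ and
$\circledast$ to ${\rm coev}^L(1)$ and flipping gives ${\rm coev}^R(1)$ (`sum_star_coevL`). The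
converse (`sum_star_coevR`), the formula ${\rm ev}^L(y^\circledast,\omega)={\rm ev}^R(\omega^*,y)^*$
and $\star^2={\rm id}$ are where $\circledast=\circledast^{-1}$ enters. -/

set_option linter.unusedSectionVars false

noncomputable section

open MulOpposite (op unop)

namespace IIB

/-! ### Presentation of the algebra and its universal property -/

section Presentation

variable {A Ω 𝔛 : Type*} [Ring A] [Algebra ℂ A]
  [AddCommGroup Ω] [Module ℂ Ω] [Module A Ω] [Module Aᵐᵒᵖ Ω]
  [AddCommGroup 𝔛] [Module ℂ 𝔛] [Module A 𝔛] [Module Aᵐᵒᵖ 𝔛]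
  (D : PivotalDual A Ω 𝔛)

/-! ### The defining relations -/

theorem gen_src (a : A) : gen D (.src a) = src D a := rfl

theorem gen_tgt (a : A) : gen D (.tgt a) = tgt D a := rfl

theorem gen_vf (x : 𝔛) (ω : Ω) : gen D (.vf x ω) = vf D x ω := rfl

theorem gen_fv (ω : Ω) (y : 𝔛) : gen D (.fv ω y) = fv D ω y := rfl

theorem src_mul_vf (a : A) (x : 𝔛) (ω : Ω) : src D a * vf D x ω = vf D (a • x) ω := by
  simpa [gen, src, tgt, vf, fv] using
      RingQuot.mkAlgHom_rel ℂ (IIBRel.src_vf (D := D) a x ω)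

theorem tgt_mul_vf (a : A) (x : 𝔛) (ω : Ω) : tgt D a * vf D x ω = vf D x (op a • ω) := by
  simpa [gen, src, tgt, vf, fv] using
      RingQuot.mkAlgHom_rel ℂ (IIBRel.tgt_vf (D := D) a x ω)

theorem vf_mul_src (a : A) (x : 𝔛) (ω : Ω) : vf D x ω * src D a = vf D (op a • x) ω := by
  simpa [gen, src, tgt, vf, fv] using
      RingQuot.mkAlgHom_rel ℂ (IIBRel.vf_src (D := D) a x ω)

theorem vf_mul_tgt (a : A) (x : 𝔛) (ω : Ω) : vf D x ω * tgt D a = vf D x (a • ω) := by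
  simpa [gen, src, tgt, vf, fv] using
      RingQuot.mkAlgHom_rel ℂ (IIBRel.vf_tgt (D := D) a x ω)

theorem src_mul_fv (a : A) (ω : Ω) (y : 𝔛) : src D a * fv D ω y = fv D (a • ω) y := by
  simpa [gen, src, tgt, vf, fv] using
      RingQuot.mkAlgHom_rel ℂ (IIBRel.src_fv (D := D) a ω y)

theorem tgt_mul_fv (a : A) (ω : Ω) (y : 𝔛) : tgt D a * fv D ω y = fv D ω (op a • y) := by
  simpa [gen, src, tgt, vf, fv] using
      RingQuot.mkAlgHom_rel ℂ (IIBRel.tgt_fv (D := D) a ω y)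

theorem fv_mul_src (a : A) (ω : Ω) (y : 𝔛) : fv D ω y * src D a = fv D (op a • ω) y := by
  simpa [gen, src, tgt, vf, fv] using
      RingQuot.mkAlgHom_rel ℂ (IIBRel.fv_src (D := D) a ω y)

theorem fv_mul_tgt (a : A) (ω : Ω) (y : 𝔛) : fv D ω y * tgt D a = fv D ω (a • y) := by
  simpa [gen, src, tgt, vf, fv] using
      RingQuot.mkAlgHom_rel ℂ (IIBRel.fv_tgt (D := D) a ω y)

theorem src_mul_tgt (a b : A) : src D a * tgt D b = tgt D b * src D a := by
  simpa [gen, src, tgt, vf, fv] using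
      RingQuot.mkAlgHom_rel ℂ (IIBRel.src_tgt (D := D) a b)

theorem sum_fv_mul_vf (ω : Ω) (y : 𝔛) :
    ∑ i, fv D (D.w i) y * vf D (D.x i) ω = tgt D (D.evR ω y) := by
  simpa [gen, src, tgt, vf, fv] using
      RingQuot.mkAlgHom_rel ℂ (IIBRel.coevL_fv (D := D) ω y)

theorem sum_vf_mul_fv (x : 𝔛) (ω : Ω) :
    ∑ j, vf D x (D.η j) * fv D ω (D.y j) = src D (D.evL x ω) := by
  simpa [gen, src, tgt, vf, fv] using
      RingQuot.mkAlgHom_rel ℂ (IIBRel.coevR_vf (D := D) x ω)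

theorem sum_vf_mul_fv' (ω : Ω) (x : 𝔛) :
    ∑ j, vf D (D.y j) ω * fv D (D.η j) x = tgt D (D.evL x ω) := by
  simpa [gen, src, tgt, vf, fv] using
      RingQuot.mkAlgHom_rel ℂ (IIBRel.coevR_tgt (D := D) ω x)

theorem sum_fv_mul_vf' (ω : Ω) (x : 𝔛) :
    ∑ i, fv D ω (D.x i) * vf D x (D.w i) = src D (D.evR ω x) := by
  simpa [gen, src, tgt, vf, fv] using
      RingQuot.mkAlgHom_rel ℂ (IIBRel.coevL_src (D := D) ω x)

/-- The inclusion of `A` as an algebra map. -/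
def srcHom : A →ₐ[ℂ] IIB D := AlgHom.ofLinearMap
  { toFun := src D
    map_add' := fun a b => by
      simpa [gen, src, tgt, vf, fv] using
        RingQuot.mkAlgHom_rel ℂ (IIBRel.src_add (D := D) a b)
    map_smul' := fun r a => by
      simpa [gen, src, tgt, vf, fv] using
        RingQuot.mkAlgHom_rel ℂ (IIBRel.src_smul (D := D) r a) }
  (by simpa [gen, src, tgt, vf, fv] using RingQuot.mkAlgHom_rel ℂ (IIBRel.src_one (D := D)))
  (fun a b => by
    simpa [gen, src, tgt, vf, fv] using
      RingQuot.mkAlgHom_rel ℂ (IIBRel.src_mul (D := D) a b))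

/-- The inclusion of the opposite algebra of `A` as an algebra map. -/
def tgtHom : Aᵐᵒᵖ →ₐ[ℂ] IIB D := AlgHom.ofLinearMap
  { toFun := fun a => tgt D (unop a)
    map_add' := fun a b => by
      simpa [gen, src, tgt, vf, fv] using
        RingQuot.mkAlgHom_rel ℂ (IIBRel.tgt_add (D := D) (unop a) (unop b))
    map_smul' := fun r a => by
      simpa [gen, src, tgt, vf, fv] using
        RingQuot.mkAlgHom_rel ℂ (IIBRel.tgt_smul (D := D) r (unop a)) }
  (by simpa [gen, src, tgt, vf, fv] using RingQuot.mkAlgHom_rel ℂ (IIBRel.tgt_one (D := D)))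
  (fun a b => by
    simpa [gen, src, tgt, vf, fv] using
      RingQuot.mkAlgHom_rel ℂ (IIBRel.tgt_mul (D := D) (unop b) (unop a)))

/-- The generators `(x, ω)` as a bilinear map. -/
def vfHom : 𝔛 →ₗ[ℂ] Ω →ₗ[ℂ] IIB D := LinearMap.mk₂ ℂ (vf D)
  (fun x x' ω => by
    simpa [gen, src, tgt, vf, fv] using
      RingQuot.mkAlgHom_rel ℂ (IIBRel.vf_add_left (D := D) x x' ω))
  (fun r x ω => by
    simpa [gen, src, tgt, vf, fv] using
      RingQuot.mkAlgHom_rel ℂ (IIBRel.vf_smul_left (D := D) r x ω))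
  (fun x ω ω' => by
    simpa [gen, src, tgt, vf, fv] using
      RingQuot.mkAlgHom_rel ℂ (IIBRel.vf_add_right (D := D) x ω ω'))
  (fun r x ω => by
    simpa [gen, src, tgt, vf, fv] using
      RingQuot.mkAlgHom_rel ℂ (IIBRel.vf_smul_right (D := D) r x ω))

/-- The generators `(ω, y)` as a bilinear map. -/
def fvHom : Ω →ₗ[ℂ] 𝔛 →ₗ[ℂ] IIB D := LinearMap.mk₂ ℂ (fv D)
  (fun ω ω' y => by
    simpa [gen, src, tgt, vf, fv] using
      RingQuot.mkAlgHom_rel ℂ (IIBRel.fv_add_left (D := D) ω ω' y))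
  (fun r ω y => by
    simpa [gen, src, tgt, vf, fv] using
      RingQuot.mkAlgHom_rel ℂ (IIBRel.fv_smul_left (D := D) r ω y))
  (fun ω y y' => by
    simpa [gen, src, tgt, vf, fv] using
      RingQuot.mkAlgHom_rel ℂ (IIBRel.fv_add_right (D := D) ω y y'))
  (fun r ω y => by
    simpa [gen, src, tgt, vf, fv] using
      RingQuot.mkAlgHom_rel ℂ (IIBRel.fv_smul_right (D := D) r ω y))

theorem srcHom_apply (a : A) : srcHom D a = src D a := rfl

theorem tgtHom_op (a : A) : tgtHom D (op a) = tgt D a := rfl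

theorem src_add (a b : A) : src D (a + b) = src D a + src D b := map_add (srcHom D) a b

theorem src_smul (r : ℂ) (a : A) : src D (r • a) = r • src D a := map_smul (srcHom D) r a

theorem src_one : src D 1 = 1 := map_one (srcHom D)

theorem src_mul (a b : A) : src D (a * b) = src D a * src D b := map_mul (srcHom D) a b

theorem tgt_add (a b : A) : tgt D (a + b) = tgt D a + tgt D b :=
  map_add (tgtHom D) (op a) (op b)

theorem tgt_smul (r : ℂ) (a : A) : tgt D (r • a) = r • tgt D a := map_smul (tgtHom D) r (op a)

theorem tgt_one : tgt D 1 = 1 := map_one (tgtHom D)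

theorem tgt_mul (a b : A) : tgt D (a * b) = tgt D b * tgt D a :=
  map_mul (tgtHom D) (op b) (op a)

theorem vf_add_left (x x' : 𝔛) (ω : Ω) : vf D (x + x') ω = vf D x ω + vf D x' ω :=
  (vfHom D).map_add₂ x x' ω

theorem vf_add_right (x : 𝔛) (ω ω' : Ω) : vf D x (ω + ω') = vf D x ω + vf D x ω' :=
  (vfHom D x).map_add ω ω'

theorem vf_smul_left (r : ℂ) (x : 𝔛) (ω : Ω) : vf D (r • x) ω = r • vf D x ω :=
  (vfHom D).map_smul₂ r x ω

theorem vf_smul_right (r : ℂ) (x : 𝔛) (ω : Ω) : vf D x (r • ω) = r • vf D x ω :=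
  (vfHom D x).map_smul r ω

theorem vf_sum_left {ι : Type*} (s : Finset ι) (x : ι → 𝔛) (ω : Ω) :
    vf D (∑ i ∈ s, x i) ω = ∑ i ∈ s, vf D (x i) ω :=
  LinearMap.map_sum₂ (vfHom D) s x ω

theorem vf_sum_right {ι : Type*} (s : Finset ι) (x : 𝔛) (ω : ι → Ω) :
    vf D x (∑ i ∈ s, ω i) = ∑ i ∈ s, vf D x (ω i) :=
  map_sum (vfHom D x) ω s

theorem fv_add_left (ω ω' : Ω) (y : 𝔛) : fv D (ω + ω') y = fv D ω y + fv D ω' y :=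
  (fvHom D).map_add₂ ω ω' y

theorem fv_add_right (ω : Ω) (y y' : 𝔛) : fv D ω (y + y') = fv D ω y + fv D ω y' :=
  (fvHom D ω).map_add y y'

theorem fv_smul_left (r : ℂ) (ω : Ω) (y : 𝔛) : fv D (r • ω) y = r • fv D ω y :=
  (fvHom D).map_smul₂ r ω y

theorem fv_smul_right (r : ℂ) (ω : Ω) (y : 𝔛) : fv D ω (r • y) = r • fv D ω y :=
  (fvHom D ω).map_smul r y

theorem fv_sum_left {ι : Type*} (s : Finset ι) (ω : ι → Ω) (y : 𝔛) :
    fv D (∑ i ∈ s, ω i) y = ∑ i ∈ s, fv D (ω i) y :=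
  LinearMap.map_sum₂ (fvHom D) s ω y

theorem fv_sum_right {ι : Type*} (s : Finset ι) (ω : Ω) (y : ι → 𝔛) :
    fv D ω (∑ i ∈ s, y i) = ∑ i ∈ s, fv D ω (y i) :=
  map_sum (fvHom D ω) y s

/-! ### Maps out of `IIB(Ω)` -/

variable {D} in
/-- An algebra map out of `IIB(Ω)`, given on generators. -/
def lift {C : Type*} [Ring C] [Algebra ℂ C] (f : IIBGen A Ω 𝔛 → C)
    (h : ∀ p q, IIBRel D p q → FreeAlgebra.lift ℂ f p = FreeAlgebra.lift ℂ f q) :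
    IIB D →ₐ[ℂ] C :=
  RingQuot.liftAlgHom ℂ ⟨FreeAlgebra.lift ℂ f, fun {p q} => h p q⟩

variable {D} in
theorem lift_gen {C : Type*} [Ring C] [Algebra ℂ C] (f : IIBGen A Ω 𝔛 → C)
    (h : ∀ p q, IIBRel D p q → FreeAlgebra.lift ℂ f p = FreeAlgebra.lift ℂ f q)
    (g : IIBGen A Ω 𝔛) : lift f h (gen D g) = f g := by
  simp [lift, gen]

variable {D} in
/-- Induction by multiplication with generators from the left. -/
theorem gen_induction {P : IIB D → Prop} (one : P 1) (add : ∀ X Y, P X → P Y → P (X + Y))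
    (smul : ∀ (r : ℂ) X, P X → P (r • X)) (mul : ∀ g X, P X → P (gen D g * X))
    (X : IIB D) : P X := by
  -- Stability of `P` under left multiplication by an arbitrary word composes along products, unlike
  -- `P` of the word itself; the case `Y = 1` gives the claim.
  suffices h : ∀ p : FreeAlgebra ℂ (IIBGen A Ω 𝔛), ∀ Y, P Y →
      P (RingQuot.mkAlgHom ℂ (IIBRel D) p * Y) by
    obtain ⟨p, rfl⟩ := RingQuot.mkAlgHom_surjective ℂ (IIBRel D) X
    simpa using h p 1 one
  intro p
  induction p using FreeAlgebra.induction with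
  | grade0 r =>
    intro Y hY
    rw [AlgHom.commutes, ← Algebra.smul_def]
    exact smul r Y hY
  | grade1 g => exact fun Y hY => mul g Y hY
  | mul p q hp hq =>
    intro Y hY
    rw [map_mul, mul_assoc]
    exact hp _ (hq Y hY)
  | add p q hp hq =>
    intro Y hY
    rw [map_add, add_mul]
    exact add _ _ (hp Y hY) (hq Y hY)

end Presentation

end IIB

/-! ### Coevaluations as canonical elements -/

section Coevaluation

variable {A Ω 𝔛 : Type*} [Ring A] [Algebra ℂ A]
  [AddCommGroup Ω] [Module ℂ Ω] [Module A Ω] [Module Aᵐᵒᵖ Ω]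
  [AddCommGroup 𝔛] [Module ℂ 𝔛] [Module A 𝔛] [Module Aᵐᵒᵖ 𝔛]

namespace PivotalDual

variable (D : PivotalDual A Ω 𝔛) {M ι : Type*} [AddCommGroup M] [Module ℂ M] [Fintype ι]

/-- A sum `∑ zₖ ⊗ ζₖ` in `𝔛 ⊗_A Ω` is determined by the map `ω ↦ ∑ evR(ω, zₖ) ζₖ`. -/
theorem sum_coevR (β : 𝔛 →ₗ[ℂ] Ω →ₗ[ℂ] M)
    (hβ : ∀ (a : A) (x : 𝔛) (ω : Ω), β (op a • x) ω = β x (a • ω))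
    (z : ι → 𝔛) (ζ : ι → Ω) (g : Ω → Ω) (h : ∀ ω, ∑ k, D.evR ω (z k) • ζ k = g ω) :
    ∑ k, β (z k) (ζ k) = ∑ j, β (D.y j) (g (D.η j)) := by
  calc ∑ k, β (z k) (ζ k) = ∑ k, ∑ j, β (D.y j) (D.evR (D.η j) (z k) • ζ k) := by
        refine Finset.sum_congr rfl fun k _ => ?_
        conv_lhs => rw [← D.coevR_vec (z k), map_sum, LinearMap.sum_apply]
        simp only [hβ]
    _ = _ := by
        rw [Finset.sum_comm]
        simp only [← map_sum, h]

/-- A sum `∑ ζₖ ⊗ zₖ` in `Ω ⊗_A 𝔛` is determined by the map `z ↦ ∑ evL(z, ζₖ) zₖ`. -/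
theorem sum_coevL (β : Ω →ₗ[ℂ] 𝔛 →ₗ[ℂ] M)
    (hβ : ∀ (a : A) (ω : Ω) (x : 𝔛), β (op a • ω) x = β ω (a • x))
    (ζ : ι → Ω) (z : ι → 𝔛) (g : 𝔛 → 𝔛) (h : ∀ x, ∑ k, D.evL x (ζ k) • z k = g x) :
    ∑ k, β (ζ k) (z k) = ∑ i, β (D.w i) (g (D.x i)) := by
  calc ∑ k, β (ζ k) (z k) = ∑ k, ∑ i, β (D.w i) (D.evL (D.x i) (ζ k) • z k) := by
        refine Finset.sum_congr rfl fun k _ => ?_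
        conv_lhs => rw [← D.coevL_form (ζ k), map_sum, LinearMap.sum_apply]
        simp only [hβ]
    _ = _ := by
        rw [Finset.sum_comm]
        simp only [← map_sum, h]

/-- `coevR` is central. -/
theorem coevR_central (β : 𝔛 →ₗ[ℂ] Ω →ₗ[ℂ] M)
    (hβ : ∀ (a : A) (x : 𝔛) (ω : Ω), β (op a • x) ω = β x (a • ω)) (a : A) :
    ∑ j, β (a • D.y j) (D.η j) = ∑ j, β (D.y j) (op a • D.η j) :=
  D.sum_coevR β hβ (fun j => a • D.y j) D.η (fun ω => op a • ω) fun ω => by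
    simp only [← D.evR_mid, D.coevR_form]

/-- `coevL` is central. -/
theorem coevL_central (β : Ω →ₗ[ℂ] 𝔛 →ₗ[ℂ] M)
    (hβ : ∀ (a : A) (ω : Ω) (x : 𝔛), β (op a • ω) x = β ω (a • x)) (a : A) :
    ∑ i, β (a • D.w i) (D.x i) = ∑ i, β (D.w i) (op a • D.x i) :=
  D.sum_coevL β hβ (fun i => a • D.w i) D.x (fun x => op a • x) fun x => by
    simp only [← D.evL_mid, D.coevL_vec]

end PivotalDual

end Coevaluation

namespace IIB

/-! ### The action on the base algebra and the counit -/

section Counit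

variable {A Ω 𝔛 : Type*} [Ring A] [Algebra ℂ A]
  [AddCommGroup Ω] [Module ℂ Ω] [Module A Ω] [Module Aᵐᵒᵖ Ω] [SMulCommClass A Aᵐᵒᵖ Ω]
  [IsScalarTower ℂ A Ω]
  [AddCommGroup 𝔛] [Module ℂ 𝔛] [Module A 𝔛] [Module Aᵐᵒᵖ 𝔛] [SMulCommClass A Aᵐᵒᵖ 𝔛]
  [IsScalarTower ℂ A 𝔛]
  (D : PivotalDual A Ω 𝔛)

/-- The action of a generator on the base algebra `A`. -/
def actGen : IIBGen A Ω 𝔛 → Module.End ℂ A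
  | .src a => LinearMap.mulLeft ℂ a
  | .tgt a => LinearMap.mulRight ℂ a
  | .vf x ω =>
    { toFun := fun c => D.evL x (c • ω)
      map_add' := fun c d => by rw [add_smul, map_add]
      map_smul' := fun r c => by rw [smul_assoc, map_smul, RingHom.id_apply] }
  | .fv ω y =>
    { toFun := fun c => D.evR ω (c • y)
      map_add' := fun c d => by rw [add_smul, map_add]
      map_smul' := fun r c => by rw [smul_assoc, map_smul, RingHom.id_apply] }

theorem actGen_src (a c : A) : actGen D (.src a) c = a * c := rfl

theorem actGen_tgt (a c : A) : actGen D (.tgt a) c = c * a := rfl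

theorem actGen_vf (x : 𝔛) (ω : Ω) (c : A) : actGen D (.vf x ω) c = D.evL x (c • ω) := rfl

theorem actGen_fv (ω : Ω) (y : 𝔛) (c : A) : actGen D (.fv ω y) c = D.evR ω (c • y) := rfl

/-- The action of `IIB(Ω)` on the base algebra `A`. -/
def act : IIB D →ₐ[ℂ] Module.End ℂ A := lift (actGen D) (by
  intro p q h
  refine LinearMap.ext fun c => ?_
  cases h <;> simp only [IIBGen.mk, map_add, map_smul, map_mul, map_one, map_sum,
    FreeAlgebra.lift_ι_apply, LinearMap.add_apply, LinearMap.smul_apply, LinearMap.sum_apply,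
    Module.End.mul_apply, Module.End.one_apply, actGen_src, actGen_tgt, actGen_vf, actGen_fv,
    add_mul, mul_add, smul_add, smul_mul_assoc, mul_smul_comm, one_mul, mul_one, mul_assoc]
  case vf_smul_right r x ω => rw [smul_comm c r ω, map_smul]
  case fv_smul_right r ω y => rw [smul_comm c r y, map_smul]
  case src_vf => rw [D.evL_left]
  case tgt_vf a x ω => rw [smul_comm c (op a) ω, D.evL_right]
  case vf_src => rw [mul_smul, D.evL_mid]
  case vf_tgt => rw [mul_smul]
  case src_fv => rw [D.evR_left]
  case tgt_fv a ω y => rw [smul_comm c (op a) y, D.evR_right]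
  case fv_src => rw [mul_smul, D.evR_mid]
  case fv_tgt => rw [mul_smul]
  -- In each of the four coevaluation relations the inner evaluation is a scalar in `A`. Balancing
  -- moves it onto the coevaluation, where a dual basis expansion absorbs the sum.
  case coevL_fv =>
    simp only [← D.evR_mid, ← LinearMap.sum_apply, ← map_sum, D.coevL_form, D.evR_left]
  case coevR_vf => simp only [← D.evR_mid, ← map_sum, D.coevR_form, D.evL_right]
  case coevR_tgt =>
    simp only [← D.evL_mid, ← LinearMap.sum_apply, ← map_sum, D.coevR_vec, D.evL_left]
  case coevL_src => simp only [← D.evL_mid, ← map_sum, D.coevL_vec, D.evR_right])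

theorem act_gen (g : IIBGen A Ω 𝔛) : act D (gen D g) = actGen D g := lift_gen _ _ g

theorem act_src (a c : A) : act D (src D a) c = a * c := by
  rw [src, act_gen, actGen_src]

theorem act_tgt (a c : A) : act D (tgt D a) c = c * a := by
  rw [tgt, act_gen, actGen_tgt]

theorem act_vf (x : 𝔛) (ω : Ω) (c : A) : act D (vf D x ω) c = D.evL x (c • ω) := by
  rw [vf, act_gen, actGen_vf]

theorem act_fv (ω : Ω) (y : 𝔛) (c : A) : act D (fv D ω y) c = D.evR ω (c • y) := by
  rw [fv, act_gen, actGen_fv]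

/-- The counit `X ↦ X ▷ 1`. -/
def counit : IIB D →ₗ[ℂ] A := LinearMap.applyₗ 1 ∘ₗ (act D).toLinearMap

theorem counit_apply (X : IIB D) : counit D X = act D X 1 := rfl

/-- Since `src D a` and `tgt D a` both have counit `a`, this single formula yields both forms of
weak multiplicativity of the counit. -/
theorem counit_mul (X Y : IIB D) : counit D (X * Y) = act D X (counit D Y) := by
  rw [counit_apply, map_mul, Module.End.mul_apply, counit_apply]

theorem counit_one : counit D 1 = 1 := by
  rw [counit_apply, map_one (act D)]; rfl

theorem counit_src_mul (a : A) (X : IIB D) : counit D (src D a * X) = a * counit D X := by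
  rw [counit_mul, act_src]

theorem counit_tgt_mul (a : A) (X : IIB D) : counit D (tgt D a * X) = counit D X * a := by
  rw [counit_mul, act_tgt]

theorem counit_src (a : A) : counit D (src D a) = a := by
  rw [counit_apply, act_src, mul_one]

theorem counit_tgt (a : A) : counit D (tgt D a) = a := by
  rw [counit_apply, act_tgt, one_mul]

theorem counit_vf (x : 𝔛) (ω : Ω) : counit D (vf D x ω) = D.evL x ω := by
  rw [counit_apply, act_vf, one_smul]

theorem counit_fv (ω : Ω) (y : 𝔛) : counit D (fv D ω y) = D.evR ω y := by
  rw [counit_apply, act_fv, one_smul]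

theorem counit_vf_mul (x : 𝔛) (ω : Ω) (X : IIB D) :
    counit D (vf D x ω * X) = D.evL x (counit D X • ω) := by
  rw [counit_mul, act_vf]

theorem counit_fv_mul (ω : Ω) (y : 𝔛) (X : IIB D) :
    counit D (fv D ω y * X) = D.evR ω (counit D X • y) := by
  rw [counit_mul, act_fv]

end Counit

end IIB

namespace IIB

/-! ### The left coproduct -/

section Coproduct

variable {A Ω 𝔛 : Type*} [Ring A] [Algebra ℂ A]
  [AddCommGroup Ω] [Module ℂ Ω] [Module A Ω] [Module Aᵐᵒᵖ Ω]
  [AddCommGroup 𝔛] [Module ℂ 𝔛] [Module A 𝔛] [Module Aᵐᵒᵖ 𝔛]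
  (D : PivotalDual A Ω 𝔛)

/-- The tensor product `IIB(Ω) ⊗_A IIB(Ω)` of the left bialgebroid. -/
abbrev LT : Type _ := LTensor (srcHom D) (tgtHom D)

/-- The class in `LT` of an element of `IIB(Ω) ⊗ IIB(Ω)`. -/
abbrev lcls : IIB D ⊗[ℂ] IIB D →ₗ[ℂ] LT D := LTensor.cls (srcHom D) (tgtHom D)

theorem lcls_surjective : Function.Surjective (lcls D) := Submodule.mkQ_surjective _

theorem lcls_tgt_mul (a : A) (X Y : IIB D) :
    lcls D ((tgt D a * X) ⊗ₜ Y) = lcls D (X ⊗ₜ (src D a * Y)) :=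
  (Submodule.Quotient.eq _).2 (Submodule.subset_span ⟨a, X, Y, rfl⟩)

theorem lcls_tgt_tmul (a : A) (Y : IIB D) :
    lcls D (tgt D a ⊗ₜ Y) = lcls D (1 ⊗ₜ (src D a * Y)) := by
  simpa only [mul_one] using lcls_tgt_mul D a 1 Y

theorem lcls_tmul_src (a : A) (X : IIB D) :
    lcls D (X ⊗ₜ src D a) = lcls D ((tgt D a * X) ⊗ₜ 1) := by
  simpa only [mul_one] using (lcls_tgt_mul D a X 1).symm

variable {D} in
/-- Linear maps out of `IIB(Ω) ⊗ IIB(Ω)` that respect the balancing are determined on `LT`. -/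
theorem lcls_congr {σ : ℂ →+* ℂ} {M : Type*} [AddCommGroup M] [Module ℂ M]
    {f : IIB D ⊗[ℂ] IIB D →ₛₗ[σ] M}
    (hf : ∀ a X Y, f ((tgt D a * X) ⊗ₜ Y) = f (X ⊗ₜ (src D a * Y)))
    {u v : IIB D ⊗[ℂ] IIB D} (h : lcls D u = lcls D v) : f u = f v := by
  have hle : balSub (leftActR (tgtHom D)) (leftActL (srcHom D)) ≤ LinearMap.ker f := by
    refine Submodule.span_le.2 ?_
    rintro _ ⟨a, X, Y, rfl⟩
    rw [SetLike.mem_coe, LinearMap.mem_ker, map_sub, sub_eq_zero]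
    exact hf a X Y
  rw [← sub_eq_zero, ← map_sub]
  exact LinearMap.mem_ker.1 (hle ((Submodule.Quotient.eq _).1 h))

/-- The balancing relations come from left multiplications, so they form a right ideal of the tensor
square. -/
theorem lcls_mul_right {u v : IIB D ⊗[ℂ] IIB D} (h : lcls D u = lcls D v)
    (w : IIB D ⊗[ℂ] IIB D) : lcls D (u * w) = lcls D (v * w) := by
  rw [← LTensor.rmul_cls, ← LTensor.rmul_cls]
  exact congrArg _ h

/-- The coproduct of a generator, in `IIB(Ω) ⊗ IIB(Ω)`. -/
def comulGen : IIBGen A Ω 𝔛 → IIB D ⊗[ℂ] IIB D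
  | .src a => src D a ⊗ₜ 1
  | .tgt a => 1 ⊗ₜ tgt D a
  | .vf x ω => ∑ i, vf D x (D.w i) ⊗ₜ vf D (D.x i) ω
  | .fv ω y => ∑ j, fv D ω (D.y j) ⊗ₜ fv D (D.η j) y

theorem comulGen_src (a : A) : comulGen D (.src a) = src D a ⊗ₜ 1 := rfl

theorem comulGen_tgt (a : A) : comulGen D (.tgt a) = 1 ⊗ₜ tgt D a := rfl

theorem comulGen_vf (x : 𝔛) (ω : Ω) :
    comulGen D (.vf x ω) = ∑ i, vf D x (D.w i) ⊗ₜ vf D (D.x i) ω := rfl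

theorem comulGen_fv (ω : Ω) (y : 𝔛) :
    comulGen D (.fv ω y) = ∑ j, fv D ω (D.y j) ⊗ₜ fv D (D.η j) y := rfl

/-- Left multiplication by the coproduct of a generator respects the balancing. -/
theorem lcls_comulGen_mul (g : IIBGen A Ω 𝔛) (a : A) (X Y : IIB D) :
    lcls D (comulGen D g * ((tgt D a * X) ⊗ₜ Y)) =
      lcls D (comulGen D g * (X ⊗ₜ (src D a * Y))) := by
  cases g with
  | src b =>
    simp only [comulGen_src, Algebra.TensorProduct.tmul_mul_tmul, one_mul]
    rw [← lcls_tgt_mul, ← mul_assoc, ← mul_assoc, src_mul_tgt]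
  | tgt b =>
    simp only [comulGen_tgt, Algebra.TensorProduct.tmul_mul_tmul, one_mul]
    rw [lcls_tgt_mul, ← mul_assoc, ← mul_assoc, src_mul_tgt]
  | vf x ω =>
    simp only [comulGen_vf, Finset.sum_mul, Algebra.TensorProduct.tmul_mul_tmul, ← mul_assoc,
      vf_mul_tgt, vf_mul_src, map_sum]
    exact D.coevL_central
      (((TensorProduct.mk ℂ _ _).compl₁₂ (LinearMap.mulRight ℂ X ∘ₗ vfHom D x)
        (LinearMap.mulRight ℂ Y ∘ₗ (vfHom D).flip ω)).compr₂ (lcls D)) (fun b ω' x' => by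
          change lcls D ((vf D x (op b • ω') * X) ⊗ₜ (vf D x' ω * Y)) =
            lcls D ((vf D x ω' * X) ⊗ₜ (vf D (b • x') ω * Y))
          rw [← tgt_mul_vf, ← src_mul_vf, mul_assoc, mul_assoc, lcls_tgt_mul]) a
  | fv ω y =>
    simp only [comulGen_fv, Finset.sum_mul, Algebra.TensorProduct.tmul_mul_tmul, ← mul_assoc,
      fv_mul_tgt, fv_mul_src, map_sum]
    exact D.coevR_central
      (((TensorProduct.mk ℂ _ _).compl₁₂ (LinearMap.mulRight ℂ X ∘ₗ fvHom D ω)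
        (LinearMap.mulRight ℂ Y ∘ₗ (fvHom D).flip y)).compr₂ (lcls D)) (fun b x' ω' => by
          change lcls D ((fv D ω (op b • x') * X) ⊗ₜ (fv D ω' y * Y)) =
            lcls D ((fv D ω x' * X) ⊗ₜ (fv D (b • ω') y * Y))
          rw [← tgt_mul_fv, ← src_mul_fv, mul_assoc, mul_assoc, lcls_tgt_mul]) a

theorem lcls_comulGen_mul_congr (g : IIBGen A Ω 𝔛) {u v : IIB D ⊗[ℂ] IIB D}
    (h : lcls D u = lcls D v) : lcls D (comulGen D g * u) = lcls D (comulGen D g * v) :=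
  lcls_congr (f := lcls D ∘ₗ LinearMap.mulLeft ℂ (comulGen D g)) (lcls_comulGen_mul D g) h

/-- The action of a generator on `LT` by left multiplication with its coproduct. -/
def comulEndGen (g : IIBGen A Ω 𝔛) : Module.End ℂ (LT D) :=
  Submodule.mapQ _ _ (LinearMap.mulLeft ℂ (comulGen D g)) fun u hu => by
    rw [← Submodule.Quotient.mk_eq_zero] at hu
    rw [Submodule.mem_comap, ← Submodule.Quotient.mk_eq_zero]
    simpa using lcls_comulGen_mul_congr D g (u := u) (v := 0) (by simpa using hu)

theorem comulEndGen_lcls (g : IIBGen A Ω 𝔛) (u : IIB D ⊗[ℂ] IIB D) :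
    comulEndGen D g (lcls D u) = lcls D (comulGen D g * u) := rfl

/-- In the free algebra a coproduct can be computed inside the honest algebra `IIB D ⊗ IIB D`. This
compares it with the action on the quotient, so that a relation can be tested on representatives. -/
theorem lift_comulEndGen (p : FreeAlgebra ℂ (IIBGen A Ω 𝔛)) (u : IIB D ⊗[ℂ] IIB D) :
    FreeAlgebra.lift ℂ (comulEndGen D) p (lcls D u) =
      lcls D (FreeAlgebra.lift ℂ (comulGen D) p * u) := by
  induction p using FreeAlgebra.induction generalizing u with
  | grade0 r => simp [Algebra.algebraMap_eq_smul_one]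
  | grade1 g =>
    rw [FreeAlgebra.lift_ι_apply, FreeAlgebra.lift_ι_apply, comulEndGen_lcls]
  | mul p q hp hq =>
    rw [map_mul, map_mul (FreeAlgebra.lift ℂ (comulGen D)), Module.End.mul_apply, hq, hp,
      mul_assoc]
  | add p q hp hq => rw [map_add, map_add, LinearMap.add_apply, hq, hp, add_mul, map_add]

/-- In a product of two coproducts summed over a coevaluation, the summation index occurs in one
tensor leg only. Here it is the first leg; there a relation of the algebra can be applied. -/
theorem sum_mul_contract_left {H ι κ μ : Type*} [Ring H] [Algebra ℂ H] [Fintype ι] [Fintype κ]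
    [Fintype μ] (a : ι → κ → H) (b : κ → H) (c : ι → μ → H) (d : μ → H) :
    ∑ i, (∑ j, a i j ⊗ₜ[ℂ] b j) * (∑ k, c i k ⊗ₜ[ℂ] d k) =
      ∑ j, ∑ k, (∑ i, a i j * c i k) ⊗ₜ[ℂ] (b j * d k) := by
  simp only [Finset.sum_mul_sum, Algebra.TensorProduct.tmul_mul_tmul, TensorProduct.sum_tmul]
  rw [Finset.sum_comm]
  exact Finset.sum_congr rfl fun j _ => Finset.sum_comm

theorem sum_mul_contract_right {H ι κ μ : Type*} [Ring H] [Algebra ℂ H] [Fintype ι] [Fintype κ]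
    [Fintype μ] (a : κ → H) (b : κ → ι → H) (c : μ → H) (d : μ → ι → H) :
    ∑ i, (∑ j, a j ⊗ₜ[ℂ] b j i) * (∑ k, c k ⊗ₜ[ℂ] d k i) =
      ∑ j, ∑ k, (a j * c k) ⊗ₜ[ℂ] (∑ i, b j i * d k i) := by
  simp only [Finset.sum_mul_sum, Algebra.TensorProduct.tmul_mul_tmul, TensorProduct.tmul_sum]
  rw [Finset.sum_comm]
  exact Finset.sum_congr rfl fun j _ => Finset.sum_comm

/-- The relation is used twice. Contracting the first leg leaves `tgt D (D.evR (D.w k) (D.y j))`,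
which crosses the tensor sign as an element of `A`; a dual basis expansion removes `j`, and the same
relation contracts the second leg. The next three lemmas work alike, two of them beginning with the
second leg. -/
theorem lcls_sum_comulGen_fv_mul_vf (ω : Ω) (y : 𝔛) :
    lcls D (∑ i, comulGen D (.fv (D.w i) y) * comulGen D (.vf (D.x i) ω)) =
      lcls D (comulGen D (.tgt (D.evR ω y))) := by
  simp only [comulGen_fv, comulGen_vf, comulGen_tgt, sum_mul_contract_left, sum_fv_mul_vf]
  rw [Finset.sum_comm]
  simp only [map_sum, lcls_tgt_tmul, ← mul_assoc, src_mul_fv]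
  simp only [← map_sum, ← TensorProduct.tmul_sum, ← Finset.sum_mul, ← fv_sum_left, D.coevR_form,
    sum_fv_mul_vf]

theorem lcls_sum_comulGen_vf_mul_fv (x : 𝔛) (ω : Ω) :
    lcls D (∑ j, comulGen D (.vf x (D.η j)) * comulGen D (.fv ω (D.y j))) =
      lcls D (comulGen D (.src (D.evL x ω))) := by
  simp only [comulGen_fv, comulGen_vf, comulGen_src, sum_mul_contract_right, sum_vf_mul_fv]
  rw [Finset.sum_comm]
  simp only [map_sum, lcls_tmul_src, ← mul_assoc, tgt_mul_vf]
  simp only [← map_sum, ← TensorProduct.sum_tmul, ← Finset.sum_mul, ← vf_sum_right, D.coevL_form,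
    sum_vf_mul_fv]

theorem lcls_sum_comulGen_vf_mul_fv' (ω : Ω) (x : 𝔛) :
    lcls D (∑ j, comulGen D (.vf (D.y j) ω) * comulGen D (.fv (D.η j) x)) =
      lcls D (comulGen D (.tgt (D.evL x ω))) := by
  simp only [comulGen_fv, comulGen_vf, comulGen_tgt, sum_mul_contract_left, sum_vf_mul_fv']
  rw [Finset.sum_comm]
  simp only [map_sum, lcls_tgt_tmul, ← mul_assoc, src_mul_vf]
  simp only [← map_sum, ← TensorProduct.tmul_sum, ← Finset.sum_mul, ← vf_sum_left, D.coevL_vec,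
    sum_vf_mul_fv']

theorem lcls_sum_comulGen_fv_mul_vf' (ω : Ω) (x : 𝔛) :
    lcls D (∑ i, comulGen D (.fv ω (D.x i)) * comulGen D (.vf x (D.w i))) =
      lcls D (comulGen D (.src (D.evR ω x))) := by
  simp only [comulGen_fv, comulGen_vf, comulGen_src, sum_mul_contract_right, sum_fv_mul_vf']
  rw [Finset.sum_comm]
  simp only [map_sum, lcls_tmul_src, ← mul_assoc, tgt_mul_fv]
  simp only [← map_sum, ← TensorProduct.sum_tmul, ← Finset.sum_mul, ← fv_sum_right, D.coevR_vec,
    sum_fv_mul_vf']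

/-- The coproducts of the generators satisfy the relations of `IIB(Ω)` in `LT`. -/
theorem lcls_lift_comulGen {p q : FreeAlgebra ℂ (IIBGen A Ω 𝔛)} (h : IIBRel D p q) :
    lcls D (FreeAlgebra.lift ℂ (comulGen D) p) = lcls D (FreeAlgebra.lift ℂ (comulGen D) q) := by
  cases h
  case coevL_fv ω y =>
    simpa only [IIBGen.mk, map_sum, map_mul, FreeAlgebra.lift_ι_apply] using
      lcls_sum_comulGen_fv_mul_vf D ω y
  case coevR_vf x ω =>
    simpa only [IIBGen.mk, map_sum, map_mul, FreeAlgebra.lift_ι_apply] using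
      lcls_sum_comulGen_vf_mul_fv D x ω
  case coevR_tgt ω x =>
    simpa only [IIBGen.mk, map_sum, map_mul, FreeAlgebra.lift_ι_apply] using
      lcls_sum_comulGen_vf_mul_fv' D ω x
  case coevL_src ω x =>
    simpa only [IIBGen.mk, map_sum, map_mul, FreeAlgebra.lift_ι_apply] using
      lcls_sum_comulGen_fv_mul_vf' D ω x
  all_goals simp only [IIBGen.mk, map_add, map_smul, map_mul, map_one, map_sum,
    FreeAlgebra.lift_ι_apply, comulGen_src, comulGen_tgt, comulGen_vf, comulGen_fv,
    Finset.sum_mul, Finset.mul_sum, Algebra.TensorProduct.tmul_mul_tmul, one_mul, mul_one,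
    src_add, src_smul, src_one, src_mul, tgt_add, tgt_smul, tgt_one, tgt_mul,
    vf_add_left, vf_add_right, vf_smul_left, vf_smul_right,
    fv_add_left, fv_add_right, fv_smul_left, fv_smul_right, TensorProduct.add_tmul,
    TensorProduct.tmul_add, ← TensorProduct.smul_tmul', TensorProduct.tmul_smul,
    Finset.sum_add_distrib, ← Finset.smul_sum, src_mul_vf, tgt_mul_vf, vf_mul_src, vf_mul_tgt,
    src_mul_fv, tgt_mul_fv, fv_mul_src, fv_mul_tgt, Algebra.TensorProduct.one_def]

/-- The action of `IIB(Ω)` on `LT` through the coproduct. -/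
def comulEnd : IIB D →ₐ[ℂ] Module.End ℂ (LT D) := lift (comulEndGen D) (by
  intro p q h
  refine LinearMap.ext fun z => ?_
  obtain ⟨u, rfl⟩ := lcls_surjective D z
  rw [lift_comulEndGen, lift_comulEndGen]
  -- The relations have to be checked only against the class of `1`: right multiplication by `u`
  -- does the rest.
  exact lcls_mul_right D (lcls_lift_comulGen D h) u)

/-- The coproduct. -/
def comul : IIB D →ₗ[ℂ] LT D := LinearMap.applyₗ (lcls D 1) ∘ₗ (comulEnd D).toLinearMap

theorem comul_apply (X : IIB D) : comul D X = comulEnd D X (lcls D 1) := rfl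

theorem comulEnd_gen (g : IIBGen A Ω 𝔛) (u : IIB D ⊗[ℂ] IIB D) :
    comulEnd D (gen D g) (lcls D u) = lcls D (comulGen D g * u) := by
  rw [comulEnd, lift_gen, comulEndGen_lcls]

/-- Left multiplications commute with right ones. Since the class of `1` generates `LT D` under
right multiplication, the action of `X` is determined by its coproduct. -/
theorem comulEnd_rmul (X : IIB D) (w : IIB D ⊗[ℂ] IIB D) (z : LT D) :
    comulEnd D X (LTensor.rmul _ _ w z) = LTensor.rmul _ _ w (comulEnd D X z) := by
  induction X using gen_induction generalizing z with
  | one => simp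
  | add X Y hX hY => simp only [map_add, LinearMap.add_apply, hX, hY]
  | smul r X hX => simp only [map_smul, LinearMap.smul_apply, hX]
  | mul g X hX =>
    simp only [map_mul, Module.End.mul_apply, hX]
    obtain ⟨u, hu⟩ := lcls_surjective D (comulEnd D X z)
    rw [← hu, LTensor.rmul_cls, comulEnd_gen, comulEnd_gen, LTensor.rmul_cls, mul_assoc]

theorem comulEnd_lcls {X : IIB D} {u : IIB D ⊗[ℂ] IIB D} (hu : lcls D u = comul D X)
    (v : IIB D ⊗[ℂ] IIB D) : comulEnd D X (lcls D v) = lcls D (u * v) := by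
  rw [← LTensor.rmul_cls, hu, comul_apply, ← comulEnd_rmul, LTensor.rmul_cls, one_mul]

theorem comul_mul {X Y : IIB D} {u v : IIB D ⊗[ℂ] IIB D} (hu : lcls D u = comul D X)
    (hv : lcls D v = comul D Y) : comul D (X * Y) = lcls D (u * v) := by
  rw [comul_apply, map_mul, Module.End.mul_apply, ← comul_apply, ← hv, comulEnd_lcls D hu]

theorem comul_one : comul D 1 = lcls D 1 := by
  rw [comul_apply, map_one]; rfl

theorem comul_gen (g : IIBGen A Ω 𝔛) : comul D (gen D g) = lcls D (comulGen D g) := by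
  rw [comul_apply, comulEnd_gen, mul_one]

theorem comul_gen_mul (g : IIBGen A Ω 𝔛) {X : IIB D} {u : IIB D ⊗[ℂ] IIB D}
    (hu : lcls D u = comul D X) : comul D (gen D g * X) = lcls D (comulGen D g * u) :=
  comul_mul D (comul_gen D g).symm hu

theorem comul_vf (x : 𝔛) (ω : Ω) :
    comul D (vf D x ω) = lcls D (∑ i, vf D x (D.w i) ⊗ₜ vf D (D.x i) ω) := comul_gen D _

theorem comul_fv (ω : Ω) (y : 𝔛) :
    comul D (fv D ω y) = lcls D (∑ j, fv D ω (D.y j) ⊗ₜ fv D (D.η j) y) := comul_gen D _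

variable {D} in
/-- An identity `f (X₁ ⊗ X₂) = g X` follows from its compatibility with left multiplication by
generators. -/
theorem comul_induction {σ : ℂ →+* ℂ} {M : Type*} [AddCommGroup M] [Module ℂ M]
    {f : IIB D ⊗[ℂ] IIB D →ₛₗ[σ] M} {g : IIB D →ₛₗ[σ] M}
    (hf : ∀ a X Y, f ((tgt D a * X) ⊗ₜ Y) = f (X ⊗ₜ (src D a * Y)))
    (one : f 1 = g 1)
    (mul : ∀ γ X u, lcls D u = comul D X → f u = g X →
      f (comulGen D γ * u) = g (gen D γ * X))
    {X : IIB D} {u : IIB D ⊗[ℂ] IIB D} (hu : lcls D u = comul D X) : f u = g X := by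
  induction X using gen_induction generalizing u with
  | one =>
    rw [← one]
    exact lcls_congr hf (hu.trans (comul_one D))
  | add X Y hX hY =>
    obtain ⟨v, hv⟩ := lcls_surjective D (comul D X)
    obtain ⟨w, hw⟩ := lcls_surjective D (comul D Y)
    rw [map_add, ← hX hv, ← hY hw, ← map_add]
    exact lcls_congr hf (by rw [hu, map_add, map_add, hv, hw])
  | smul r X hX =>
    obtain ⟨v, hv⟩ := lcls_surjective D (comul D X)
    rw [map_smulₛₗ, ← hX hv, ← map_smulₛₗ]
    exact lcls_congr hf (by rw [hu, map_smul, map_smul, hv])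
  | mul γ X hX =>
    obtain ⟨v, hv⟩ := lcls_surjective D (comul D X)
    rw [← mul γ X v hv (hX hv)]
    exact lcls_congr hf (hu.trans (comul_gen_mul D γ hv))

end Coproduct

end IIB

/-! ### Multiplication in twofold and threefold tensor products -/

section TensorMul

variable {H : Type*} [Ring H] [Algebra ℂ H]

theorem map_mulLeft_id (a : H) (u : H ⊗[ℂ] H) :
    TensorProduct.map (LinearMap.mulLeft ℂ a) LinearMap.id u = (a ⊗ₜ 1) * u := by
  induction u using TensorProduct.induction_on with
  | zero => simp
  | tmul X Y => simp
  | add u v hu hv => rw [map_add, hu, hv, mul_add]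

theorem map_id_mulLeft (a : H) (u : H ⊗[ℂ] H) :
    TensorProduct.map LinearMap.id (LinearMap.mulLeft ℂ a) u = (1 ⊗ₜ a) * u := by
  induction u using TensorProduct.induction_on with
  | zero => simp
  | tmul X Y => simp
  | add u v hu hv => rw [map_add, hu, hv, mul_add]

theorem map_mulRight_id (a : H) (u : H ⊗[ℂ] H) :
    TensorProduct.map (LinearMap.mulRight ℂ a) LinearMap.id u = u * (a ⊗ₜ 1) := by
  induction u using TensorProduct.induction_on with
  | zero => simp
  | tmul X Y => simp
  | add u v hu hv => rw [map_add, hu, hv, add_mul]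

theorem map_id_mulRight (a : H) (u : H ⊗[ℂ] H) :
    TensorProduct.map LinearMap.id (LinearMap.mulRight ℂ a) u = u * (1 ⊗ₜ a) := by
  induction u using TensorProduct.induction_on with
  | zero => simp
  | tmul X Y => simp
  | add u v hu hv => rw [map_add, hu, hv, add_mul]

theorem assoc_tmul_mul (u v : H ⊗[ℂ] H) (X Y : H) :
    TensorProduct.assoc ℂ H H H ((u * v) ⊗ₜ (X * Y)) =
      TensorProduct.assoc ℂ H H H (u ⊗ₜ X) * TensorProduct.assoc ℂ H H H (v ⊗ₜ Y) := by
  induction u using TensorProduct.induction_on with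
  | zero => simp
  | tmul a b =>
    induction v using TensorProduct.induction_on with
    | zero => simp
    | tmul c d => simp
    | add v w hv hw =>
      rw [mul_add, TensorProduct.add_tmul, map_add, hv, hw, TensorProduct.add_tmul, map_add,
        mul_add]
  | add u w hu hw =>
    rw [add_mul, TensorProduct.add_tmul, map_add, hu, hw, TensorProduct.add_tmul, map_add,
      add_mul]

end TensorMul

section BalancedCongr

variable {H : Type*} [Ring H] [Algebra ℂ H] {B C : Type*}
  (ρ₁ l₁ : B → Module.End ℂ H) (ρ₂ l₂ : C → Module.End ℂ H)

theorem balSub₃_mkQ_assoc_congr {u v : H ⊗[ℂ] H}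
    (h : (balSub ρ₁ l₁).mkQ u = (balSub ρ₁ l₁).mkQ v) (Z : H) :
    (balSub₃ ρ₁ l₁ ρ₂ l₂).mkQ (TensorProduct.assoc ℂ H H H (u ⊗ₜ Z)) =
      (balSub₃ ρ₁ l₁ ρ₂ l₂).mkQ (TensorProduct.assoc ℂ H H H (v ⊗ₜ Z)) :=
  congrArg (fun z => balAssocL ρ₁ l₁ ρ₂ l₂ (z ⊗ₜ Z)) h

theorem balSub₃_mkQ_tmul_congr {u v : H ⊗[ℂ] H}
    (h : (balSub ρ₂ l₂).mkQ u = (balSub ρ₂ l₂).mkQ v) (X : H) :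
    (balSub₃ ρ₁ l₁ ρ₂ l₂).mkQ (X ⊗ₜ u) = (balSub₃ ρ₁ l₁ ρ₂ l₂).mkQ (X ⊗ₜ v) :=
  congrArg (fun z => balAssocR ρ₁ l₁ ρ₂ l₂ (X ⊗ₜ z)) h

theorem balSub₃_mkQ_left (b : B) (X : H) (v : H ⊗[ℂ] H) :
    (balSub₃ ρ₁ l₁ ρ₂ l₂).mkQ ((ρ₁ b X) ⊗ₜ v) =
      (balSub₃ ρ₁ l₁ ρ₂ l₂).mkQ (X ⊗ₜ TensorProduct.map (l₁ b) LinearMap.id v) := by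
  induction v using TensorProduct.induction_on with
  | zero => simp
  | tmul Y Z => exact (Submodule.Quotient.eq _).2 (Submodule.subset_span (Or.inl ⟨b, X, Y, Z, rfl⟩))
  | add u v hu hv => simp only [TensorProduct.tmul_add, map_add, hu, hv]

theorem balSub₃_mkQ_right (c : C) (u : H ⊗[ℂ] H) (Z : H) :
    (balSub₃ ρ₁ l₁ ρ₂ l₂).mkQ
        (TensorProduct.assoc ℂ H H H (TensorProduct.map LinearMap.id (ρ₂ c) u ⊗ₜ Z)) =
      (balSub₃ ρ₁ l₁ ρ₂ l₂).mkQ (TensorProduct.assoc ℂ H H H (u ⊗ₜ (l₂ c Z))) := by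
  induction u using TensorProduct.induction_on with
  | zero => simp
  | tmul X Y => exact (Submodule.Quotient.eq _).2 (Submodule.subset_span (Or.inr ⟨c, X, Y, Z, rfl⟩))
  | add u v hu hv => simp only [TensorProduct.add_tmul, map_add, hu, hv]

theorem balSub_mkQ_congr {ρ l : B → Module.End ℂ H} {M : Type*} [AddCommGroup M] [Module ℂ M]
    {f : H ⊗[ℂ] H →ₗ[ℂ] M} (hf : ∀ b X Y, f ((ρ b X) ⊗ₜ Y) = f (X ⊗ₜ (l b Y)))
    {u v : H ⊗[ℂ] H} (h : (balSub ρ l).mkQ u = (balSub ρ l).mkQ v) : f u = f v := by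
  have hle : balSub ρ l ≤ LinearMap.ker f := by
    refine Submodule.span_le.2 ?_
    rintro _ ⟨a, X, Y, rfl⟩
    rw [SetLike.mem_coe, LinearMap.mem_ker, map_sub, sub_eq_zero]
    exact hf a X Y
  rw [← sub_eq_zero, ← map_sub]
  exact LinearMap.mem_ker.1 (hle ((Submodule.Quotient.eq _).1 h))

theorem balAssocR_lTensor_tmul (Δ : H →ₗ[ℂ] BalTensor ρ₂ l₂) (X : H) {Y : H} {v : H ⊗[ℂ] H}
    (hv : (balSub ρ₂ l₂).mkQ v = Δ Y) :
    balAssocR ρ₁ l₁ ρ₂ l₂ (Δ.lTensor H (X ⊗ₜ Y)) = (balSub₃ ρ₁ l₁ ρ₂ l₂).mkQ (X ⊗ₜ v) := by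
  rw [LinearMap.lTensor_tmul, ← hv]; rfl

theorem balAssocL_rTensor_tmul (Δ : H →ₗ[ℂ] BalTensor ρ₁ l₁) {X : H} (Y : H) {u : H ⊗[ℂ] H}
    (hu : (balSub ρ₁ l₁).mkQ u = Δ X) :
    balAssocL ρ₁ l₁ ρ₂ l₂ (Δ.rTensor H (X ⊗ₜ Y)) =
      (balSub₃ ρ₁ l₁ ρ₂ l₂).mkQ (TensorProduct.assoc ℂ H H H (u ⊗ₜ Y)) := by
  rw [LinearMap.rTensor_tmul, ← hu]; rfl

theorem Submodule.sub_mem_of_mkQ_eq {M : Type*} [AddCommGroup M] [Module ℂ M]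
    (N : Submodule ℂ M) {u v : M} (h : N.mkQ u = N.mkQ v) : u - v ∈ N :=
  (Submodule.Quotient.eq N).1 h

variable {n m : ℕ} {w : H ⊗[ℂ] (H ⊗[ℂ] H)}

/-- The two bracketings of `w` serve different relations: those between the first and second factors
are preserved through the `P j`, those between the second and third through the `Q i`. -/
theorem balSub₃_le_comap_mulLeft (p : Fin n → H) (Q : Fin n → H ⊗[ℂ] H)
    (P : Fin m → H ⊗[ℂ] H) (q : Fin m → H) (h₂ : w = ∑ i, p i ⊗ₜ Q i)
    (h₁ : w = ∑ j, TensorProduct.assoc ℂ H H H (P j ⊗ₜ q j))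
    (hP : ∀ j b X Y, (balSub ρ₁ l₁).mkQ (P j * ((ρ₁ b X) ⊗ₜ Y)) =
      (balSub ρ₁ l₁).mkQ (P j * (X ⊗ₜ (l₁ b Y))))
    (hQ : ∀ i c X Y, (balSub ρ₂ l₂).mkQ (Q i * ((ρ₂ c X) ⊗ₜ Y)) =
      (balSub ρ₂ l₂).mkQ (Q i * (X ⊗ₜ (l₂ c Y)))) :
    balSub₃ ρ₁ l₁ ρ₂ l₂ ≤ (balSub₃ ρ₁ l₁ ρ₂ l₂).comap (LinearMap.mulLeft ℂ w) := by
  refine Submodule.span_le.2 ?_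
  rintro _ (⟨b, X, Y, Z, rfl⟩ | ⟨c, X, Y, Z, rfl⟩)
  · rw [SetLike.mem_coe, Submodule.mem_comap, map_sub]
    refine Submodule.sub_mem_of_mkQ_eq _ ?_
    change (balSub₃ ρ₁ l₁ ρ₂ l₂).mkQ (w * TensorProduct.assoc ℂ H H H ((ρ₁ b X ⊗ₜ Y) ⊗ₜ Z)) =
      (balSub₃ ρ₁ l₁ ρ₂ l₂).mkQ (w * TensorProduct.assoc ℂ H H H ((X ⊗ₜ l₁ b Y) ⊗ₜ Z))
    simp only [h₁, Finset.sum_mul, ← assoc_tmul_mul]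
    rw [map_sum, map_sum]
    exact Finset.sum_congr rfl fun j _ =>
      balSub₃_mkQ_assoc_congr ρ₁ l₁ ρ₂ l₂ (hP _ _ _ _) _
  · rw [SetLike.mem_coe, Submodule.mem_comap, map_sub]
    refine Submodule.sub_mem_of_mkQ_eq _ ?_
    rw [LinearMap.mulLeft_apply, LinearMap.mulLeft_apply, h₂, Finset.sum_mul, Finset.sum_mul,
      map_sum, map_sum]
    refine Finset.sum_congr rfl fun i _ => ?_
    rw [Algebra.TensorProduct.tmul_mul_tmul, Algebra.TensorProduct.tmul_mul_tmul]
    exact balSub₃_mkQ_tmul_congr ρ₁ l₁ ρ₂ l₂ (hQ _ _ _ _) _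

variable {ρ₁ l₁ ρ₂ l₂}
  (hw : balSub₃ ρ₁ l₁ ρ₂ l₂ ≤ (balSub₃ ρ₁ l₁ ρ₂ l₂).comap (LinearMap.mulLeft ℂ w))

/-- The inductive step for one side of coassociativity: a coproduct multiplied on the left becomes a
twofold coproduct `w` multiplied on the left. `balAssocL_rTensor_mul` does the same for the other
side with the same `w`. -/
theorem balAssocR_lTensor_mul (Δ : H →ₗ[ℂ] BalTensor ρ₂ l₂) (p q : Fin n → H)
    (Q : Fin n → H ⊗[ℂ] H) (h : w = ∑ i, p i ⊗ₜ Q i)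
    (hQ : ∀ i Y v, (balSub ρ₂ l₂).mkQ v = Δ Y → Δ (q i * Y) = (balSub ρ₂ l₂).mkQ (Q i * v))
    (u : H ⊗[ℂ] H) :
    balAssocR ρ₁ l₁ ρ₂ l₂ (Δ.lTensor H ((∑ i, p i ⊗ₜ q i) * u)) =
      Submodule.mapQ _ _ (LinearMap.mulLeft ℂ w) hw
        (balAssocR ρ₁ l₁ ρ₂ l₂ (Δ.lTensor H u)) := by
  induction u using TensorProduct.induction_on with
  | zero => simp only [mul_zero, map_zero]
  | add u v hu hv => simp only [mul_add, map_add, hu, hv]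
  | tmul X Y =>
    obtain ⟨v, hv⟩ := Submodule.mkQ_surjective _ (Δ Y)
    rw [balAssocR_lTensor_tmul ρ₁ l₁ ρ₂ l₂ Δ X hv, Submodule.mkQ_apply, Submodule.mapQ_apply,
      LinearMap.mulLeft_apply, h, Finset.sum_mul, Finset.sum_mul, map_sum, map_sum,
      ← Submodule.mkQ_apply, map_sum]
    refine Finset.sum_congr rfl fun i _ => ?_
    rw [Algebra.TensorProduct.tmul_mul_tmul, Algebra.TensorProduct.tmul_mul_tmul,
      balAssocR_lTensor_tmul ρ₁ l₁ ρ₂ l₂ Δ _ (hQ _ _ _ hv).symm]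

theorem balAssocL_rTensor_mul (Δ : H →ₗ[ℂ] BalTensor ρ₁ l₁) (p q : Fin m → H)
    (P : Fin m → H ⊗[ℂ] H) (h : w = ∑ j, TensorProduct.assoc ℂ H H H (P j ⊗ₜ q j))
    (hP : ∀ j X u, (balSub ρ₁ l₁).mkQ u = Δ X → Δ (p j * X) = (balSub ρ₁ l₁).mkQ (P j * u))
    (v : H ⊗[ℂ] H) :
    balAssocL ρ₁ l₁ ρ₂ l₂ (Δ.rTensor H ((∑ j, p j ⊗ₜ q j) * v)) =
      Submodule.mapQ _ _ (LinearMap.mulLeft ℂ w) hw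
        (balAssocL ρ₁ l₁ ρ₂ l₂ (Δ.rTensor H v)) := by
  induction v using TensorProduct.induction_on with
  | zero => simp only [mul_zero, map_zero]
  | add u v hu hv => simp only [mul_add, map_add, hu, hv]
  | tmul X Y =>
    obtain ⟨u, hu⟩ := Submodule.mkQ_surjective _ (Δ X)
    rw [balAssocL_rTensor_tmul ρ₁ l₁ ρ₂ l₂ Δ Y hu, Submodule.mkQ_apply, Submodule.mapQ_apply,
      LinearMap.mulLeft_apply, h, Finset.sum_mul, Finset.sum_mul, map_sum, map_sum,
      ← Submodule.mkQ_apply, map_sum]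
    refine Finset.sum_congr rfl fun j _ => ?_
    rw [Algebra.TensorProduct.tmul_mul_tmul, ← assoc_tmul_mul,
      balAssocL_rTensor_tmul ρ₁ l₁ ρ₂ l₂ Δ _ (hP _ _ _ hu).symm]

end BalancedCongr

namespace IIB

/-! ### Pure and mixed coassociativity from generators -/

section Coassociativity

variable {A Ω 𝔛 : Type*} [Ring A] [Algebra ℂ A]
  [AddCommGroup Ω] [Module ℂ Ω] [Module A Ω] [Module Aᵐᵒᵖ Ω]
  [AddCommGroup 𝔛] [Module ℂ 𝔛] [Module A 𝔛] [Module Aᵐᵒᵖ 𝔛]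
  (D : PivotalDual A Ω 𝔛)

/-- A map to a balanced tensor square of `IIB(Ω)` that is determined by its values on generators:
left multiplication with a generator corresponds to left multiplication with its coproduct. -/
structure GenCoproduct {B : Type*} (ρ l : B → Module.End ℂ (IIB D)) where
  /-- the coproduct -/
  Δ : IIB D →ₗ[ℂ] BalTensor ρ l
  /-- the coproducts of the generators -/
  onGen : IIBGen A Ω 𝔛 → IIB D ⊗[ℂ] IIB D
  one : Δ 1 = (balSub ρ l).mkQ 1
  gen_mul : ∀ g X u, (balSub ρ l).mkQ u = Δ X →
    Δ (gen D g * X) = (balSub ρ l).mkQ (onGen g * u)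
  balanced : ∀ g b X Y, (balSub ρ l).mkQ (onGen g * ((ρ b X) ⊗ₜ Y)) =
    (balSub ρ l).mkQ (onGen g * (X ⊗ₜ (l b Y)))

variable {D} {B C : Type*} {ρ₁ l₁ : B → Module.End ℂ (IIB D)} {ρ₂ l₂ : C → Module.End ℂ (IIB D)}

/-- `(id ⊗ Δ₂) Δ₁ = (Δ₁ ⊗ id) Δ₂` if this holds for the generators. -/
theorem mixed_coassoc (P : GenCoproduct D ρ₁ l₁) (Q : GenCoproduct D ρ₂ l₂)
    (hQ : ∀ b X u, (balSub ρ₂ l₂).mkQ u = Q.Δ X →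
      Q.Δ (l₁ b X) = (balSub ρ₂ l₂).mkQ (TensorProduct.map (l₁ b) LinearMap.id u))
    (hP : ∀ c X u, (balSub ρ₁ l₁).mkQ u = P.Δ X →
      P.Δ (ρ₂ c X) = (balSub ρ₁ l₁).mkQ (TensorProduct.map LinearMap.id (ρ₂ c) u))
    (hgen : ∀ g, ∃ (n m : ℕ) (p q : Fin n → IIBGen A Ω 𝔛) (p' q' : Fin m → IIBGen A Ω 𝔛),
      P.onGen g = ∑ i, gen D (p i) ⊗ₜ gen D (q i) ∧
      Q.onGen g = ∑ j, gen D (p' j) ⊗ₜ gen D (q' j) ∧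
      ∑ i, gen D (p i) ⊗ₜ Q.onGen (q i) =
        ∑ j, TensorProduct.assoc ℂ _ _ _ (P.onGen (p' j) ⊗ₜ[ℂ] gen D (q' j)))
    {X : IIB D} {u v : IIB D ⊗[ℂ] IIB D} (hu : (balSub ρ₁ l₁).mkQ u = P.Δ X)
    (hv : (balSub ρ₂ l₂).mkQ v = Q.Δ X) :
    balAssocR ρ₁ l₁ ρ₂ l₂ (Q.Δ.lTensor _ u) = balAssocL ρ₁ l₁ ρ₂ l₂ (P.Δ.rTensor _ v) := by
  let F : IIB D ⊗[ℂ] IIB D →ₗ[ℂ] BalTensor₃ ρ₁ l₁ ρ₂ l₂ :=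
    balAssocR ρ₁ l₁ ρ₂ l₂ ∘ₗ Q.Δ.lTensor _
  let G : IIB D ⊗[ℂ] IIB D →ₗ[ℂ] BalTensor₃ ρ₁ l₁ ρ₂ l₂ :=
    balAssocL ρ₁ l₁ ρ₂ l₂ ∘ₗ P.Δ.rTensor _
  -- Each of the two iterated coproducts depends only on the class of a representative, because the
  -- second coproduct to be applied is linear for the action that balances the first one.
  have F_bal : ∀ b X Y, F ((ρ₁ b X) ⊗ₜ Y) = F (X ⊗ₜ (l₁ b Y)) := fun b X Y => by
    obtain ⟨v, hv⟩ := Submodule.mkQ_surjective _ (Q.Δ Y)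
    change balAssocR ρ₁ l₁ ρ₂ l₂ (Q.Δ.lTensor _ (ρ₁ b X ⊗ₜ Y)) =
      balAssocR ρ₁ l₁ ρ₂ l₂ (Q.Δ.lTensor _ (X ⊗ₜ l₁ b Y))
    rw [balAssocR_lTensor_tmul _ _ _ _ _ _ hv,
      balAssocR_lTensor_tmul _ _ _ _ _ _ (hQ b Y v hv).symm, balSub₃_mkQ_left]
  have G_bal : ∀ c X Y, G ((ρ₂ c X) ⊗ₜ Y) = G (X ⊗ₜ (l₂ c Y)) := fun c X Y => by
    obtain ⟨u, hu⟩ := Submodule.mkQ_surjective _ (P.Δ X)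
    change balAssocL ρ₁ l₁ ρ₂ l₂ (P.Δ.rTensor _ (ρ₂ c X ⊗ₜ Y)) =
      balAssocL ρ₁ l₁ ρ₂ l₂ (P.Δ.rTensor _ (X ⊗ₜ l₂ c Y))
    rw [balAssocL_rTensor_tmul _ _ _ _ _ _ hu,
      balAssocL_rTensor_tmul _ _ _ _ _ _ (hP c X u hu).symm, balSub₃_mkQ_right]
  -- Both sides are multiplied on the left by the same twofold coproduct of `g`, so equality is
  -- propagated for arbitrary `u` and `v`, representatives or not.
  have step : ∀ g u v, F u = G v → F (P.onGen g * u) = G (Q.onGen g * v) := by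
    intro g u v huv
    obtain ⟨n, m, p, q, p', q', hp, hq, hpq⟩ := hgen g
    have hw := balSub₃_le_comap_mulLeft ρ₁ l₁ ρ₂ l₂ (fun i => gen D (p i)) (fun i => Q.onGen (q i))
      (fun j => P.onGen (p' j)) (fun j => gen D (q' j)) rfl hpq (fun j => P.balanced (p' j))
      (fun i => Q.balanced (q i))
    rw [hp, hq]
    refine (balAssocR_lTensor_mul hw Q.Δ _ _ _ rfl (fun i => Q.gen_mul (q i)) u).trans ?_
    refine Eq.trans ?_
      (balAssocL_rTensor_mul hw P.Δ _ _ _ hpq (fun j => P.gen_mul (p' j)) v).symm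
    exact congrArg _ huv
  change F u = G v
  induction X using gen_induction generalizing u v with
  | one =>
    rw [balSub_mkQ_congr F_bal (hu.trans P.one), balSub_mkQ_congr G_bal (hv.trans Q.one),
      Algebra.TensorProduct.one_def]
    exact (balAssocR_lTensor_tmul ρ₁ l₁ ρ₂ l₂ Q.Δ 1 Q.one.symm).trans
      (balAssocL_rTensor_tmul ρ₁ l₁ ρ₂ l₂ P.Δ 1 P.one.symm).symm
  | add X Y hX hY =>
    obtain ⟨u₁, hu₁⟩ := Submodule.mkQ_surjective _ (P.Δ X)
    obtain ⟨u₂, hu₂⟩ := Submodule.mkQ_surjective _ (P.Δ Y)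
    obtain ⟨v₁, hv₁⟩ := Submodule.mkQ_surjective _ (Q.Δ X)
    obtain ⟨v₂, hv₂⟩ := Submodule.mkQ_surjective _ (Q.Δ Y)
    rw [balSub_mkQ_congr F_bal (v := u₁ + u₂) (by rw [hu, map_add, map_add, hu₁, hu₂]),
      balSub_mkQ_congr G_bal (v := v₁ + v₂) (by rw [hv, map_add, map_add, hv₁, hv₂]),
      map_add, map_add, hX hu₁ hv₁, hY hu₂ hv₂]
  | smul r X hX =>
    obtain ⟨u₁, hu₁⟩ := Submodule.mkQ_surjective _ (P.Δ X)
    obtain ⟨v₁, hv₁⟩ := Submodule.mkQ_surjective _ (Q.Δ X)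
    rw [balSub_mkQ_congr F_bal (v := r • u₁) (by rw [hu, map_smul, map_smul, hu₁]),
      balSub_mkQ_congr G_bal (v := r • v₁) (by rw [hv, map_smul, map_smul, hv₁]),
      map_smul, map_smul, hX hu₁ hv₁]
  | mul g X hX =>
    obtain ⟨u₁, hu₁⟩ := Submodule.mkQ_surjective _ (P.Δ X)
    obtain ⟨v₁, hv₁⟩ := Submodule.mkQ_surjective _ (Q.Δ X)
    rw [balSub_mkQ_congr F_bal (hu.trans (P.gen_mul g X u₁ hu₁)),
      balSub_mkQ_congr G_bal (hv.trans (Q.gen_mul g X v₁ hv₁))]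
    exact step g _ _ (hX hu₁ hv₁)

end Coassociativity

end IIB

namespace IIB

/-! ### The left bialgebroid -/

section LeftCoproduct

variable {A Ω 𝔛 : Type*} [Ring A] [Algebra ℂ A]
  [AddCommGroup Ω] [Module ℂ Ω] [Module A Ω] [Module Aᵐᵒᵖ Ω]
  [AddCommGroup 𝔛] [Module ℂ 𝔛] [Module A 𝔛] [Module Aᵐᵒᵖ 𝔛]
  (D : PivotalDual A Ω 𝔛)

/-- The coproduct of the left bialgebroid, with its values on generators. -/
def leftGenCoproduct : GenCoproduct D (leftActR (tgtHom D)) (leftActL (srcHom D)) where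
  Δ := comul D
  onGen := comulGen D
  one := comul_one D
  gen_mul g _ _ hu := comul_gen_mul D g hu
  balanced := lcls_comulGen_mul D

theorem comul_src_mul (a : A) {X : IIB D} {u : IIB D ⊗[ℂ] IIB D} (hu : lcls D u = comul D X) :
    comul D (src D a * X) = lcls D ((src D a ⊗ₜ 1) * u) :=
  comul_gen_mul D (.src a) hu

theorem comul_tgt_mul (a : A) {X : IIB D} {u : IIB D ⊗[ℂ] IIB D} (hu : lcls D u = comul D X) :
    comul D (tgt D a * X) = lcls D ((1 ⊗ₜ tgt D a) * u) :=
  comul_gen_mul D (.tgt a) hu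

/-- The classes of `tgt D a ⊗ 1` and `1 ⊗ src D a` coincide, and both sides are the action of `X` on
this class. -/
theorem comul_takeuchi (a : A) {X : IIB D} {u : IIB D ⊗[ℂ] IIB D} (hu : lcls D u = comul D X) :
    lcls D (u * (tgt D a ⊗ₜ 1)) = lcls D (u * (1 ⊗ₜ src D a)) := by
  rw [← comulEnd_lcls D hu, ← comulEnd_lcls D hu, lcls_tgt_tmul, mul_one]

theorem comul_coassoc {X : IIB D} {u v : IIB D ⊗[ℂ] IIB D} (hu : lcls D u = comul D X)
    (hv : lcls D v = comul D X) :
    balAssocR (leftActR (tgtHom D)) (leftActL (srcHom D)) (leftActR (tgtHom D))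
        (leftActL (srcHom D)) ((comul D).lTensor _ u) =
      balAssocL (leftActR (tgtHom D)) (leftActL (srcHom D)) (leftActR (tgtHom D))
        (leftActL (srcHom D)) ((comul D).rTensor _ v) := by
  refine mixed_coassoc (leftGenCoproduct D) (leftGenCoproduct D) (fun a X u hu => ?_)
    (fun a X u hu => ?_) (fun g => ?_) hu hv
  · rw [leftActL, map_mulLeft_id]
    exact comul_src_mul D a hu
  · rw [leftActR, map_id_mulLeft]
    exact comul_tgt_mul D a hu
  · cases g with
    | src a =>
      -- Both legs must be generators, so the unit is written as the generator `.src 1`; in the next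
      -- case it is `.tgt 1`.
      refine ⟨1, 1, fun _ => .src a, fun _ => .src 1, fun _ => .src a, fun _ => .src 1, ?_⟩
      simp [leftGenCoproduct, comulGen_src, gen_src, src_one]
    | tgt a =>
      refine ⟨1, 1, fun _ => .tgt 1, fun _ => .tgt a, fun _ => .tgt 1, fun _ => .tgt a, ?_⟩
      simp [leftGenCoproduct, comulGen_tgt, gen_tgt, tgt_one]
    | vf x ω =>
      refine ⟨_, _, fun i => .vf x (D.w i), fun i => .vf (D.x i) ω,
        fun i => .vf x (D.w i), fun i => .vf (D.x i) ω, rfl, rfl, ?_⟩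
      simp only [leftGenCoproduct, comulGen_vf, gen_vf, TensorProduct.tmul_sum,
        TensorProduct.sum_tmul, map_sum, TensorProduct.assoc_tmul]
      exact Finset.sum_comm
    | fv ω y =>
      refine ⟨_, _, fun j => .fv ω (D.y j), fun j => .fv (D.η j) y,
        fun j => .fv ω (D.y j), fun j => .fv (D.η j) y, rfl, rfl, ?_⟩
      simp only [leftGenCoproduct, comulGen_fv, gen_fv, TensorProduct.tmul_sum,
        TensorProduct.sum_tmul, map_sum, TensorProduct.assoc_tmul]
      exact Finset.sum_comm

end LeftCoproduct

section LeftBialgebroid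

variable {A Ω 𝔛 : Type*} [Ring A] [Algebra ℂ A]
  [AddCommGroup Ω] [Module ℂ Ω] [Module A Ω] [Module Aᵐᵒᵖ Ω] [SMulCommClass A Aᵐᵒᵖ Ω]
  [IsScalarTower ℂ A Ω]
  [AddCommGroup 𝔛] [Module ℂ 𝔛] [Module A 𝔛] [Module Aᵐᵒᵖ 𝔛] [SMulCommClass A Aᵐᵒᵖ 𝔛]
  [IsScalarTower ℂ A 𝔛]
  (D : PivotalDual A Ω 𝔛)

theorem comul_counit_left {X : IIB D} {u : IIB D ⊗[ℂ] IIB D} (hu : lcls D u = comul D X) :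
    LinearMap.mul' ℂ (IIB D)
      (TensorProduct.map ((srcHom D).toLinearMap ∘ₗ counit D) LinearMap.id u) = X := by
  refine comul_induction (f := LinearMap.mul' ℂ (IIB D) ∘ₗ
    TensorProduct.map ((srcHom D).toLinearMap ∘ₗ counit D) LinearMap.id) (g := LinearMap.id)
    (fun a X Y => ?_) ?_ (fun γ X u hX h => ?_) hu
  · change src D (counit D (tgt D a * X)) * Y = src D (counit D X) * (src D a * Y)
    rw [counit_tgt_mul, src_mul, mul_assoc]
  · change src D (counit D 1) * 1 = 1
    rw [counit_one, src_one, mul_one]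
  -- With `X` replaced by its counit expansion, what is left is compatibility with left
  -- multiplication by a generator. This holds for every tensor `u`, so the link with `X` is dropped
  -- before the induction on `u`.
  · rw [LinearMap.id_apply, ← LinearMap.id_apply (R := ℂ) X, ← h]
    clear h hX
    induction u using TensorProduct.induction_on with
    | zero => simp only [mul_zero, map_zero]
    | add u v hu hv => simp only [mul_add, map_add, hu, hv]
    | tmul X Y =>
      have hf : ∀ X Y, (LinearMap.mul' ℂ (IIB D) ∘ₗ TensorProduct.map
        ((srcHom D).toLinearMap ∘ₗ counit D) LinearMap.id) (X ⊗ₜ Y) =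
          src D (counit D X) * Y := fun _ _ => rfl
      cases γ with
      | src a =>
        rw [comulGen_src, Algebra.TensorProduct.tmul_mul_tmul, one_mul, hf, hf, counit_src_mul,
          src_mul, mul_assoc, gen_src]
      | tgt a =>
        rw [comulGen_tgt, Algebra.TensorProduct.tmul_mul_tmul, one_mul, hf, hf, ← mul_assoc,
          ← mul_assoc, src_mul_tgt, gen_tgt]
      | vf x ω =>
        simp only [comulGen_vf, Finset.sum_mul, Algebra.TensorProduct.tmul_mul_tmul, hf, map_sum,
          counit_vf_mul, ← mul_assoc, src_mul_vf, ← D.evL_mid, gen_vf, vf_mul_src]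
        rw [← Finset.sum_mul, ← vf_sum_left, D.coevL_vec]
      | fv ω y =>
        simp only [comulGen_fv, Finset.sum_mul, Algebra.TensorProduct.tmul_mul_tmul, hf, map_sum,
          counit_fv_mul, ← mul_assoc, src_mul_fv, ← D.evR_mid, gen_fv, fv_mul_src]
        rw [← Finset.sum_mul, ← fv_sum_left, D.coevR_form]

theorem comul_counit_right {X : IIB D} {u : IIB D ⊗[ℂ] IIB D} (hu : lcls D u = comul D X) :
    LinearMap.mul' ℂ (IIB D) (TensorProduct.map ((tgtHom D).toLinearMap ∘ₗ
      (MulOpposite.opLinearEquiv ℂ).toLinearMap ∘ₗ counit D) LinearMap.id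
      (TensorProduct.comm ℂ _ _ u)) = X := by
  refine comul_induction (f := LinearMap.mul' ℂ (IIB D) ∘ₗ
    TensorProduct.map ((tgtHom D).toLinearMap ∘ₗ
      (MulOpposite.opLinearEquiv ℂ).toLinearMap ∘ₗ counit D) LinearMap.id ∘ₗ
      (TensorProduct.comm ℂ _ _).toLinearMap) (g := LinearMap.id)
    (fun a X Y => ?_) ?_ (fun γ X u hX h => ?_) hu
  · change tgt D (counit D Y) * (tgt D a * X) = tgt D (counit D (src D a * Y)) * X
    rw [counit_src_mul, tgt_mul, mul_assoc]
  · change tgt D (counit D 1) * 1 = 1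
    rw [counit_one, tgt_one, mul_one]
  · rw [LinearMap.id_apply, ← LinearMap.id_apply (R := ℂ) X, ← h]
    clear h hX
    induction u using TensorProduct.induction_on with
    | zero => simp only [mul_zero, map_zero]
    | add u v hu hv => simp only [mul_add, map_add, hu, hv]
    | tmul X Y =>
      have hf : ∀ X Y, (LinearMap.mul' ℂ (IIB D) ∘ₗ TensorProduct.map
        ((tgtHom D).toLinearMap ∘ₗ (MulOpposite.opLinearEquiv ℂ).toLinearMap ∘ₗ counit D)
          LinearMap.id ∘ₗ (TensorProduct.comm ℂ _ _).toLinearMap) (X ⊗ₜ Y) =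
          tgt D (counit D Y) * X := fun _ _ => rfl
      cases γ with
      | src a =>
        rw [comulGen_src, Algebra.TensorProduct.tmul_mul_tmul, one_mul, hf, hf, ← mul_assoc,
          ← mul_assoc, gen_src, src_mul_tgt]
      | tgt a =>
        rw [comulGen_tgt, Algebra.TensorProduct.tmul_mul_tmul, one_mul, hf, hf, counit_tgt_mul,
          tgt_mul, mul_assoc, gen_tgt]
      | vf x ω =>
        simp only [comulGen_vf, Finset.sum_mul, Algebra.TensorProduct.tmul_mul_tmul, hf, map_sum,
          counit_vf_mul, ← mul_assoc, tgt_mul_vf, gen_vf, vf_mul_tgt]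
        rw [← Finset.sum_mul, ← vf_sum_right, D.coevL_form]
      | fv ω y =>
        simp only [comulGen_fv, Finset.sum_mul, Algebra.TensorProduct.tmul_mul_tmul, hf, map_sum,
          counit_fv_mul, ← mul_assoc, tgt_mul_fv, gen_fv, fv_mul_tgt]
        rw [← Finset.sum_mul, ← fv_sum_right, D.coevR_vec]

/-- The left bialgebroid structure of `IIB(Ω)`. -/
def leftBialgebroid : LeftBialgebroid A (IIB D) where
  s := srcHom D
  t := tgtHom D
  comm := src_mul_tgt D
  Δ := comul D
  ε := counit D
  Δ_bimod a b X u hu := by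
    have h := comul_src_mul D a (comul_tgt_mul D b hu).symm
    rw [← mul_assoc, ← mul_assoc, Algebra.TensorProduct.tmul_mul_tmul, mul_one, one_mul] at h
    exact h
  ε_bimod a b X := by
    rw [srcHom_apply, tgtHom_op, mul_assoc, counit_src_mul, counit_tgt_mul, mul_assoc]
  coassoc X u v hu hv := comul_coassoc D hu hv
  counit_left X u hu := comul_counit_left D hu
  counit_right X u hu := comul_counit_right D hu
  takeuchi a X u hu := comul_takeuchi D a hu
  Δ_one := comul_one D
  Δ_mul X Y u v hu hv := comul_mul D hu hv
  ε_one := counit_one D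
  ε_mul_s X Y := by rw [srcHom_apply, counit_mul, counit_mul, counit_src]
  ε_mul_t X Y := by rw [tgtHom_op, counit_mul, counit_mul, counit_tgt]

end LeftBialgebroid

end IIB

namespace IIB

/-! ### The antipode -/

section Antipode

variable {A Ω 𝔛 : Type*} [Ring A] [Algebra ℂ A]
  [AddCommGroup Ω] [Module ℂ Ω] [Module A Ω] [Module Aᵐᵒᵖ Ω]
  [AddCommGroup 𝔛] [Module ℂ 𝔛] [Module A 𝔛] [Module Aᵐᵒᵖ 𝔛]
  (D : PivotalDual A Ω 𝔛)

/-- The antipode exchanges the two copies of `A` and the two kinds of generators. -/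
def swapGen : IIBGen A Ω 𝔛 → IIBGen A Ω 𝔛
  | .src a => .tgt a
  | .tgt a => .src a
  | .vf x ω => .fv ω x
  | .fv ω x => .vf x ω

/-- The antipode as an algebra map to the opposite algebra. -/
def antipodeHom : IIB D →ₐ[ℂ] (IIB D)ᵐᵒᵖ := lift (fun g => op (gen D (swapGen g))) (by
  intro p q h
  apply MulOpposite.unop_injective
  -- Reversal of products and the swap of generators interchange `coevL_fv` with `coevL_src` and
  -- `coevR_vf` with `coevR_tgt`.
  cases h <;> simp only [IIBGen.mk, map_add, map_smul, map_mul, map_one, map_sum,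
    FreeAlgebra.lift_ι_apply, swapGen, gen_src, gen_tgt, gen_vf, gen_fv, MulOpposite.unop_add,
    MulOpposite.unop_mul, MulOpposite.unop_smul, MulOpposite.unop_one, MulOpposite.unop_op,
    Finset.unop_sum,
    src_add, src_smul, src_one, src_mul, tgt_add, tgt_smul, tgt_one, tgt_mul, src_mul_tgt,
    vf_add_left, vf_add_right, vf_smul_left, vf_smul_right,
    fv_add_left, fv_add_right, fv_smul_left, fv_smul_right, src_mul_vf, tgt_mul_vf, vf_mul_src,
    vf_mul_tgt, src_mul_fv, tgt_mul_fv, fv_mul_src, fv_mul_tgt, sum_fv_mul_vf, sum_vf_mul_fv,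
    sum_fv_mul_vf', sum_vf_mul_fv'])

theorem unop_antipodeHom_mul (X Y : IIB D) :
    unop (antipodeHom D (X * Y)) = unop (antipodeHom D Y) * unop (antipodeHom D X) := by
  rw [map_mul, MulOpposite.unop_mul]

theorem unop_antipodeHom_gen (g : IIBGen A Ω 𝔛) :
    unop (antipodeHom D (gen D g)) = gen D (swapGen g) := by
  rw [antipodeHom, lift_gen, MulOpposite.unop_op]

theorem unop_antipodeHom_involutive (X : IIB D) :
    unop (antipodeHom D (unop (antipodeHom D X))) = X := by
  induction X using gen_induction with
  | one => simp only [map_one, MulOpposite.unop_one]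
  | add X Y hX hY => simp only [map_add, MulOpposite.unop_add, hX, hY]
  | smul r X hX => simp only [map_smul, MulOpposite.unop_smul, hX]
  | mul g X hX =>
    rw [unop_antipodeHom_mul, unop_antipodeHom_mul, hX, unop_antipodeHom_gen,
      unop_antipodeHom_gen]
    cases g <;> rfl

/-- The antipode. -/
def antipode : IIB D ≃ₗ[ℂ] IIB D :=
  LinearEquiv.ofInvolutive
    ((MulOpposite.opLinearEquiv ℂ).symm.toLinearMap ∘ₗ (antipodeHom D).toLinearMap)
    (unop_antipodeHom_involutive D)

theorem antipode_antipode (X : IIB D) : antipode D (antipode D X) = X :=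
  unop_antipodeHom_involutive D X

theorem antipode_mul (X Y : IIB D) : antipode D (X * Y) = antipode D Y * antipode D X :=
  unop_antipodeHom_mul D X Y

theorem antipode_one : antipode D 1 = 1 := by
  change unop (antipodeHom D 1) = 1
  rw [map_one, MulOpposite.unop_one]

theorem antipode_gen (g : IIBGen A Ω 𝔛) : antipode D (gen D g) = gen D (swapGen g) :=
  unop_antipodeHom_gen D g

theorem antipode_src (a : A) : antipode D (src D a) = tgt D a := antipode_gen D _

theorem antipode_tgt (a : A) : antipode D (tgt D a) = src D a := antipode_gen D _

theorem antipode_vf (x : 𝔛) (ω : Ω) : antipode D (vf D x ω) = fv D ω x := antipode_gen D _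

theorem antipode_fv (ω : Ω) (x : 𝔛) : antipode D (fv D ω x) = vf D x ω := antipode_gen D _

theorem comulEnd_mul_lcls (X Y : IIB D) (u : IIB D ⊗[ℂ] IIB D) :
    comulEnd D (X * Y) (lcls D u) = comulEnd D X (comulEnd D Y (lcls D u)) := by
  rw [map_mul, Module.End.mul_apply]

/-- Turns the two twist maps of the antipode axioms into the action of `IIB D` on `LT D`, where
products of antipodes become compositions. -/
theorem rmul_comul (X : IIB D) (u : IIB D ⊗[ℂ] IIB D) :
    LTensor.rmul (srcHom D) (tgtHom D) u (comul D X) = comulEnd D X (lcls D u) := by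
  rw [comul_apply, ← comulEnd_rmul, LTensor.rmul_cls, one_mul]

theorem twistOne_tmul (X Y : IIB D) :
    LTensor.twistOne (srcHom D) (tgtHom D) (comul D) (antipode D).symm.toLinearMap (X ⊗ₜ Y) =
      comulEnd D (antipode D Y) (lcls D (1 ⊗ₜ X)) := rmul_comul D _ _

theorem twistTwo_tmul (X Y : IIB D) :
    LTensor.twistTwo (srcHom D) (tgtHom D) (comul D) (antipode D).toLinearMap (X ⊗ₜ Y) =
      comulEnd D (antipode D X) (lcls D (Y ⊗ₜ 1)) := rmul_comul D _ _

theorem comulEnd_src (a : A) (u : IIB D ⊗[ℂ] IIB D) :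
    comulEnd D (src D a) (lcls D u) = lcls D ((src D a ⊗ₜ 1) * u) := comulEnd_gen D _ u

theorem comulEnd_tgt (a : A) (u : IIB D ⊗[ℂ] IIB D) :
    comulEnd D (tgt D a) (lcls D u) = lcls D ((1 ⊗ₜ tgt D a) * u) := comulEnd_gen D _ u

theorem comulEnd_vf (x : 𝔛) (ω : Ω) (X Y : IIB D) :
    comulEnd D (vf D x ω) (lcls D (X ⊗ₜ Y)) =
      ∑ i, lcls D ((vf D x (D.w i) * X) ⊗ₜ (vf D (D.x i) ω * Y)) := by
  rw [← map_sum]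
  simpa only [gen_vf, comulGen_vf, Finset.sum_mul, Algebra.TensorProduct.tmul_mul_tmul] using
    comulEnd_gen D (.vf x ω) (X ⊗ₜ Y)

theorem comulEnd_fv (ω : Ω) (y : 𝔛) (X Y : IIB D) :
    comulEnd D (fv D ω y) (lcls D (X ⊗ₜ Y)) =
      ∑ j, lcls D ((fv D ω (D.y j) * X) ⊗ₜ (fv D (D.η j) y * Y)) := by
  rw [← map_sum]
  simpa only [gen_fv, comulGen_fv, Finset.sum_mul, Algebra.TensorProduct.tmul_mul_tmul] using
    comulEnd_gen D (.fv ω y) (X ⊗ₜ Y)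

/-- As `S` reverses products, a right factor `Y` of the second leg acts last. This reduces the
treatment of `comulGen D g * u` to `Y = 1`. -/
theorem twistOne_mul_tmul (u : IIB D ⊗[ℂ] IIB D) (X Y : IIB D) :
    LTensor.twistOne (srcHom D) (tgtHom D) (comul D) (antipode D).symm.toLinearMap (u * X ⊗ₜ Y) =
      comulEnd D (antipode D Y) (LTensor.twistOne (srcHom D) (tgtHom D) (comul D)
        (antipode D).symm.toLinearMap (u * X ⊗ₜ 1)) := by
  induction u using TensorProduct.induction_on with
  | zero => simp only [zero_mul, map_zero]
  | add u v hu hv => simp only [add_mul, map_add, hu, hv]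
  | tmul U V =>
    rw [Algebra.TensorProduct.tmul_mul_tmul, Algebra.TensorProduct.tmul_mul_tmul, twistOne_tmul,
      twistOne_tmul, antipode_mul, comulEnd_mul_lcls, mul_one]

/-- `S⁻¹(X₂)₁ ⊗ S⁻¹(X₂)₂ X₁ = S⁻¹(X) ⊗ 1` for a generator `X`, multiplied by `1 ⊗ Y`. -/
theorem twistOne_comulGen (g : IIBGen A Ω 𝔛) (Y : IIB D) :
    LTensor.twistOne (srcHom D) (tgtHom D) (comul D) (antipode D).symm.toLinearMap
      (comulGen D g * Y ⊗ₜ 1) = lcls D (antipode D (gen D g) ⊗ₜ Y) := by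
  cases g with
  | src a =>
    rw [comulGen_src, Algebra.TensorProduct.tmul_mul_tmul, twistOne_tmul, mul_one, antipode_one,
      map_one, gen_src, antipode_src, lcls_tgt_tmul]
    rfl
  | tgt a =>
    rw [comulGen_tgt, Algebra.TensorProduct.tmul_mul_tmul, twistOne_tmul, mul_one, one_mul,
      antipode_tgt, gen_tgt, antipode_tgt, comulEnd_src, Algebra.TensorProduct.tmul_mul_tmul,
      mul_one, one_mul]
  | vf x ω =>
    simp only [comulGen_vf, Finset.sum_mul, Algebra.TensorProduct.tmul_mul_tmul, map_sum,
      twistOne_tmul, mul_one, antipode_vf, gen_vf, comulEnd_fv]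
    rw [Finset.sum_comm]
    simp only [← mul_assoc, ← map_sum, ← TensorProduct.tmul_sum, ← Finset.sum_mul, sum_fv_mul_vf']
    rw [map_sum]
    simp only [← lcls_tgt_mul, tgt_mul_fv]
    rw [← map_sum, ← TensorProduct.sum_tmul, ← fv_sum_right, D.coevR_vec]
  | fv ω y =>
    simp only [comulGen_fv, Finset.sum_mul, Algebra.TensorProduct.tmul_mul_tmul, map_sum,
      twistOne_tmul, mul_one, antipode_fv, gen_fv, comulEnd_vf]
    rw [Finset.sum_comm]
    simp only [← mul_assoc, ← map_sum, ← TensorProduct.tmul_sum, ← Finset.sum_mul, sum_vf_mul_fv]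
    rw [map_sum]
    simp only [← lcls_tgt_mul, tgt_mul_vf]
    rw [← map_sum, ← TensorProduct.sum_tmul, ← vf_sum_right, D.coevL_form]

theorem twistTwo_mul_tmul (u : IIB D ⊗[ℂ] IIB D) (X Y : IIB D) :
    LTensor.twistTwo (srcHom D) (tgtHom D) (comul D) (antipode D).toLinearMap (u * X ⊗ₜ Y) =
      comulEnd D (antipode D X) (LTensor.twistTwo (srcHom D) (tgtHom D) (comul D)
        (antipode D).toLinearMap (u * 1 ⊗ₜ Y)) := by
  induction u using TensorProduct.induction_on with
  | zero => simp only [zero_mul, map_zero]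
  | add u v hu hv => simp only [add_mul, map_add, hu, hv]
  | tmul U V =>
    rw [Algebra.TensorProduct.tmul_mul_tmul, Algebra.TensorProduct.tmul_mul_tmul, twistTwo_tmul,
      twistTwo_tmul, antipode_mul, comulEnd_mul_lcls, mul_one]

/-- `S(X₁)₁ X₂ ⊗ S(X₁)₂ = 1 ⊗ S(X)` for a generator `X`, multiplied by `Y ⊗ 1`. -/
theorem twistTwo_comulGen (g : IIBGen A Ω 𝔛) (Y : IIB D) :
    LTensor.twistTwo (srcHom D) (tgtHom D) (comul D) (antipode D).toLinearMap
      (comulGen D g * 1 ⊗ₜ Y) = lcls D (Y ⊗ₜ antipode D (gen D g)) := by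
  cases g with
  | src a =>
    rw [comulGen_src, Algebra.TensorProduct.tmul_mul_tmul, twistTwo_tmul, mul_one, one_mul,
      antipode_src, gen_src, antipode_src, comulEnd_tgt, Algebra.TensorProduct.tmul_mul_tmul,
      mul_one, one_mul]
  | tgt a =>
    rw [comulGen_tgt, Algebra.TensorProduct.tmul_mul_tmul, twistTwo_tmul, mul_one, antipode_one,
      map_one, gen_tgt, antipode_tgt, lcls_tmul_src]
    rfl
  | vf x ω =>
    simp only [comulGen_vf, Finset.sum_mul, Algebra.TensorProduct.tmul_mul_tmul, map_sum,
      twistTwo_tmul, mul_one, antipode_vf, gen_vf, comulEnd_fv]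
    rw [Finset.sum_comm]
    simp only [← mul_assoc, ← map_sum, ← TensorProduct.sum_tmul, ← Finset.sum_mul, sum_fv_mul_vf]
    rw [map_sum]
    simp only [lcls_tgt_mul, src_mul_fv]
    rw [← map_sum, ← TensorProduct.tmul_sum, ← fv_sum_left, D.coevR_form]
  | fv ω y =>
    simp only [comulGen_fv, Finset.sum_mul, Algebra.TensorProduct.tmul_mul_tmul, map_sum,
      twistTwo_tmul, mul_one, antipode_fv, gen_fv, comulEnd_vf]
    rw [Finset.sum_comm]
    simp only [← mul_assoc, ← map_sum, ← TensorProduct.sum_tmul, ← Finset.sum_mul, sum_vf_mul_fv']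
    rw [map_sum]
    simp only [lcls_tgt_mul, src_mul_vf]
    rw [← map_sum, ← TensorProduct.tmul_sum, ← vf_sum_left, D.coevL_vec]

theorem antipode_inv_identity {X : IIB D} {u : IIB D ⊗[ℂ] IIB D} (hu : lcls D u = comul D X) :
    LTensor.twistOne (srcHom D) (tgtHom D) (comul D) (antipode D).symm.toLinearMap u =
      lcls D (antipode D X ⊗ₜ 1) := by
  refine comul_induction (f := LTensor.twistOne (srcHom D) (tgtHom D) (comul D)
    (antipode D).symm.toLinearMap) (g := lcls D ∘ₗ (TensorProduct.mk ℂ _ _).flip 1 ∘ₗ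
    (antipode D).toLinearMap) (fun a X Y => ?_) ?_ (fun γ X u hX h => ?_) hu
  · rw [twistOne_tmul, twistOne_tmul, antipode_mul, antipode_src, comulEnd_mul_lcls,
      comulEnd_tgt, Algebra.TensorProduct.tmul_mul_tmul, one_mul]
  · rw [Algebra.TensorProduct.one_def, twistOne_tmul, antipode_one, map_one]
    change _ = lcls D (antipode D 1 ⊗ₜ 1)
    rw [antipode_one]; rfl
  -- The identity for the generator produces `S γ ⊗ 1`, on which the antipode of the second leg
  -- acts. Since the action commutes with right multiplication, `S γ` ends up on the right, as in `S
  -- (γ X) = S X * S γ`.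
  · have key : ∀ u, LTensor.twistOne (srcHom D) (tgtHom D) (comul D)
        (antipode D).symm.toLinearMap (comulGen D γ * u) =
        LTensor.rmul _ _ (antipode D (gen D γ) ⊗ₜ 1) (LTensor.twistOne (srcHom D) (tgtHom D)
          (comul D) (antipode D).symm.toLinearMap u) := by
      intro u
      induction u using TensorProduct.induction_on with
      | zero => simp only [mul_zero, map_zero]
      | add u v hu hv => simp only [mul_add, map_add, hu, hv]
      | tmul X Y =>
        rw [twistOne_mul_tmul, twistOne_comulGen, twistOne_tmul, ← comulEnd_rmul, LTensor.rmul_cls,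
          Algebra.TensorProduct.tmul_mul_tmul, one_mul, mul_one]
    rw [key, h]
    change LTensor.rmul _ _ _ (lcls D (antipode D X ⊗ₜ 1)) =
      lcls D (antipode D (gen D γ * X) ⊗ₜ 1)
    rw [LTensor.rmul_cls, antipode_mul, Algebra.TensorProduct.tmul_mul_tmul, mul_one]

theorem antipode_identity {X : IIB D} {u : IIB D ⊗[ℂ] IIB D} (hu : lcls D u = comul D X) :
    LTensor.twistTwo (srcHom D) (tgtHom D) (comul D) (antipode D).toLinearMap u =
      lcls D (1 ⊗ₜ antipode D X) := by
  refine comul_induction (f := LTensor.twistTwo (srcHom D) (tgtHom D) (comul D)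
    (antipode D).toLinearMap) (g := lcls D ∘ₗ TensorProduct.mk ℂ _ _ 1 ∘ₗ
    (antipode D).toLinearMap) (fun a X Y => ?_) ?_ (fun γ X u hX h => ?_) hu
  · rw [twistTwo_tmul, twistTwo_tmul, antipode_mul, antipode_tgt, comulEnd_mul_lcls,
      comulEnd_src, Algebra.TensorProduct.tmul_mul_tmul, one_mul]
  · rw [Algebra.TensorProduct.one_def, twistTwo_tmul, antipode_one, map_one]
    change _ = lcls D (1 ⊗ₜ antipode D 1)
    rw [antipode_one]; rfl
  · have key : ∀ u, LTensor.twistTwo (srcHom D) (tgtHom D) (comul D)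
        (antipode D).toLinearMap (comulGen D γ * u) =
        LTensor.rmul _ _ (1 ⊗ₜ antipode D (gen D γ)) (LTensor.twistTwo (srcHom D) (tgtHom D)
          (comul D) (antipode D).toLinearMap u) := by
      intro u
      induction u using TensorProduct.induction_on with
      | zero => simp only [mul_zero, map_zero]
      | add u v hu hv => simp only [mul_add, map_add, hu, hv]
      | tmul X Y =>
        rw [twistTwo_mul_tmul, twistTwo_comulGen, twistTwo_tmul, ← comulEnd_rmul, LTensor.rmul_cls,
          Algebra.TensorProduct.tmul_mul_tmul, one_mul, mul_one]
    rw [key, h]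
    change LTensor.rmul _ _ _ (lcls D (1 ⊗ₜ antipode D X)) =
      lcls D (1 ⊗ₜ antipode D (gen D γ * X))
    rw [LTensor.rmul_cls, antipode_mul, Algebra.TensorProduct.tmul_mul_tmul, mul_one]

end Antipode

end IIB

namespace IIB

/-! ### The right coproduct, transported along the antipode -/

section RightCoproduct

variable {A Ω 𝔛 : Type*} [Ring A] [Algebra ℂ A]
  [AddCommGroup Ω] [Module ℂ Ω] [Module A Ω] [Module Aᵐᵒᵖ Ω]
  [AddCommGroup 𝔛] [Module ℂ 𝔛] [Module A 𝔛] [Module Aᵐᵒᵖ 𝔛]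
  (D : PivotalDual A Ω 𝔛)

/-- The inclusion of `A` as the target map of the right bialgebroid. -/
def srcOpOp : Aᵐᵒᵖᵐᵒᵖ →ₐ[ℂ] IIB D := (srcHom D).comp (AlgEquiv.opOp ℂ A).symm.toAlgHom

/-- The tensor product `IIB(Ω) ⊗_{Aᵒᵖ} IIB(Ω)` of the right bialgebroid. -/
abbrev RT : Type _ := RTensor (tgtHom D) (srcOpOp D)

/-- The class in `RT` of an element of `IIB(Ω) ⊗ IIB(Ω)`. -/
abbrev rcls : IIB D ⊗[ℂ] IIB D →ₗ[ℂ] RT D := RTensor.cls (tgtHom D) (srcOpOp D)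

theorem rcls_mul_tgt (a : A) (X Y : IIB D) :
    rcls D ((X * tgt D a) ⊗ₜ Y) = rcls D (X ⊗ₜ (Y * src D a)) :=
  (Submodule.Quotient.eq _).2 (Submodule.subset_span ⟨op a, X, Y, rfl⟩)

theorem rcls_mul_tgt_tmul (a : A) (u : IIB D ⊗[ℂ] IIB D) :
    rcls D (u * tgt D a ⊗ₜ 1) = rcls D (u * 1 ⊗ₜ src D a) := by
  induction u using TensorProduct.induction_on with
  | zero => simp only [zero_mul]
  | add u v hu hv => rw [add_mul, add_mul, map_add, map_add, hu, hv]
  | tmul X Y =>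
    rw [Algebra.TensorProduct.tmul_mul_tmul, Algebra.TensorProduct.tmul_mul_tmul, mul_one,
      mul_one, rcls_mul_tgt]

/-- The map `X ⊗ Y ↦ S Y ⊗ S X`. -/
def flipAntipode : IIB D ⊗[ℂ] IIB D →ₗ[ℂ] IIB D ⊗[ℂ] IIB D :=
  TensorProduct.map (antipode D).toLinearMap (antipode D).toLinearMap ∘ₗ
    (TensorProduct.comm ℂ _ _).toLinearMap

theorem flipAntipode_tmul (X Y : IIB D) :
    flipAntipode D (X ⊗ₜ Y) = antipode D Y ⊗ₜ antipode D X := rfl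

theorem flipAntipode_flipAntipode (u : IIB D ⊗[ℂ] IIB D) :
    flipAntipode D (flipAntipode D u) = u := by
  induction u using TensorProduct.induction_on with
  | zero => simp only [map_zero]
  | add u v hu hv => rw [map_add, map_add, hu, hv]
  | tmul X Y => rw [flipAntipode_tmul, flipAntipode_tmul, antipode_antipode, antipode_antipode]

theorem flipAntipode_mul (u v : IIB D ⊗[ℂ] IIB D) :
    flipAntipode D (u * v) = flipAntipode D v * flipAntipode D u := by
  induction u using TensorProduct.induction_on with
  | zero => simp only [zero_mul, map_zero, mul_zero]
  | add u v hu hv => rw [add_mul, map_add, hu, hv, map_add, mul_add]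
  | tmul X Y =>
    induction v using TensorProduct.induction_on with
    | zero => simp only [zero_mul, map_zero, mul_zero]
    | add u v hu hv => rw [mul_add, map_add, hu, hv, map_add, add_mul]
    | tmul U V =>
      simp only [Algebra.TensorProduct.tmul_mul_tmul, flipAntipode_tmul, antipode_mul]

theorem rcls_flipAntipode_congr {u v : IIB D ⊗[ℂ] IIB D} (h : lcls D u = lcls D v) :
    rcls D (flipAntipode D u) = rcls D (flipAntipode D v) :=
  lcls_congr (f := rcls D ∘ₗ flipAntipode D) (fun a X Y => by
    change rcls D (flipAntipode D ((tgt D a * X) ⊗ₜ Y)) =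
      rcls D (flipAntipode D (X ⊗ₜ (src D a * Y)))
    rw [flipAntipode_tmul, flipAntipode_tmul, antipode_mul, antipode_mul, antipode_tgt,
      antipode_src, rcls_mul_tgt]) h

theorem lcls_flipAntipode_congr {u v : IIB D ⊗[ℂ] IIB D} (h : rcls D u = rcls D v) :
    lcls D (flipAntipode D u) = lcls D (flipAntipode D v) :=
  balSub_mkQ_congr (f := lcls D ∘ₗ flipAntipode D) (fun a X Y => by
    change lcls D (flipAntipode D ((X * tgt D (unop a)) ⊗ₜ Y)) =
      lcls D (flipAntipode D (X ⊗ₜ (Y * src D (unop a))))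
    rw [flipAntipode_tmul, flipAntipode_tmul, antipode_mul, antipode_mul, antipode_tgt,
      antipode_src, lcls_tgt_mul]) h

/-- The map `LT → RT` induced by `X ⊗ Y ↦ S Y ⊗ S X`. -/
def flipQuot : LT D →ₗ[ℂ] RT D := Submodule.mapQ _ _ (flipAntipode D) fun u hu => by
  rw [← Submodule.Quotient.mk_eq_zero] at hu
  rw [Submodule.mem_comap, ← Submodule.Quotient.mk_eq_zero]
  simpa using rcls_flipAntipode_congr D (u := u) (v := 0) (by simpa using hu)

theorem flipQuot_lcls (u : IIB D ⊗[ℂ] IIB D) :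
    flipQuot D (lcls D u) = rcls D (flipAntipode D u) := rfl

/-- The coproduct of the right bialgebroid. -/
def comulR : IIB D →ₗ[ℂ] RT D := flipQuot D ∘ₗ comul D ∘ₗ (antipode D).toLinearMap

theorem comulR_apply (X : IIB D) : comulR D X = flipQuot D (comul D (antipode D X)) := rfl

/-- `flipAntipode` is an involution that respects the balancings in both directions. This is the
dictionary by which right-handed statements about representatives become left-handed ones for
`antipode D X`. -/
theorem rcls_eq_comulR_iff {X : IIB D} {u : IIB D ⊗[ℂ] IIB D} :
    rcls D u = comulR D X ↔ lcls D (flipAntipode D u) = comul D (antipode D X) := by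
  constructor
  · intro h
    obtain ⟨v, hv⟩ := lcls_surjective D (comul D (antipode D X))
    rw [comulR_apply, ← hv, flipQuot_lcls] at h
    rw [lcls_flipAntipode_congr D h, flipAntipode_flipAntipode, hv]
  · intro h
    rw [comulR_apply, ← h, flipQuot_lcls, flipAntipode_flipAntipode]

theorem comulR_mul {X Y : IIB D} {u v : IIB D ⊗[ℂ] IIB D} (hu : rcls D u = comulR D X)
    (hv : rcls D v = comulR D Y) : comulR D (X * Y) = rcls D (u * v) := by
  rw [rcls_eq_comulR_iff] at hu hv
  exact ((rcls_eq_comulR_iff D).2 (by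
    rw [flipAntipode_mul, antipode_mul, comul_mul D hv hu])).symm

theorem comulR_one : comulR D 1 = rcls D 1 := by
  refine ((rcls_eq_comulR_iff D).2 ?_).symm
  rw [antipode_one, comul_one, Algebra.TensorProduct.one_def, flipAntipode_tmul, antipode_one]

/-- The coproduct of a generator in the right bialgebroid. -/
def comulGenR : IIBGen A Ω 𝔛 → IIB D ⊗[ℂ] IIB D
  | .src a => src D a ⊗ₜ 1
  | .tgt a => 1 ⊗ₜ tgt D a
  | .vf x ω => ∑ j, vf D x (D.η j) ⊗ₜ vf D (D.y j) ω
  | .fv ω y => ∑ i, fv D ω (D.x i) ⊗ₜ fv D (D.w i) y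

theorem comulGenR_src (a : A) : comulGenR D (.src a) = src D a ⊗ₜ 1 := rfl

theorem comulGenR_tgt (a : A) : comulGenR D (.tgt a) = 1 ⊗ₜ tgt D a := rfl

theorem comulGenR_vf (x : 𝔛) (ω : Ω) :
    comulGenR D (.vf x ω) = ∑ j, vf D x (D.η j) ⊗ₜ vf D (D.y j) ω := rfl

theorem comulGenR_fv (ω : Ω) (y : 𝔛) :
    comulGenR D (.fv ω y) = ∑ i, fv D ω (D.x i) ⊗ₜ fv D (D.w i) y := rfl

theorem flipAntipode_comulGen (g : IIBGen A Ω 𝔛) :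
    flipAntipode D (comulGen D (swapGen g)) = comulGenR D g := by
  cases g <;> simp only [swapGen, comulGen_src, comulGen_tgt, comulGen_vf, comulGen_fv, map_sum,
    flipAntipode_tmul, antipode_src, antipode_tgt, antipode_vf, antipode_fv, antipode_one,
    comulGenR_src, comulGenR_tgt, comulGenR_vf, comulGenR_fv]

theorem comulR_gen (g : IIBGen A Ω 𝔛) : comulR D (gen D g) = rcls D (comulGenR D g) := by
  rw [comulR_apply, antipode_gen, comul_gen, flipQuot_lcls, flipAntipode_comulGen]

/-- The coproduct of the right bialgebroid, with its values on generators. -/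
def rightGenCoproduct : GenCoproduct D (rightActR (tgtHom D)) (rightActL (srcOpOp D)) where
  Δ := comulR D
  onGen := comulGenR D
  one := comulR_one D
  gen_mul g _ _ hu := comulR_mul D (comulR_gen D g).symm hu
  -- The right balancing consists of right multiplications, so left multiplication by any tensor
  -- respects it; centrality of coevaluations is not needed here.
  balanced g a X Y := by
    have h := rcls_mul_tgt_tmul D (unop a) (comulGenR D g * X ⊗ₜ Y)
    rw [mul_assoc, mul_assoc, Algebra.TensorProduct.tmul_mul_tmul,
      Algebra.TensorProduct.tmul_mul_tmul, mul_one, mul_one] at h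
    exact h

theorem comul_mul_gen (g : IIBGen A Ω 𝔛) {X : IIB D} {u : IIB D ⊗[ℂ] IIB D}
    (hu : lcls D u = comul D X) : comul D (X * gen D g) = lcls D (u * comulGen D g) :=
  comul_mul D hu (comul_gen D g).symm

theorem comulR_gen_mul (g : IIBGen A Ω 𝔛) {X : IIB D} {u : IIB D ⊗[ℂ] IIB D}
    (hu : rcls D u = comulR D X) : comulR D (gen D g * X) = rcls D (comulGenR D g * u) :=
  comulR_mul D (comulR_gen D g).symm hu

theorem comulR_mul_gen (g : IIBGen A Ω 𝔛) {X : IIB D} {u : IIB D ⊗[ℂ] IIB D}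
    (hu : rcls D u = comulR D X) : comulR D (X * gen D g) = rcls D (u * comulGenR D g) :=
  comulR_mul D hu (comulR_gen D g).symm

theorem comulR_takeuchi (a : A) {X : IIB D} {u : IIB D ⊗[ℂ] IIB D}
    (hu : rcls D u = comulR D X) :
    rcls D ((tgt D a ⊗ₜ 1) * u) = rcls D ((1 ⊗ₜ src D a) * u) := by
  rw [rcls_eq_comulR_iff] at hu
  have h := rcls_flipAntipode_congr D (comul_takeuchi D a hu)
  rw [flipAntipode_mul, flipAntipode_mul, flipAntipode_flipAntipode, flipAntipode_tmul,
    flipAntipode_tmul, antipode_one, antipode_src, antipode_tgt] at h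
  exact h.symm

theorem comulR_coassoc {X : IIB D} {u v : IIB D ⊗[ℂ] IIB D} (hu : rcls D u = comulR D X)
    (hv : rcls D v = comulR D X) :
    balAssocR (rightActR (tgtHom D)) (rightActL (srcOpOp D)) (rightActR (tgtHom D))
        (rightActL (srcOpOp D)) ((comulR D).lTensor _ u) =
      balAssocL (rightActR (tgtHom D)) (rightActL (srcOpOp D)) (rightActR (tgtHom D))
        (rightActL (srcOpOp D)) ((comulR D).rTensor _ v) := by
  refine mixed_coassoc (rightGenCoproduct D) (rightGenCoproduct D) (fun a X u hu => ?_)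
    (fun a X u hu => ?_) (fun g => ?_) hu hv
  · rw [rightActL, map_mulRight_id]
    exact comulR_mul_gen D (.src (unop a)) hu
  · rw [rightActR, map_id_mulRight]
    exact comulR_mul_gen D (.tgt (unop a)) hu
  · cases g with
    | src a =>
      refine ⟨1, 1, fun _ => .src a, fun _ => .src 1, fun _ => .src a, fun _ => .src 1, ?_⟩
      simp [rightGenCoproduct, comulGenR_src, gen_src, src_one]
    | tgt a =>
      refine ⟨1, 1, fun _ => .tgt 1, fun _ => .tgt a, fun _ => .tgt 1, fun _ => .tgt a, ?_⟩
      simp [rightGenCoproduct, comulGenR_tgt, gen_tgt, tgt_one]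
    | vf x ω =>
      refine ⟨_, _, fun j => .vf x (D.η j), fun j => .vf (D.y j) ω,
        fun j => .vf x (D.η j), fun j => .vf (D.y j) ω, rfl, rfl, ?_⟩
      simp only [rightGenCoproduct, comulGenR_vf, gen_vf, TensorProduct.tmul_sum,
        TensorProduct.sum_tmul, map_sum, TensorProduct.assoc_tmul]
      exact Finset.sum_comm
    | fv ω y =>
      refine ⟨_, _, fun i => .fv ω (D.x i), fun i => .fv (D.w i) y,
        fun i => .fv ω (D.x i), fun i => .fv (D.w i) y, rfl, rfl, ?_⟩
      simp only [rightGenCoproduct, comulGenR_fv, gen_fv, TensorProduct.tmul_sum,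
        TensorProduct.sum_tmul, map_sum, TensorProduct.assoc_tmul]
      exact Finset.sum_comm

/-- On `(x, ω)` and `(ω, y)` the left and right coproducts insert different coevaluations, and two
insertions at different places commute. On `src` and `tgt` both coproducts agree, which gives the
linearity conditions. -/
theorem comul_comulR_coassoc {X : IIB D} {u v : IIB D ⊗[ℂ] IIB D} (hu : lcls D u = comul D X)
    (hv : rcls D v = comulR D X) :
    balAssocR (leftActR (tgtHom D)) (leftActL (srcHom D)) (rightActR (tgtHom D))
        (rightActL (srcOpOp D)) ((comulR D).lTensor _ u) =
      balAssocL (leftActR (tgtHom D)) (leftActL (srcHom D)) (rightActR (tgtHom D))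
        (rightActL (srcOpOp D)) ((comul D).rTensor _ v) := by
  refine mixed_coassoc (leftGenCoproduct D) (rightGenCoproduct D) (fun a X u hu => ?_)
    (fun a X u hu => ?_) (fun g => ?_) hu hv
  · rw [leftActL, map_mulLeft_id]
    exact comulR_gen_mul D (.src a) hu
  · rw [rightActR, map_id_mulRight]
    exact comul_mul_gen D (.tgt (unop a)) hu
  · cases g with
    | src a =>
      refine ⟨1, 1, fun _ => .src a, fun _ => .src 1, fun _ => .src a, fun _ => .src 1, ?_⟩
      simp [leftGenCoproduct, rightGenCoproduct, comulGen_src, comulGenR_src, gen_src, src_one]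
    | tgt a =>
      refine ⟨1, 1, fun _ => .tgt 1, fun _ => .tgt a, fun _ => .tgt 1, fun _ => .tgt a, ?_⟩
      simp [leftGenCoproduct, rightGenCoproduct, comulGen_tgt, comulGenR_tgt, gen_tgt, tgt_one]
    | vf x ω =>
      refine ⟨_, _, fun i => .vf x (D.w i), fun i => .vf (D.x i) ω,
        fun j => .vf x (D.η j), fun j => .vf (D.y j) ω, rfl, rfl, ?_⟩
      simp only [leftGenCoproduct, rightGenCoproduct, comulGen_vf, comulGenR_vf, gen_vf,
        TensorProduct.tmul_sum, TensorProduct.sum_tmul, map_sum, TensorProduct.assoc_tmul]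
      exact Finset.sum_comm
    | fv ω y =>
      refine ⟨_, _, fun j => .fv ω (D.y j), fun j => .fv (D.η j) y,
        fun i => .fv ω (D.x i), fun i => .fv (D.w i) y, rfl, rfl, ?_⟩
      simp only [leftGenCoproduct, rightGenCoproduct, comulGen_fv, comulGenR_fv, gen_fv,
        TensorProduct.tmul_sum, TensorProduct.sum_tmul, map_sum, TensorProduct.assoc_tmul]
      exact Finset.sum_comm

theorem comulR_comul_coassoc {X : IIB D} {u v : IIB D ⊗[ℂ] IIB D} (hu : rcls D u = comulR D X)
    (hv : lcls D v = comul D X) :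
    balAssocR (rightActR (tgtHom D)) (rightActL (srcOpOp D)) (leftActR (tgtHom D))
        (leftActL (srcHom D)) ((comul D).lTensor _ u) =
      balAssocL (rightActR (tgtHom D)) (rightActL (srcOpOp D)) (leftActR (tgtHom D))
        (leftActL (srcHom D)) ((comulR D).rTensor _ v) := by
  refine mixed_coassoc (rightGenCoproduct D) (leftGenCoproduct D) (fun a X u hu => ?_)
    (fun a X u hu => ?_) (fun g => ?_) hu hv
  · rw [rightActL, map_mulRight_id]
    exact comul_mul_gen D (.src (unop a)) hu
  · rw [leftActR, map_id_mulLeft]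
    exact comulR_gen_mul D (.tgt a) hu
  · cases g with
    | src a =>
      refine ⟨1, 1, fun _ => .src a, fun _ => .src 1, fun _ => .src a, fun _ => .src 1, ?_⟩
      simp [leftGenCoproduct, rightGenCoproduct, comulGen_src, comulGenR_src, gen_src, src_one]
    | tgt a =>
      refine ⟨1, 1, fun _ => .tgt 1, fun _ => .tgt a, fun _ => .tgt 1, fun _ => .tgt a, ?_⟩
      simp [leftGenCoproduct, rightGenCoproduct, comulGen_tgt, comulGenR_tgt, gen_tgt, tgt_one]
    | vf x ω =>
      refine ⟨_, _, fun j => .vf x (D.η j), fun j => .vf (D.y j) ω,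
        fun i => .vf x (D.w i), fun i => .vf (D.x i) ω, rfl, rfl, ?_⟩
      simp only [leftGenCoproduct, rightGenCoproduct, comulGen_vf, comulGenR_vf, gen_vf,
        TensorProduct.tmul_sum, TensorProduct.sum_tmul, map_sum, TensorProduct.assoc_tmul]
      exact Finset.sum_comm
    | fv ω y =>
      refine ⟨_, _, fun i => .fv ω (D.x i), fun i => .fv (D.w i) y,
        fun j => .fv ω (D.y j), fun j => .fv (D.η j) y, rfl, rfl, ?_⟩
      simp only [leftGenCoproduct, rightGenCoproduct, comulGen_fv, comulGenR_fv, gen_fv,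
        TensorProduct.tmul_sum, TensorProduct.sum_tmul, map_sum, TensorProduct.assoc_tmul]
      exact Finset.sum_comm

end RightCoproduct

/-! ### The right bialgebroid and the full Hopf algebroid -/

section FullHopf

variable {A Ω 𝔛 : Type*} [Ring A] [Algebra ℂ A]
  [AddCommGroup Ω] [Module ℂ Ω] [Module A Ω] [Module Aᵐᵒᵖ Ω] [SMulCommClass A Aᵐᵒᵖ Ω]
  [IsScalarTower ℂ A Ω]
  [AddCommGroup 𝔛] [Module ℂ 𝔛] [Module A 𝔛] [Module Aᵐᵒᵖ 𝔛] [SMulCommClass A Aᵐᵒᵖ 𝔛]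
  [IsScalarTower ℂ A 𝔛]
  (D : PivotalDual A Ω 𝔛)

/-- The counit of the right bialgebroid. -/
def counitR : IIB D →ₗ[ℂ] Aᵐᵒᵖ :=
  (MulOpposite.opLinearEquiv ℂ).toLinearMap ∘ₗ counit D ∘ₗ (antipode D).toLinearMap

theorem counitR_apply (X : IIB D) : counitR D X = op (counit D (antipode D X)) := rfl

/-- This is the antipode applied to the right counit law of `antipode D X`; the flip of tensor legs
interchanges left and right counit laws. -/
theorem comulR_counit_left {X : IIB D} {u : IIB D ⊗[ℂ] IIB D} (hu : rcls D u = comulR D X) :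
    LinearMap.mul' ℂ (IIB D) (TensorProduct.comm ℂ _ _ (TensorProduct.map
      ((srcOpOp D).toLinearMap ∘ₗ (MulOpposite.opLinearEquiv ℂ).toLinearMap ∘ₗ counitR D)
      LinearMap.id u)) = X := by
  rw [rcls_eq_comulR_iff] at hu
  have h := congrArg (antipode D) (comul_counit_right D hu)
  rw [antipode_antipode] at h
  refine Eq.trans ?_ h
  clear h hu
  induction u using TensorProduct.induction_on with
  | zero => simp only [map_zero]
  | add u v hu hv => simp only [map_add, hu, hv]
  | tmul U V =>
    change V * src D (counit D (antipode D U)) =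
      antipode D (tgt D (counit D (antipode D U)) * antipode D V)
    rw [antipode_mul, antipode_tgt, antipode_antipode]

theorem comulR_counit_right {X : IIB D} {u : IIB D ⊗[ℂ] IIB D} (hu : rcls D u = comulR D X) :
    LinearMap.mul' ℂ (IIB D) (TensorProduct.map LinearMap.id
      ((tgtHom D).toLinearMap ∘ₗ counitR D) u) = X := by
  rw [rcls_eq_comulR_iff] at hu
  have h := congrArg (antipode D) (comul_counit_left D hu)
  rw [antipode_antipode] at h
  refine Eq.trans ?_ h
  clear h hu
  induction u using TensorProduct.induction_on with
  | zero => simp only [map_zero]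
  | add u v hu hv => simp only [map_add, hu, hv]
  | tmul U V =>
    change U * tgt D (counit D (antipode D V)) =
      antipode D (src D (counit D (antipode D V)) * antipode D U)
    rw [antipode_mul, antipode_src, antipode_antipode]

/-- The right bialgebroid structure of `IIB(Ω)`. -/
def rightBialgebroid : RightBialgebroid Aᵐᵒᵖ (IIB D) where
  s := tgtHom D
  t := srcOpOp D
  comm a b := (src_mul_tgt D (unop b) (unop a)).symm
  Δ := comulR D
  ε := counitR D
  Δ_bimod a b X u hu := by
    have h := comulR_mul_gen D (.tgt (unop b)) (comulR_mul_gen D (.src (unop a)) hu).symm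
    rw [comulGenR_tgt, comulGenR_src, mul_assoc u, Algebra.TensorProduct.tmul_mul_tmul, mul_one,
      one_mul] at h
    exact h
  ε_bimod a b X := by
    change op (counit D (antipode D (X * src D (unop a) * tgt D (unop b)))) =
      a * op (counit D (antipode D X)) * b
    rw [antipode_mul, antipode_mul, antipode_tgt, antipode_src, counit_src_mul, counit_tgt_mul,
      MulOpposite.op_mul, MulOpposite.op_mul, MulOpposite.op_unop, MulOpposite.op_unop]
  coassoc X u v hu hv := comulR_coassoc D hu hv
  counit_left X u hu := comulR_counit_left D hu
  counit_right X u hu := comulR_counit_right D hu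
  takeuchi a X u hu := comulR_takeuchi D (unop a) hu
  Δ_one := comulR_one D
  Δ_mul X Y u v hu hv := comulR_mul D hu hv
  ε_one := by rw [counitR_apply, antipode_one, counit_one, MulOpposite.op_one]
  ε_mul_s X Y := by
    change op (counit D (antipode D (X * Y))) =
      op (counit D (antipode D (tgt D (counit D (antipode D X)) * Y)))
    rw [antipode_mul, antipode_mul, antipode_tgt, counit_mul, counit_mul, counit_src]
  ε_mul_t X Y := by
    change op (counit D (antipode D (X * Y))) =
      op (counit D (antipode D (src D (counit D (antipode D X)) * Y)))
    rw [antipode_mul, antipode_mul, antipode_src, counit_mul, counit_mul, counit_tgt]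

/-- The full Hopf algebroid structure of `IIB(Ω)`. -/
def fullHopfAlgebroid : FullHopfAlgebroid A (IIB D) where
  L := leftBialgebroid D
  S := antipode D
  S_one := antipode_one D
  S_mul := antipode_mul D
  S_t := antipode_tgt D
  antipode_inv X u hu := antipode_inv_identity D hu
  antipode X u hu := antipode_identity D hu
  R := rightBialgebroid D
  R_s _ := rfl
  R_t a := (antipode_tgt D a).symm
  R_ε _ := rfl
  R_Δ X u hu := by
    change comulR D X = rcls D (flipAntipode D u)
    rw [comulR_apply, ← flipQuot_lcls]
    exact congrArg (flipQuot D) hu.symm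
  range_s := by
    ext X
    exact ⟨fun ⟨a, ha⟩ => ⟨op (op a), ha⟩, fun ⟨a, ha⟩ => ⟨unop (unop a), ha⟩⟩
  range_t := rfl
  mixed_coassoc_LR X u v hu hv := comul_comulR_coassoc D hu hv
  mixed_coassoc_RL X u v hu hv := comulR_comul_coassoc D hu hv

end FullHopf

end IIB

/-! ### Antilinear maps, the map on the dual and the involution -/

section Conjugate

/-- The complex conjugate of an algebra: the same ring, with conjugate scalar multiplication. -/
def ConjugateAlgebra (H : Type*) : Type _ := H

namespace ConjugateAlgebra

variable (H : Type*) [Ring H] [Algebra ℂ H]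

instance : Ring (ConjugateAlgebra H) := inferInstanceAs (Ring H)

instance : Algebra ℂ (ConjugateAlgebra H) := Algebra.compHom H (starRingEnd ℂ)

/-- The identity map from an algebra to its complex conjugate. -/
def equiv : H ≃+* ConjugateAlgebra H := RingEquiv.refl H

theorem equiv_symm_smul (r : ℂ) (X : ConjugateAlgebra H) :
    (equiv H).symm (r • X) = starRingEnd ℂ r • (equiv H).symm X := rfl

end ConjugateAlgebra

end Conjugate

section Star

variable {A Ω 𝔛 : Type*} [Ring A] [Algebra ℂ A] [StarRing A] [StarModule ℂ A]
  [AddCommGroup Ω] [Module ℂ Ω] [Module A Ω] [Module Aᵐᵒᵖ Ω]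
  [IsScalarTower ℂ A Ω] [IsScalarTower ℂ Aᵐᵒᵖ Ω]
  [AddCommGroup 𝔛] [Module ℂ 𝔛] [Module A 𝔛] [Module Aᵐᵒᵖ 𝔛]
  [StarBimodule A Ω]

/-- Antilinearity over `ℂ` is not part of a `StarBimodule`. It follows because complex scalars act
through `A` on the left and through `Aᵐᵒᵖ` on the right. -/
theorem StarBimodule.star_complex_smul (r : ℂ) (ω : Ω) :
    star (r • ω) = starRingEnd ℂ r • star ω := by
  rw [← algebraMap_smul A r ω, StarBimodule.star_smul_left, ← algebraMap_star_comm,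
    ← MulOpposite.algebraMap_apply, algebraMap_smul]
  rfl

namespace PivotalDual

variable (D : PivotalDual A Ω 𝔛)

/-- The dual basis expansion recovers a vector from its pairings with forms, so additivity,
antilinearity and the bimodule rules for `⊛` can be read off from its defining equation. -/
theorem eq_of_evR {y y' : 𝔛} (h : ∀ ω, D.evR ω y = D.evR ω y') : y = y' := by
  rw [← D.coevR_vec y, ← D.coevR_vec y']
  simp only [h]

theorem circledast_add (y y' : 𝔛) :
    D.circledast (y + y') = D.circledast y + D.circledast y' :=
  D.eq_of_evR fun ω => by
    simp only [map_add, D.evR_circledast, LinearMap.add_apply, star_add]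

theorem circledast_sum {ι : Type*} (s : Finset ι) (y : ι → 𝔛) :
    D.circledast (∑ i ∈ s, y i) = ∑ i ∈ s, D.circledast (y i) :=
  map_sum (AddMonoidHom.mk' D.circledast D.circledast_add) y s

theorem circledast_complex_smul (r : ℂ) (y : 𝔛) :
    D.circledast (r • y) = starRingEnd ℂ r • D.circledast y :=
  D.eq_of_evR fun ω => by
    simp only [map_smul, D.evR_circledast, LinearMap.smul_apply, star_smul]
    rfl

theorem circledast_smul (a : A) (y : 𝔛) :
    D.circledast (a • y) = op (star a) • D.circledast y :=
  D.eq_of_evR fun ω => by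
    rw [D.evR_right, D.evR_circledast, D.evR_circledast, D.evL_left, star_mul]

theorem circledast_op_smul (a : A) (y : 𝔛) :
    D.circledast (op a • y) = star a • D.circledast y :=
  D.eq_of_evR fun ω => by
    rw [← D.evR_mid, D.evR_circledast, D.evR_circledast, D.evL_mid, PivotalDual.star_op_smul,
      star_star]

variable {M : Type*} [AddCommGroup M] [Module ℂ M]

/-- `coevL*` is `coevR`. -/
theorem sum_star_coevL (β : 𝔛 →ₗ[ℂ] Ω →ₗ[ℂ] M)
    (hβ : ∀ (a : A) (x : 𝔛) (ω : Ω), β (op a • x) ω = β x (a • ω)) :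
    ∑ i, β (D.circledast (D.x i)) (star (D.w i)) = ∑ j, β (D.y j) (D.η j) :=
  D.sum_coevR β hβ _ _ id fun ω => by
    simp only [D.evR_circledast, ← PivotalDual.star_op_smul, ← star_sum, D.coevL_form, star_star,
      id_eq]

variable {D}
theorem circledast_circledast (hcirc : D.circledast = D.circledast.symm) (y : 𝔛) :
    D.circledast (D.circledast y) = y :=
  (congrArg (fun e => e (D.circledast y)) hcirc).trans (D.circledast.symm_apply_apply y)

theorem evL_circledast (hcirc : D.circledast = D.circledast.symm) (y : 𝔛) (ω : Ω) :
    D.evL (D.circledast y) ω = star (D.evR (star ω) y) := by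
  rw [hcirc, D.evL_circledast_symm]

/-- `coevR*` is `coevL`. -/
theorem sum_star_coevR (hcirc : D.circledast = D.circledast.symm)
    (β : Ω →ₗ[ℂ] 𝔛 →ₗ[ℂ] M)
    (hβ : ∀ (a : A) (ω : Ω) (x : 𝔛), β (op a • ω) x = β ω (a • x)) :
    ∑ j, β (star (D.η j)) (D.circledast (D.y j)) = ∑ i, β (D.w i) (D.x i) :=
  D.sum_coevL β hβ _ _ id fun x => by
    have h : ∀ ω, D.evL x (star ω) = star (D.evR ω (D.circledast x)) := fun ω => by
      rw [D.evR_circledast, star_star]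
    simp only [h, ← D.circledast_op_smul, ← D.circledast_sum, D.coevR_vec,
      circledast_circledast hcirc, id_eq]

end PivotalDual

namespace IIB

section StarStructure

variable {D : PivotalDual A Ω 𝔛}

variable (D) in
/-- The involution on generators. -/
def starGen : IIBGen A Ω 𝔛 → IIBGen A Ω 𝔛
  | .src a => .src (star a)
  | .tgt a => .tgt (star a)
  | .vf x ω => .vf (D.circledast x) (star ω)
  | .fv ω y => .fv (star ω) (D.circledast y)

/-- The starred coevaluation is replaced by the opposite one, which turns the sum into another
defining relation. This and the next three lemmas show that the involution respects the coevaluation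
relations. -/
theorem sum_star_fv_mul_vf (ω : Ω) (y : 𝔛) :
    ∑ i, vf D (D.circledast (D.x i)) ω * fv D (star (D.w i)) y = tgt D (D.evL y ω) := by
  rw [← sum_vf_mul_fv']
  exact D.sum_star_coevL ((LinearMap.mul ℂ (IIB D)).compl₁₂ ((vfHom D).flip ω)
    ((fvHom D).flip y)) fun a x ω' => by
      change vf D (op a • x) ω * fv D ω' y = vf D x ω * fv D (a • ω') y
      rw [← vf_mul_src, ← src_mul_fv, mul_assoc]

theorem sum_star_fv_mul_vf' (x : 𝔛) (ω : Ω) :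
    ∑ i, vf D x (star (D.w i)) * fv D ω (D.circledast (D.x i)) = src D (D.evL x ω) := by
  rw [← sum_vf_mul_fv]
  exact D.sum_star_coevL ((LinearMap.mul ℂ (IIB D)).compl₁₂ (vfHom D x) (fvHom D ω)).flip
    fun a z ω' => by
      change vf D x ω' * fv D ω (op a • z) = vf D x (a • ω') * fv D ω z
      rw [← vf_mul_tgt, ← tgt_mul_fv, mul_assoc]

theorem sum_star_vf_mul_fv (hcirc : D.circledast = D.circledast.symm)
    (ω : Ω) (x : 𝔛) :
    ∑ j, fv D ω (D.circledast (D.y j)) * vf D x (star (D.η j)) = src D (D.evR ω x) := by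
  rw [← sum_fv_mul_vf']
  exact D.sum_star_coevR hcirc ((LinearMap.mul ℂ (IIB D)).compl₁₂ (fvHom D ω) (vfHom D x)).flip
    fun a ω' z => by
      change fv D ω z * vf D x (op a • ω') = fv D ω (a • z) * vf D x ω'
      rw [← fv_mul_tgt, ← tgt_mul_vf, mul_assoc]

theorem sum_star_vf_mul_fv' (hcirc : D.circledast = D.circledast.symm)
    (ω : Ω) (x : 𝔛) :
    ∑ j, fv D (star (D.η j)) x * vf D (D.circledast (D.y j)) ω = tgt D (D.evR ω x) := by
  rw [← sum_fv_mul_vf]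
  exact D.sum_star_coevR hcirc ((LinearMap.mul ℂ (IIB D)).compl₁₂ ((fvHom D).flip x)
    ((vfHom D).flip ω)) fun a ω' z => by
      change fv D (op a • ω') x * vf D z ω = fv D ω' x * vf D (a • z) ω
      rw [← fv_mul_src, ← src_mul_vf, mul_assoc]

/-- The involution as an algebra map to the opposite of the complex conjugate. -/
def starHom (hcirc : D.circledast = D.circledast.symm) :
    IIB D →ₐ[ℂ] (ConjugateAlgebra (IIB D))ᵐᵒᵖ :=
  lift (fun g => op (ConjugateAlgebra.equiv (IIB D) (gen D (starGen D g)))) (by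
    intro p q h
    apply MulOpposite.unop_injective
    apply (ConjugateAlgebra.equiv (IIB D)).symm.injective
    -- The involution sends `coevL_fv` to `coevR_tgt` and `coevR_vf` to `coevL_src`, and conversely.
    -- The evaluations on the right-hand sides match by the two formulas that relate `evL` and `evR`
    -- through `⊛`.
    cases h <;> simp only [IIBGen.mk, map_add, map_smul, map_mul, map_one, map_sum,
      FreeAlgebra.lift_ι_apply, starGen, gen_src, gen_tgt, gen_vf, gen_fv, MulOpposite.unop_add,
      MulOpposite.unop_mul, MulOpposite.unop_smul, MulOpposite.unop_one, MulOpposite.unop_op,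
      Finset.unop_sum, ConjugateAlgebra.equiv_symm_smul, RingEquiv.symm_apply_apply,
      star_add, star_mul, star_one, D.circledast_add, D.circledast_complex_smul,
      StarBimodule.star_complex_smul, D.circledast_smul, D.circledast_op_smul,
      StarBimodule.star_smul_left, PivotalDual.star_op_smul,
      src_add, src_one, src_mul, tgt_add, tgt_one, tgt_mul, src_mul_tgt,
      vf_add_left, vf_add_right, vf_smul_left, vf_smul_right,
      fv_add_left, fv_add_right, fv_smul_left, fv_smul_right, src_mul_vf, tgt_mul_vf, vf_mul_src,
      vf_mul_tgt, src_mul_fv, tgt_mul_fv, fv_mul_src, fv_mul_tgt, sum_star_fv_mul_vf,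
      sum_star_fv_mul_vf', sum_star_vf_mul_fv hcirc, sum_star_vf_mul_fv' hcirc,
      D.evR_circledast, PivotalDual.evL_circledast hcirc, star_star]
    case src_smul => rw [star_smul, src_smul, starRingEnd_apply]
    case tgt_smul => rw [star_smul, tgt_smul, starRingEnd_apply])

end StarStructure

end IIB

end Star

namespace IIB

/-! ### Compatibility of the involution with the Hopf algebroid -/

section StarHopf

variable {A Ω 𝔛 : Type*} [Ring A] [Algebra ℂ A] [StarRing A] [StarModule ℂ A]
  [AddCommGroup Ω] [Module ℂ Ω] [Module A Ω] [Module Aᵐᵒᵖ Ω] [SMulCommClass A Aᵐᵒᵖ Ω]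
  [IsScalarTower ℂ A Ω] [IsScalarTower ℂ Aᵐᵒᵖ Ω]
  [AddCommGroup 𝔛] [Module ℂ 𝔛] [Module A 𝔛] [Module Aᵐᵒᵖ 𝔛] [SMulCommClass A Aᵐᵒᵖ 𝔛]
  [IsScalarTower ℂ A 𝔛]
  [StarBimodule A Ω] {D : PivotalDual A Ω 𝔛} (hcirc : D.circledast = D.circledast.symm)

/-- The involution of `IIB(Ω)`. -/
def starMap : IIB D →ₛₗ[starRingEnd ℂ] IIB D where
  toFun X := (ConjugateAlgebra.equiv (IIB D)).symm (unop (starHom hcirc X))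
  map_add' X Y := by rw [map_add, MulOpposite.unop_add, map_add]
  map_smul' r X := by
    rw [map_smul, MulOpposite.unop_smul, ConjugateAlgebra.equiv_symm_smul]

theorem starMap_apply (X : IIB D) :
    starMap hcirc X = (ConjugateAlgebra.equiv (IIB D)).symm (unop (starHom hcirc X)) := rfl

theorem starMap_mul (X Y : IIB D) :
    starMap hcirc (X * Y) = starMap hcirc Y * starMap hcirc X := by
  simp only [starMap_apply, map_mul, MulOpposite.unop_mul]

theorem starMap_one : starMap hcirc 1 = 1 := by
  simp only [starMap_apply, map_one, MulOpposite.unop_one]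

theorem starMap_gen (g : IIBGen A Ω 𝔛) : starMap hcirc (gen D g) = gen D (starGen D g) := by
  rw [starMap_apply, starHom, lift_gen, MulOpposite.unop_op, RingEquiv.symm_apply_apply]

theorem starMap_src (a : A) : starMap hcirc (src D a) = src D (star a) := starMap_gen hcirc _

theorem starMap_tgt (a : A) : starMap hcirc (tgt D a) = tgt D (star a) := starMap_gen hcirc _

theorem starMap_vf (x : 𝔛) (ω : Ω) :
    starMap hcirc (vf D x ω) = vf D (D.circledast x) (star ω) := starMap_gen hcirc _

theorem starMap_fv (ω : Ω) (y : 𝔛) :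
    starMap hcirc (fv D ω y) = fv D (star ω) (D.circledast y) := starMap_gen hcirc _

theorem starMap_starMap (X : IIB D) : starMap hcirc (starMap hcirc X) = X := by
  induction X using gen_induction with
  | one => rw [starMap_one, starMap_one]
  | add X Y hX hY => rw [map_add, map_add, hX, hY]
  | smul r X hX => rw [map_smulₛₗ, map_smulₛₗ, hX, Complex.conj_conj]
  | mul g X hX =>
    rw [starMap_mul, starMap_mul, hX, starMap_gen, starMap_gen]
    cases g <;> simp only [starGen, star_star, PivotalDual.circledast_circledast hcirc]

/-- The counit compatibility is the case `c = 1`. A general `c` is needed in the induction: for `gen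
D g * X` the generator acts first on both sides, and the hypothesis on `X` is then applied to its
result. -/
theorem act_starMap (X : IIB D) (c : A) :
    act D (starMap hcirc X) (star c) = star (act D (antipode D X) c) := by
  induction X using gen_induction generalizing c with
  | one => rw [starMap_one, antipode_one, map_one]; rfl
  | add X Y hX hY => simp only [map_add, LinearMap.add_apply, hX, hY, star_add]
  | smul r X hX =>
    simp only [map_smul, map_smulₛₗ, LinearMap.smul_apply, hX, star_smul]
    rfl
  | mul g X hX =>
    have hg : ∀ c, act D (starMap hcirc (gen D g)) (star c) =
        star (act D (antipode D (gen D g)) c) := fun c => by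
      cases g with
      | src a => rw [gen_src, starMap_src, antipode_src, act_src, act_tgt, star_mul]
      | tgt a => rw [gen_tgt, starMap_tgt, antipode_tgt, act_src, act_tgt, star_mul]
      | vf x ω =>
        rw [gen_vf, starMap_vf, antipode_vf, act_vf, act_fv, PivotalDual.evL_circledast hcirc,
          StarBimodule.star_smul_left, star_star, star_star, D.evR_mid]
      | fv ω y =>
        rw [gen_fv, starMap_fv, antipode_fv, act_vf, act_fv, ← D.evR_mid, D.evR_circledast,
          PivotalDual.star_op_smul, star_star, star_star]
    rw [starMap_mul, antipode_mul, map_mul, map_mul, Module.End.mul_apply, Module.End.mul_apply,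
      hg, hX]

theorem counit_starMap (X : IIB D) :
    op (counit D (starMap hcirc X)) = star (counitR D X) := by
  rw [counitR_apply, ← MulOpposite.op_star, counit_apply, counit_apply, ← act_starMap hcirc,
    star_one]

theorem map_starMap_mul (u v : IIB D ⊗[ℂ] IIB D) :
    TensorProduct.map (starMap hcirc) (starMap hcirc) (u * v) =
      TensorProduct.map (starMap hcirc) (starMap hcirc) v *
        TensorProduct.map (starMap hcirc) (starMap hcirc) u := by
  induction u using TensorProduct.induction_on with
  | zero => simp only [zero_mul, map_zero, mul_zero]
  | add u v hu hv => rw [add_mul, map_add, hu, hv, map_add, mul_add]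
  | tmul X Y =>
    induction v using TensorProduct.induction_on with
    | zero => simp only [zero_mul, map_zero, mul_zero]
    | add u v hu hv => rw [mul_add, map_add, hu, hv, map_add, add_mul]
    | tmul U V =>
      simp only [Algebra.TensorProduct.tmul_mul_tmul, TensorProduct.map_tmul, starMap_mul]

/-- The left coproducts of `(x, ω)` and `(ω, y)` insert `coevL` and `coevR` respectively, the right
ones insert the other, and the involution exchanges the two coevaluations. -/
theorem rcls_map_starMap_comulGen (g : IIBGen A Ω 𝔛) :
    rcls D (TensorProduct.map (starMap hcirc) (starMap hcirc) (comulGen D g)) =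
      comulR D (starMap hcirc (gen D g)) := by
  rw [starMap_gen, comulR_gen]
  cases g with
  | src a => rw [comulGen_src, TensorProduct.map_tmul, starMap_one, starMap_src]; rfl
  | tgt a => rw [comulGen_tgt, TensorProduct.map_tmul, starMap_one, starMap_tgt]; rfl
  | vf x ω =>
    simp only [comulGen_vf, starGen, comulGenR_vf, map_sum, TensorProduct.map_tmul, starMap_vf]
    exact D.sum_star_coevL (((TensorProduct.mk ℂ _ _).compl₁₂ (vfHom D (D.circledast x))
      ((vfHom D).flip (star ω))).compr₂ (rcls D)).flip fun a z ω' => by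
        change rcls D (vf D (D.circledast x) ω' ⊗ₜ vf D (op a • z) (star ω)) =
          rcls D (vf D (D.circledast x) (a • ω') ⊗ₜ vf D z (star ω))
        rw [← vf_mul_src, ← vf_mul_tgt, rcls_mul_tgt]
  | fv ω y =>
    simp only [comulGen_fv, starGen, comulGenR_fv, map_sum, TensorProduct.map_tmul, starMap_fv]
    exact D.sum_star_coevR hcirc (((TensorProduct.mk ℂ _ _).compl₁₂ (fvHom D (star ω))
      ((fvHom D).flip (D.circledast y))).compr₂ (rcls D)).flip fun a ω' z => by
        change rcls D (fv D (star ω) z ⊗ₜ fv D (op a • ω') (D.circledast y)) =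
          rcls D (fv D (star ω) (a • z) ⊗ₜ fv D ω' (D.circledast y))
        rw [← fv_mul_src, ← fv_mul_tgt, rcls_mul_tgt]

/-- The involution carries the left balancing to the right one and reverses products, so
multiplicativity of the right coproduct reduces the claim to generators; `comul_induction` applies
in its antilinear form. -/
theorem comulR_starMap {X : IIB D} {u : IIB D ⊗[ℂ] IIB D} (hu : lcls D u = comul D X) :
    rcls D (TensorProduct.map (starMap hcirc) (starMap hcirc) u) =
      comulR D (starMap hcirc X) := by
  refine comul_induction
    (f := (rcls D).comp (TensorProduct.map (starMap hcirc) (starMap hcirc)))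
    (g := (comulR D).comp (starMap hcirc)) (fun a X Y => ?_) ?_ (fun γ X u _ h => ?_) hu
  · change rcls D (starMap hcirc (tgt D a * X) ⊗ₜ starMap hcirc Y) =
      rcls D (starMap hcirc X ⊗ₜ starMap hcirc (src D a * Y))
    rw [starMap_mul, starMap_mul, starMap_tgt, starMap_src, rcls_mul_tgt]
  · change rcls D (starMap hcirc 1 ⊗ₜ starMap hcirc 1) = comulR D (starMap hcirc 1)
    rw [starMap_one, comulR_one]; rfl
  · change rcls D (TensorProduct.map (starMap hcirc) (starMap hcirc) (comulGen D γ * u)) =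
      comulR D (starMap hcirc (gen D γ * X))
    rw [starMap_mul, map_starMap_mul]
    exact (comulR_mul D h (rcls_map_starMap_comulGen hcirc γ)).symm

/-- The full `⋆`-Hopf algebroid structure of `IIB(Ω)`. -/
def fullStarHopfAlgebroid : FullStarHopfAlgebroid A (IIB D) where
  toFullHopfAlgebroid := fullHopfAlgebroid D
  st := starMap hcirc
  st_st := starMap_starMap hcirc
  st_mul := starMap_mul hcirc
  st_s := starMap_src hcirc
  st_t := starMap_tgt hcirc
  st_ε := counit_starMap hcirc
  st_Δ _ _ hu := (comulR_starMap hcirc hu).symm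

end StarHopf

end IIB

end

/-! ### The proposition -/

theorem proposition5p3
    {A Ω 𝔛 : Type*} [Ring A] [Algebra ℂ A] [StarRing A] [StarModule ℂ A]
    [AddCommGroup Ω] [Module ℂ Ω] [Module A Ω] [Module Aᵐᵒᵖ Ω] [SMulCommClass A Aᵐᵒᵖ Ω]
    [IsScalarTower ℂ A Ω] [IsScalarTower ℂ Aᵐᵒᵖ Ω]
    [AddCommGroup 𝔛] [Module ℂ 𝔛] [Module A 𝔛] [Module Aᵐᵒᵖ 𝔛] [SMulCommClass A Aᵐᵒᵖ 𝔛]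
    [IsScalarTower ℂ A 𝔛] [IsScalarTower ℂ Aᵐᵒᵖ 𝔛]
    [StarBimodule A Ω] (D : PivotalDual A Ω 𝔛)
    (hcirc : D.circledast = D.circledast.symm) :
    ∃ H : FullStarHopfAlgebroid A (IIB D),
      -- the left bialgebroid
      (∀ a : A, H.L.s a = IIB.src D a) ∧
      (∀ a : A, H.L.t (MulOpposite.op a) = IIB.tgt D a) ∧
      (∀ (ω : Ω) (y : 𝔛), H.L.Δ (IIB.fv D ω y) =
        LTensor.cls H.L.s H.L.t (∑ j, IIB.fv D ω (D.y j) ⊗ₜ[ℂ] IIB.fv D (D.η j) y)) ∧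
      (∀ (x : 𝔛) (ω : Ω), H.L.Δ (IIB.vf D x ω) =
        LTensor.cls H.L.s H.L.t (∑ i, IIB.vf D x (D.w i) ⊗ₜ[ℂ] IIB.vf D (D.x i) ω)) ∧
      (∀ (ω : Ω) (y : 𝔛), H.L.ε (IIB.fv D ω y) = D.evR ω y) ∧
      (∀ (x : 𝔛) (ω : Ω), H.L.ε (IIB.vf D x ω) = D.evL x ω) ∧
      -- the antipode
      (∀ (x : 𝔛) (ω : Ω), H.S (IIB.vf D x ω) = IIB.fv D ω x) ∧
      (∀ (ω : Ω) (x : 𝔛), H.S (IIB.fv D ω x) = IIB.vf D x ω) ∧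
      -- the right bialgebroid
      (∀ a : A, H.R.s (MulOpposite.op a) = IIB.tgt D a) ∧
      (∀ a : A, H.R.t (MulOpposite.op (MulOpposite.op a)) = IIB.src D a) ∧
      (∀ (ω : Ω) (y : 𝔛), H.R.Δ (IIB.fv D ω y) =
        RTensor.cls H.R.s H.R.t (∑ i, IIB.fv D ω (D.x i) ⊗ₜ[ℂ] IIB.fv D (D.w i) y)) ∧
      (∀ (x : 𝔛) (ω : Ω), H.R.Δ (IIB.vf D x ω) =
        RTensor.cls H.R.s H.R.t (∑ j, IIB.vf D x (D.η j) ⊗ₜ[ℂ] IIB.vf D (D.y j) ω)) ∧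
      (∀ (ω : Ω) (y : 𝔛), H.R.ε (IIB.fv D ω y) = MulOpposite.op (D.evL y ω)) ∧
      (∀ (x : 𝔛) (ω : Ω), H.R.ε (IIB.vf D x ω) = MulOpposite.op (D.evR ω x)) ∧
      -- the `⋆`-structure
      (∀ a : A, H.st (H.L.s a) = IIB.src D (star a)) ∧
      (∀ a : A, H.st (H.L.t (MulOpposite.op a)) = IIB.tgt D (star a)) ∧
      (∀ (ω : Ω) (y : 𝔛), H.st (IIB.fv D ω y) = IIB.fv D (star ω) (D.circledast y)) ∧
      (∀ (x : 𝔛) (ω : Ω), H.st (IIB.vf D x ω) = IIB.vf D (D.circledast x) (star ω)) :=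
  ⟨IIB.fullStarHopfAlgebroid hcirc, fun _ => rfl, fun _ => rfl, IIB.comul_fv D, IIB.comul_vf D,
    IIB.counit_fv D, IIB.counit_vf D, IIB.antipode_vf D, IIB.antipode_fv D, fun _ => rfl,
    fun _ => rfl, fun ω y => IIB.comulR_gen D (.fv ω y), fun x ω => IIB.comulR_gen D (.vf x ω),
    fun ω y => congrArg MulOpposite.op
      ((congrArg (IIB.counit D) (IIB.antipode_fv D ω y)).trans (IIB.counit_vf D y ω)),
    fun x ω => congrArg MulOpposite.op
      ((congrArg (IIB.counit D) (IIB.antipode_vf D x ω)).trans (IIB.counit_fv D ω x)),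
    IIB.starMap_src hcirc, IIB.starMap_tgt hcirc, IIB.starMap_fv hcirc, IIB.starMap_vf hcirc⟩
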